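/- Notation. For $A,B\subseteq\mathbb Q$ let $A+B=\{x+y: x\in A,\ y\in B\}$; let $\mathbb Q^2$ be the set of all rational squares (including $0$), $\mathbb Z_{(l)}$ the localization of $\mathbb Z$ at the prime $l$, $v_l$ the $l$-adic valuation, and $J(R)$ the Jacobson radical of a ring $R$. For $a,b\in\mathbb Q^\times$ put $$S_{a,b}=\{2x_1 : x_1,x_2,x_3,x_4\in\mathbb Q,\ x_1^2-ax_2^2-bx_3^2+abx_4^2=1\},\qquad T_{a,b}=S_{a,b}+S_{a,b},$$ $T_{a,b}^\times=\{u\in T_{a,b}: uv=1\text{ for some }v\in T_{a,b}\}$, and let $J_{a,b}$ be the set of all $x\in\mathbb Q$ for which there are $y_1,y_2\in\mathbb Q$ with $$y_1,\,x-y_1\in a\,\mathbb Q^2\,T_{a,b}^\times\cap(1-\mathbb Q^2\,T_{a,b}^\times),\qquad y_2,\,x-y_2\in b\,\mathbb Q^2\,T_{a,b}^\times\cap(1-\mathbb Q^2\,T_{a,b}^\times).$$ For $p,q\in\mathbb Q^\times$ put $R_q^{[3]}=T_{-q,-q}+T_{2q,-q}$ and $R_{p,q}^{[1]}=T_{2pq,q}+T_{-2pq,q}$.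 For $k\in\{1,3\}$ let $\Phi_k$ be the set of $p\in\mathbb Q^\times$ such that $p\in k+8\mathbb Z_{(2)}$ and every prime $l$ with $v_l(p)$ odd satisfies $l\equiv 1$ or $l\equiv k\pmod 8$. Let $$\Psi=\{(p,q)\in\Phi_1\times\Phi_3 : p\in 2\cdot(\mathbb Q^\times)^2\cdot(1+J(R_q^{[3]}))\},$$ where, since $R_q^{[3]}$ is a subring of $\mathbb Q$ for $q\in\Phi_3$, $J(R_q^{[3]})$ is its Jacobson radical. A set $D\subseteq\mathbb Q^k$ is diophantine in $\mathbb Q$ if for some $n$ there is a polynomial $f\in\mathbb Z[t_1,\dots,t_k,x_1,\dots,x_n]$ such that $t\in D$ if and only if $f(t,x)=0$ for some $x\in\mathbb Q^n$. Proposition. For every $(p,q)\in\Psi$, the set $R_{p,q}^{[1]}$ is a subring of $\mathbb Q$, $R_{p,q}^{[1]}\neq\mathbb Q$, and $$J(R_{p,q}^{[1]})=J_{2pq,q}+J_{-2pq,q};$$ in particular $J(R_{p,q}^{[1]})$ is diophantine in $\mathbb Q$. Moreover it is so uniformly in $(p,q)$: there is a diophantine set $D\subseteq\mathbb Q^3$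 such that for all $(p,q)\in\Psi$ and all $t\in\mathbb Q$, $t\in J(R_{p,q}^{[1]})$ if and only if $(t,p,q)\in D$. -/

import Mathlib

open scoped Pointwise

namespace RatDioph

/-- Traces of norm-one elements of the quaternion algebra `(a, b)` over `ℚ`. -/
def S (a b : ℚ) : Set ℚ :=
  {t | ∃ x₁ x₂ x₃ x₄ : ℚ,
    x₁ ^ 2 - a * x₂ ^ 2 - b * x₃ ^ 2 + a * b * x₄ ^ 2 = 1 ∧ t = 2 * x₁}

/-- `T_{a,b} = S_{a,b} + S_{a,b}` (elementwise sums). -/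
def T (a b : ℚ) : Set ℚ := S a b + S a b

/-- The invertible elements of `T_{a,b}`; this makes sense also when `T_{a,b}` is not a ring. -/
def TUnits (a b : ℚ) : Set ℚ := {u | u ∈ T a b ∧ ∃ v ∈ T a b, u * v = 1}

/-- `c · ℚ² · T_{a,b}^×`, where `ℚ²` is the set of all rational squares, including `0`. -/
def sqClass (a b c : ℚ) : Set ℚ := {x | ∃ w : ℚ, ∃ u ∈ TUnits a b, x = c * w ^ 2 * u}

/-- `c · ℚ² · T_{a,b}^× ∩ (1 - ℚ² · T_{a,b}^×)`. -/
def K (a b c : ℚ) : Set ℚ := {y | y ∈ sqClass a b c ∧ ∃ z ∈ sqClass a b 1, y = 1 - z}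

/-- The set `J_{a,b}`. -/
def J (a b : ℚ) : Set ℚ :=
  {x | ∃ y₁ y₂ : ℚ, (y₁ ∈ K a b a ∧ x - y₁ ∈ K a b a) ∧ (y₂ ∈ K a b b ∧ x - y₂ ∈ K a b b)}

/-- `R_p^{[3]} = T_{-p,-p} + T_{2p,-p}`. -/
def R3 (p : ℚ) : Set ℚ := T (-p) (-p) + T (2 * p) (-p)

/-- `R_{p,q}^{[1]} = T_{2pq,q} + T_{-2pq,q}`. -/
def R1 (p q : ℚ) : Set ℚ := T (2 * p * q) q + T (-2 * p * q) q

/-- The Jacobson radical, as a set of rationals, of the subring of `ℚ` generated by `R`.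
If `R` is (the underlying set of) a subring, then this is the Jacobson radical of `R` itself. -/
def jacobsonRadical (R : Set ℚ) : Set ℚ :=
  (fun x : Subring.closure R => (x : ℚ)) '' (Ring.jacobson (Subring.closure R) : Set _)

/-- The local ring `ℤ_(l)`, for `l` prime: rationals whose reduced denominator is prime to `l`. -/
def ZLoc (l : ℕ) : Set ℚ := {x | ¬ l ∣ x.den}

/-- `p ≡₂ k mod 8`, that is `p ∈ k + 8 ℤ_(2)`. -/
def CongTwo (p : ℚ) (k : ℕ) : Prop := ∃ z ∈ ZLoc 2, p = k + 8 * z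

/-- The primes at which `p` has odd valuation. -/
def oddPrimes (p : ℚ) : Set ℕ := {l | l.Prime ∧ Odd (padicValRat l p)}

/-- `Φ_k`: nonzero rationals `p ≡₂ k mod 8` such that every prime at which `p` has odd valuation
is congruent to `1` or `k` modulo `8`. -/
def Φ (k : ℕ) : Set ℚ :=
  {p | p ≠ 0 ∧ CongTwo p k ∧ ∀ l ∈ oddPrimes p, l ≡ 1 [MOD 8] ∨ l ≡ k [MOD 8]}

/-- `Ψ`: pairs `(p, q) ∈ Φ₁ × Φ₃` with `p ∈ 2 · (ℚ^×)² · (1 + J(R_q^{[3]}))`. -/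
def Ψ : Set (ℚ × ℚ) :=
  {x | x.1 ∈ Φ 1 ∧ x.2 ∈ Φ 3 ∧
    ∃ w : ℚ, w ≠ 0 ∧ ∃ j ∈ jacobsonRadical (R3 x.2), x.1 = 2 * w ^ 2 * (1 + j)}

/-- `D ⊆ ℚ^k` is diophantine in `ℚ`: it is the projection of the set of rational zeros of a
polynomial with integer coefficients. -/
def IsDiophantine {k : ℕ} (D : Set (Fin k → ℚ)) : Prop :=
  ∃ (n : ℕ) (f : MvPolynomial (Fin k ⊕ Fin n) ℤ),
    ∀ t : Fin k → ℚ, t ∈ D ↔ ∃ x : Fin n → ℚ, MvPolynomial.aeval (Sum.elim t x) f = 0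

theorem jacobsonRadical_coe (A : Subring ℚ) :
    jacobsonRadical (A : Set ℚ) = (fun x : A => (x : ℚ)) '' (Ring.jacobson A : Set A) := by
  unfold jacobsonRadical
  rw [Subring.closure_eq]

end RatDioph

/-!
For `c = ±2pq`, an element of odd `2`-adic valuation up to squares, `T c q` is the semilocal ring of
rationals integral at the finite primes where the quaternion algebra `(q, c)` over `ℚ` ramifies. At
such a prime the norm form is anisotropic, which forces traces of norm-one elements to be integral.
Conversely, a rational `t = n / m` integral at these primes is `A / m + (n - A) / m`, where the
Chinese remainder theorem and a count of quadratic residues provide `A` such that `A² - 4m²` and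
`(n - A)² - 4m²` are nonsquares at all ramified primes. Both summands are then traces, because such
a discriminant is represented by the ternary form `⟨c, q, -cq⟩`: one chooses, by Dirichlet's theorem
on primes in progressions, a value represented by both of the binary forms into which the problem
splits, and Legendre's theorem together with quadratic reciprocity does the rest.

Sums of semilocal rings, or of their Jacobson radicals, correspond to the intersection of the sets
of primes, so everything follows once `(q, 2pq)` and `(q, -2pq)` ramify at a common prime. By
reciprocity `(q, 2pq)` ramifies at some odd prime `l`; the condition defining `Ψ` excludes
`l ≡ 3 mod 8`, and for `l ≡ 1 mod 8` the sign does not matter.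
-/

namespace RatDioph

/-! ### Hilbert symbols at odd primes -/

/-- The cofactor of the largest power of `l` dividing `n`; it is `0` for `n = 0`. -/
def unitPart (l : ℕ) (n : ℤ) : ℤ := n / (l : ℤ) ^ padicValInt l n

/-- The quadratic character modulo an odd prime `l` of the `l`-adic unit `n / l ^ v_l(n)`.
Together with the parity of `v_l(n)` it determines the class of `n` in `ℚ_l^× / (ℚ_l^×)²`. -/
def unitChar (l : ℕ) (n : ℤ) : ℤ := jacobiSym (unitPart l n) l

/-- The Hilbert symbol of two nonzero integers at an odd prime `l`. -/
def hilbertSymbol (l : ℕ) (m n : ℤ) : ℤ :=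
  unitChar l (-1) ^ (padicValInt l m * padicValInt l n) * unitChar l m ^ padicValInt l n *
    unitChar l n ^ padicValInt l m

theorem pow_mul_unitPart (l : ℕ) (n : ℤ) : (l : ℤ) ^ padicValInt l n * unitPart l n = n :=
  Int.mul_ediv_cancel' (padicValInt_dvd n)

theorem not_dvd_unitPart {l : ℕ} (hl : l.Prime) {n : ℤ} (hn : n ≠ 0) :
    ¬ (l : ℤ) ∣ unitPart l n := by
  have := Fact.mk hl
  rintro ⟨k, hk⟩
  have h := pow_mul_unitPart l n
  rw [hk, ← mul_assoc, ← pow_succ] at h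
  have := (padicValInt_dvd_iff (p := l) (padicValInt l n + 1) n).1 ⟨k, h.symm⟩
  omega

theorem padicValInt_neg (l : ℕ) (n : ℤ) : padicValInt l (-n) = padicValInt l n := by
  simp [padicValInt]

theorem padicValInt_pow_mul {l : ℕ} (hl : l.Prime) (k : ℕ) {u : ℤ} (hu : ¬ (l : ℤ) ∣ u) :
    padicValInt l ((l : ℤ) ^ k * u) = k := by
  have := Fact.mk hl
  have hl0 : (l : ℤ) ≠ 0 := by exact_mod_cast hl.ne_zero
  have hu0 : u ≠ 0 := fun h => hu (h ▸ dvd_zero _)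
  rw [padicValInt.mul (pow_ne_zero _ hl0) hu0, padicValInt.eq_zero_of_not_dvd hu, ← Nat.cast_pow,
    padicValInt.of_nat, padicValNat.prime_pow, add_zero]

theorem unitPart_pow_mul {l : ℕ} (hl : l.Prime) (k : ℕ) {u : ℤ} (hu : ¬ (l : ℤ) ∣ u) :
    unitPart l ((l : ℤ) ^ k * u) = u := by
  have hl0 : (l : ℤ) ≠ 0 := by exact_mod_cast hl.ne_zero
  rw [unitPart, padicValInt_pow_mul hl k hu, Int.mul_ediv_cancel_left _ (pow_ne_zero _ hl0)]

theorem unitPart_mul {l : ℕ} (hl : l.Prime) {m n : ℤ} (hm : m ≠ 0) (hn : n ≠ 0) :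
    unitPart l (m * n) = unitPart l m * unitPart l n := by
  have h : m * n = (l : ℤ) ^ (padicValInt l m + padicValInt l n) *
      (unitPart l m * unitPart l n) := by
    conv_lhs => rw [← pow_mul_unitPart l m, ← pow_mul_unitPart l n]
    ring
  conv_lhs => rw [h]
  exact unitPart_pow_mul hl _ <| (Nat.prime_iff_prime_int.1 hl).not_dvd_mul
    (not_dvd_unitPart hl hm) (not_dvd_unitPart hl hn)

theorem jacobiSym_congr {l : ℕ} {m n : ℤ} (h : (l : ℤ) ∣ m - n) :
    jacobiSym m l = jacobiSym n l :=
  jacobiSym.mod_left' (Int.emod_eq_emod_iff_emod_sub_eq_zero.2 (Int.emod_eq_zero_of_dvd h))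

theorem jacobiSym_eq_one_or {l : ℕ} (hl : l.Prime) {n : ℤ} (hn : ¬ (l : ℤ) ∣ n) :
    jacobiSym n l = 1 ∨ jacobiSym n l = -1 := by
  refine jacobiSym.eq_one_or_neg_one ?_
  rw [Int.gcd_comm]
  exact Int.isCoprime_iff_gcd_eq_one.1
    ((Nat.prime_iff_prime_int.1 hl).coprime_iff_not_dvd.2 hn)

theorem unitChar_eq_one_or {l : ℕ} (hl : l.Prime) {n : ℤ} (hn : n ≠ 0) :
    unitChar l n = 1 ∨ unitChar l n = -1 :=
  jacobiSym_eq_one_or hl (not_dvd_unitPart hl hn)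

theorem isUnit_unitChar {l : ℕ} (hl : l.Prime) {n : ℤ} (hn : n ≠ 0) : IsUnit (unitChar l n) :=
  Int.isUnit_iff.2 (unitChar_eq_one_or hl hn)

theorem unitChar_mul {l : ℕ} (hl : l.Prime) {m n : ℤ} (hm : m ≠ 0) (hn : n ≠ 0) :
    unitChar l (m * n) = unitChar l m * unitChar l n := by
  rw [unitChar, unitPart_mul hl hm hn, jacobiSym.mul_left]
  rfl

theorem unitChar_mul_self {l : ℕ} (hl : l.Prime) {n : ℤ} (hn : n ≠ 0) :
    unitChar l n * unitChar l n = 1 :=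
  Int.isUnit_mul_self (isUnit_unitChar hl hn)

theorem unitChar_pow_of_even {l : ℕ} (hl : l.Prime) {n : ℤ} (hn : n ≠ 0) {k : ℕ} (hk : Even k) :
    unitChar l n ^ k = 1 := by
  obtain ⟨j, rfl⟩ := hk
  rw [pow_add, ← mul_pow, unitChar_mul_self hl hn, one_pow]

theorem unitChar_of_not_dvd {l : ℕ} {n : ℤ} (hn : ¬ (l : ℤ) ∣ n) :
    unitChar l n = jacobiSym n l := by
  rw [unitChar, unitPart, padicValInt.eq_zero_of_not_dvd hn, pow_zero, Int.ediv_one]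

theorem unitChar_pow_mul {l : ℕ} (hl : l.Prime) (k : ℕ) {u : ℤ} (hu : ¬ (l : ℤ) ∣ u) :
    unitChar l ((l : ℤ) ^ k * u) = jacobiSym u l := by
  rw [unitChar, unitPart_pow_mul hl k hu]

theorem unitChar_self {l : ℕ} (hl : l.Prime) : unitChar l l = 1 := by
  simpa using unitChar_pow_mul hl 1 (u := 1) (by exact_mod_cast hl.not_dvd_one)

theorem unitChar_neg_one {l : ℕ} (hl : l.Prime) (h2 : l ≠ 2) : unitChar l (-1) = ZMod.χ₄ l := by
  rw [unitChar_of_not_dvd (by rw [dvd_neg]; exact_mod_cast hl.not_dvd_one),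
    jacobiSym.at_neg_one (hl.odd_of_ne_two h2)]

/-- An `l`-adic perturbation of relative size less than `1` does not change the square class. -/
theorem padicValInt_eq_and_unitChar_eq {l : ℕ} (hl : l.Prime) {m n : ℤ} (hm : m ≠ 0)
    (h : (l : ℤ) ^ (padicValInt l m + 1) ∣ n - m) :
    padicValInt l n = padicValInt l m ∧ unitChar l n = unitChar l m := by
  obtain ⟨k, hk⟩ := h
  have hn : n = (l : ℤ) ^ padicValInt l m * (unitPart l m + l * k) := by
    linear_combination hk - pow_mul_unitPart l m
  have hu : ¬ (l : ℤ) ∣ unitPart l m + l * k := fun hd =>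
    not_dvd_unitPart hl hm ((dvd_add_left (dvd_mul_right _ _)).1 hd)
  rw [hn, padicValInt_pow_mul hl _ hu, unitChar_pow_mul hl _ hu]
  exact ⟨rfl, jacobiSym_congr ⟨k, by ring⟩⟩

theorem hilbertSymbol_comm (l : ℕ) (m n : ℤ) : hilbertSymbol l m n = hilbertSymbol l n m := by
  unfold hilbertSymbol
  rw [mul_comm (padicValInt l m)]
  ring

theorem hilbertSymbol_mul_right {l : ℕ} (hl : l.Prime) {m n : ℤ} (a : ℤ) (hm : m ≠ 0)
    (hn : n ≠ 0) : hilbertSymbol l a (m * n) = hilbertSymbol l a m * hilbertSymbol l a n := by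
  have := Fact.mk hl
  unfold hilbertSymbol
  rw [padicValInt.mul hm hn, unitChar_mul hl hm hn, mul_add, pow_add, pow_add, mul_pow]
  ring

theorem hilbertSymbol_mul_left {l : ℕ} (hl : l.Prime) {m n : ℤ} (a : ℤ) (hm : m ≠ 0)
    (hn : n ≠ 0) : hilbertSymbol l (m * n) a = hilbertSymbol l m a * hilbertSymbol l n a := by
  simp only [hilbertSymbol_comm l _ a, hilbertSymbol_mul_right hl a hm hn]

theorem isUnit_hilbertSymbol {l : ℕ} (hl : l.Prime) {m n : ℤ} (hm : m ≠ 0) (hn : n ≠ 0) :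
    IsUnit (hilbertSymbol l m n) :=
  (((isUnit_unitChar hl (neg_ne_zero.2 one_ne_zero)).pow _).mul ((isUnit_unitChar hl hm).pow _)).mul
    ((isUnit_unitChar hl hn).pow _)

theorem hilbertSymbol_eq_one_or {l : ℕ} (hl : l.Prime) {m n : ℤ} (hm : m ≠ 0) (hn : n ≠ 0) :
    hilbertSymbol l m n = 1 ∨ hilbertSymbol l m n = -1 :=
  Int.isUnit_iff.1 (isUnit_hilbertSymbol hl hm hn)

theorem hilbertSymbol_mul_self {l : ℕ} (hl : l.Prime) {m n : ℤ} (hm : m ≠ 0) (hn : n ≠ 0) :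
    hilbertSymbol l m n * hilbertSymbol l m n = 1 :=
  Int.isUnit_mul_self (isUnit_hilbertSymbol hl hm hn)

theorem hilbertSymbol_sq_right {l : ℕ} (hl : l.Prime) {a k : ℤ} (ha : a ≠ 0) (hk : k ≠ 0) :
    hilbertSymbol l a (k ^ 2) = 1 := by
  rw [sq, hilbertSymbol_mul_right hl a hk hk, hilbertSymbol_mul_self hl ha hk]

theorem hilbertSymbol_mul_sq_right {l : ℕ} (hl : l.Prime) {a n k : ℤ} (ha : a ≠ 0) (hn : n ≠ 0)
    (hk : k ≠ 0) : hilbertSymbol l a (n * k ^ 2) = hilbertSymbol l a n := by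
  rw [hilbertSymbol_mul_right hl a hn (pow_ne_zero 2 hk), hilbertSymbol_sq_right hl ha hk, mul_one]

theorem hilbertSymbol_of_not_dvd_left {l : ℕ} {m : ℤ} (n : ℤ) (hm : ¬ (l : ℤ) ∣ m) :
    hilbertSymbol l m n = jacobiSym m l ^ padicValInt l n := by
  rw [hilbertSymbol, padicValInt.eq_zero_of_not_dvd hm, unitChar_of_not_dvd hm, zero_mul, pow_zero,
    pow_zero, one_mul, mul_one]

theorem hilbertSymbol_of_not_dvd_right {l : ℕ} (m : ℤ) {n : ℤ} (hn : ¬ (l : ℤ) ∣ n) :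
    hilbertSymbol l m n = jacobiSym n l ^ padicValInt l m := by
  rw [hilbertSymbol_comm, hilbertSymbol_of_not_dvd_left m hn]

theorem hilbertSymbol_of_not_dvd {l : ℕ} {m n : ℤ} (hm : ¬ (l : ℤ) ∣ m) (hn : ¬ (l : ℤ) ∣ n) :
    hilbertSymbol l m n = 1 := by
  rw [hilbertSymbol_of_not_dvd_left n hm, padicValInt.eq_zero_of_not_dvd hn, pow_zero]

theorem hilbertSymbol_of_even_padicValInt {l : ℕ} (hl : l.Prime) {m n : ℤ} (hm : m ≠ 0)
    (hn : Even (padicValInt l n)) :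
    hilbertSymbol l m n = unitChar l n ^ padicValInt l m := by
  rw [hilbertSymbol, unitChar_pow_of_even hl (neg_ne_zero.2 one_ne_zero) (hn.mul_left _),
    unitChar_pow_of_even hl hm hn, one_mul, one_mul]

theorem hilbertSymbol_neg_self {l : ℕ} (hl : l.Prime) {a : ℤ} (ha : a ≠ 0) :
    hilbertSymbol l a (-a) = 1 := by
  have hε : (-1 : ℤ) ≠ 0 := neg_ne_zero.2 one_ne_zero
  have hc : unitChar l (-a) = unitChar l (-1) * unitChar l a := by
    rw [← unitChar_mul hl hε ha, neg_one_mul]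
  have hv : Even (padicValInt l a * padicValInt l a + padicValInt l a) :=
    Nat.even_mul_succ_self (padicValInt l a)
  calc hilbertSymbol l a (-a)
      = unitChar l (-1) ^ (padicValInt l a * padicValInt l a + padicValInt l a) *
          (unitChar l a * unitChar l a) ^ padicValInt l a := by
        rw [hilbertSymbol, padicValInt_neg, hc, pow_add, mul_pow, mul_pow]
        ring
    _ = 1 := by rw [unitChar_pow_of_even hl hε hv, unitChar_mul_self hl ha, one_pow, one_mul]

theorem hilbertSymbol_congr_right {l : ℕ} (hl : l.Prime) (a : ℤ) {m n : ℤ} (hm : m ≠ 0)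
    (h : (l : ℤ) ^ (padicValInt l m + 1) ∣ n - m) :
    hilbertSymbol l a n = hilbertSymbol l a m := by
  obtain ⟨hv, hχ⟩ := padicValInt_eq_and_unitChar_eq hl hm h
  rw [hilbertSymbol, hv, hχ, hilbertSymbol]

theorem hilbertSymbol_sq_sub {l : ℕ} (hl : l.Prime) {a t : ℤ} (ha : a ≠ 0)
    (hn : t ^ 2 - a ≠ 0) : hilbertSymbol l a (t ^ 2 - a) = 1 := by
  have := Fact.mk hl
  rcases eq_or_ne t 0 with rfl | ht
  · simpa using hilbertSymbol_neg_self hl ha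
  have ht2 : t ^ 2 ≠ 0 := pow_ne_zero 2 ht
  have hvt : padicValInt l (t ^ 2) = padicValInt l t + padicValInt l t := by
    rw [sq, padicValInt.mul ht ht]
  rcases lt_trichotomy (padicValInt l (t ^ 2)) (padicValInt l a) with h | h | h
  · rw [hilbertSymbol_congr_right hl a ht2, hilbertSymbol_sq_right hl ha ht]
    rw [sub_sub_cancel_left, dvd_neg, padicValInt_dvd_iff]
    exact Or.inr h
  · have hae : Even (padicValInt l a) := ⟨_, h.symm.trans hvt⟩
    by_cases hd : (l : ℤ) ^ (padicValInt l a + 1) ∣ t ^ 2 - a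
    · rw [hilbertSymbol_comm, hilbertSymbol_of_even_padicValInt hl hn hae,
        ← (padicValInt_eq_and_unitChar_eq hl ha hd).2, sq, unitChar_mul hl ht ht,
        unitChar_mul_self hl ht, one_pow]
    · have hle : padicValInt l a ≤ padicValInt l (t ^ 2 - a) := by
        have : (l : ℤ) ^ padicValInt l a ∣ t ^ 2 - a :=
          dvd_sub (h ▸ padicValInt_dvd _) (padicValInt_dvd _)
        exact ((padicValInt_dvd_iff _ _).1 this).resolve_left hn
      have hne : Even (padicValInt l (t ^ 2 - a)) := by
        rw [padicValInt_dvd_iff] at hd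
        rwa [show padicValInt l (t ^ 2 - a) = padicValInt l a by omega]
      rw [hilbertSymbol_of_even_padicValInt hl ha hne, unitChar_pow_of_even hl hn hae]
  · rw [hilbertSymbol_congr_right hl a (neg_ne_zero.2 ha), hilbertSymbol_neg_self hl ha]
    rw [sub_neg_eq_add, sub_add_cancel, padicValInt_neg, padicValInt_dvd_iff]
    exact Or.inr h

/-! ### Legendre's theorem -/

theorem exists_forall_dvd_sub {ι : Type*} {s : Finset ι} {m : ι → ℤ}
    (hm : (s : Set ι).Pairwise (Function.onFun IsCoprime m)) (a : ι → ℤ) :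
    ∃ A : ℤ, ∀ i ∈ s, m i ∣ A - a i := by
  obtain ⟨A, hA⟩ := Ideal.exists_forall_sub_mem_ideal (I := fun i : s => Ideal.span {m i})
    (fun i j hij => (Ideal.isCoprime_span_singleton_iff _ _).2
      (hm i.2 j.2 (Subtype.coe_injective.ne hij))) (fun i => a i)
  exact ⟨A, fun i hi => Ideal.mem_span_singleton.1 (hA ⟨i, hi⟩)⟩

theorem exists_forall_prime_pow_dvd_sub {P : Finset ℕ} (hP : ∀ l ∈ P, l.Prime) (n : ℕ → ℕ)
    (a : ℕ → ℤ) : ∃ A : ℤ, ∀ l ∈ P, (l : ℤ) ^ n l ∣ A - a l :=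
  exists_forall_dvd_sub (fun l hl k hk hlk => IsCoprime.pow <| Nat.isCoprime_iff_coprime.2 <|
    (Nat.coprime_primes (hP l hl) (hP k hk)).2 hlk) a

theorem exists_dvd_sq_sub {l : ℕ} (hl : l.Prime) {a : ℤ} (ha : jacobiSym a l = 1) :
    ∃ n : ℤ, (l : ℤ) ∣ n ^ 2 - a := by
  have := Fact.mk hl
  obtain ⟨x, hx⟩ := ZMod.isSquare_of_jacobiSym_eq_one ha
  refine ⟨x.val, ?_⟩
  rw [← ZMod.intCast_zmod_eq_zero_iff_dvd]
  push_cast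
  rw [ZMod.natCast_zmod_val, hx]
  ring

theorem exists_dvd_sq_sub_of_squarefree {a b : ℤ} (hb : Squarefree b)
    (h : ∀ l : ℕ, l.Prime → (l : ℤ) ∣ b → ∃ t : ℤ, (l : ℤ) ∣ t ^ 2 - a) :
    ∃ t : ℤ, b ∣ t ^ 2 - a := by
  have hsq : Squarefree b.natAbs := Int.squarefree_natAbs.2 hb
  choose! t ht using h
  obtain ⟨s, hs⟩ := exists_forall_prime_pow_dvd_sub (P := b.natAbs.primeFactors)
    (fun _ => Nat.prime_of_mem_primeFactors) (fun _ => 1) t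
  refine ⟨s, Int.natAbs_dvd.1 ?_⟩
  rw [← Nat.prod_primeFactors_of_squarefree hsq, Nat.cast_prod]
  refine Finset.prod_dvd_of_coprime (fun l hl k hk hlk => ?_) fun l hl => ?_
  · exact Nat.isCoprime_iff_coprime.2 ((Nat.coprime_primes (Nat.prime_of_mem_primeFactors hl)
      (Nat.prime_of_mem_primeFactors hk)).2 hlk)
  · have hsl : (l : ℤ) ∣ s - t l := by simpa only [pow_one] using hs l hl
    have htl := ht l (Nat.prime_of_mem_primeFactors hl)
      (Int.natCast_dvd.2 (Nat.dvd_of_mem_primeFactors hl))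
    have e : s ^ 2 - a = (s - t l) * (s + t l) + (t l ^ 2 - a) := by ring
    exact e ▸ dvd_add (hsl.mul_right _) htl

theorem exists_sq_mul_squarefree_int {n : ℤ} (hn : n ≠ 0) :
    ∃ m k : ℤ, n = m * k ^ 2 ∧ Squarefree m ∧ m ≠ 0 ∧ k ≠ 0 := by
  obtain ⟨a, b, h, ha⟩ := Nat.sq_mul_squarefree n.natAbs
  have e : n = (n.sign * a) * (b : ℤ) ^ 2 := by
    conv_lhs => rw [← Int.sign_mul_natAbs n, ← h]
    push_cast
    ring
  have h0 : (n.sign * a : ℤ) * (b : ℤ) ^ 2 ≠ 0 := e ▸ hn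
  refine ⟨n.sign * a, b, e, ?_, left_ne_zero_of_mul h0,
    ne_zero_pow two_ne_zero (right_ne_zero_of_mul h0)⟩
  rw [← Int.squarefree_natAbs]
  simpa [Int.natAbs_mul, Int.natAbs_sign_of_ne_zero hn] using ha

theorem padicValInt_eq_one_of_squarefree {l : ℕ} (hl : l.Prime) {b : ℤ} (hb : Squarefree b)
    (h : (l : ℤ) ∣ b) : padicValInt l b = 1 := by
  obtain ⟨c, rfl⟩ := h
  have hc : ¬ (l : ℤ) ∣ c := fun hd =>
    (Nat.prime_iff_prime_int.1 hl).not_isUnit (hb l (mul_dvd_mul_left _ hd))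
  simpa using padicValInt_pow_mul hl 1 hc

theorem exists_dvd_sq_sub_of_hilbertSymbol {a b : ℤ} (hb : Squarefree b)
    (h : ∀ l : ℕ, l.Prime → l ≠ 2 → hilbertSymbol l a b = 1) : ∃ t : ℤ, b ∣ t ^ 2 - a := by
  refine exists_dvd_sq_sub_of_squarefree hb fun l hl hlb => ?_
  by_cases hla : (l : ℤ) ∣ a
  · exact ⟨0, by simpa using hla⟩
  rcases eq_or_ne l 2 with rfl | h2
  · exact ⟨1, by push_cast at hla ⊢; omega⟩
  · have h1 := h l hl h2
    rw [hilbertSymbol_of_not_dvd_left b hla, padicValInt_eq_one_of_squarefree hl hb hlb,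
      pow_one] at h1
    exact exists_dvd_sq_sub hl h1

theorem exists_dvd_sub_and_four_mul_sq_le {b : ℤ} (hb : b ≠ 0) (t : ℤ) :
    ∃ s : ℤ, b ∣ t - s ∧ 4 * s ^ 2 ≤ b ^ 2 := by
  have h0 : 0 < b.natAbs := Int.natAbs_pos.2 hb
  refine ⟨t.bmod b.natAbs, Int.natAbs_dvd.1 Int.dvd_self_sub_bmod, ?_⟩
  have hlow := Int.le_bmod (x := t) h0
  have hupp := Int.bmod_lt (x := t) h0
  have habs : |2 * t.bmod b.natAbs| ≤ |(b.natAbs : ℤ)| := by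
    rw [Nat.abs_cast, abs_le]
    constructor <;> omega
  have := sq_le_sq.2 habs
  rw [← Int.natAbs_sq b]
  linarith

/-- The binary form `⟨a, b⟩` represents a square nontrivially over `ℤ`; equivalently, the
quaternion algebra `(a, b)` over `ℚ` splits. -/
def RepresentsSquare (a b : ℤ) : Prop :=
  ∃ x y z : ℤ, x ^ 2 = a * y ^ 2 + b * z ^ 2 ∧ (y ≠ 0 ∨ z ≠ 0)

theorem RepresentsSquare.symm {a b : ℤ} (h : RepresentsSquare a b) : RepresentsSquare b a := by
  obtain ⟨x, y, z, e, h0⟩ := h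
  exact ⟨x, z, y, by rw [e, add_comm], h0.symm⟩

theorem RepresentsSquare.mul_sq_right {a b k : ℤ} (hk : k ≠ 0) (h : RepresentsSquare a b) :
    RepresentsSquare a (b * k ^ 2) := by
  obtain ⟨x, y, z, e, h0⟩ := h
  exact ⟨x * k, y * k, z, by linear_combination k ^ 2 * e, h0.imp (mul_ne_zero · hk) id⟩

/-- Norms from `ℚ(√a)` form a group, so if `t² - a = b m k²` is one, then `b` is one when `m` is. -/
theorem RepresentsSquare.of_sq_sub_eq {a b m k t : ℤ} (hm : m ≠ 0) (hk : k ≠ 0)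
    (ht : t ^ 2 - a = b * (m * k ^ 2)) (h : RepresentsSquare a m) : RepresentsSquare a b := by
  obtain ⟨x, y, z, e, h0⟩ := h
  rcases eq_or_ne z 0 with rfl | hz
  · exact ⟨x, y, 0, by rw [e]; ring, h0⟩
  · refine ⟨x * t + a * y, x + t * y, m * k * z, ?_, Or.inr (by positivity)⟩
    linear_combination (t ^ 2 - a) * e + m * z ^ 2 * ht

theorem natAbs_lt_of_sq_sub_eq {a b m k t : ℤ} (hb : 2 ≤ b.natAbs) (hk : k ≠ 0)
    (hab : a.natAbs ≤ b.natAbs) (ht : 4 * t ^ 2 ≤ b ^ 2) (h : t ^ 2 - a = b * (m * k ^ 2)) :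
    m.natAbs < b.natAbs := by
  zify at hb hab ⊢
  have hbound : |b| * |m * k ^ 2| ≤ t ^ 2 + |a| := by
    calc |b| * |m * k ^ 2| = |t ^ 2 - a| := by rw [← abs_mul, h]
      _ ≤ |t ^ 2| + |a| := abs_sub _ _
      _ = t ^ 2 + |a| := by rw [abs_of_nonneg (sq_nonneg t)]
  have hmk : |m| ≤ |m * k ^ 2| := by
    rw [abs_mul]
    exact le_mul_of_one_le_right (abs_nonneg _) (Int.one_le_abs (pow_ne_zero 2 hk))
  by_contra! hcon
  have : |b| * |b| ≤ |b| * |m * k ^ 2| :=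
    mul_le_mul_of_nonneg_left (hcon.trans hmk) (abs_nonneg _)
  rw [← sq_abs b] at ht
  nlinarith

theorem pos_of_sq_sub_eq {a b m k t : ℤ} (hpos : 0 < a ∨ 0 < b) (ha : a ≠ 0)
    (h : t ^ 2 - a = b * (m * k ^ 2)) : 0 < a ∨ 0 < m := by
  refine or_iff_not_imp_left.2 fun ha0 => ?_
  have hb : 0 < b := hpos.resolve_left ha0
  have : 0 < b * (m * k ^ 2) := h ▸ by nlinarith [sq_nonneg t, lt_of_le_of_ne (not_lt.1 ha0) ha]
  exact pos_of_mul_pos_left ((mul_pos_iff_of_pos_left hb).1 this) (sq_nonneg k)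

theorem representsSquare_of_natAbs_eq_one {a b : ℤ} (ha : a.natAbs = 1) (hb : b.natAbs = 1)
    (hpos : 0 < a ∨ 0 < b) : RepresentsSquare a b := by
  rcases hpos with h | h
  · obtain rfl : a = 1 := by omega
    exact ⟨1, 1, 0, by ring, Or.inl one_ne_zero⟩
  · obtain rfl : b = 1 := by omega
    exact ⟨1, 0, 1, by ring, Or.inr one_ne_zero⟩

theorem representsSquare_of_squarefree (N : ℕ) (a b : ℤ) (h : a.natAbs + b.natAbs ≤ N)
    (hsa : Squarefree a) (hsb : Squarefree b) (hpos : 0 < a ∨ 0 < b)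
    (hab : ∀ l : ℕ, l.Prime → l ≠ 2 → hilbertSymbol l a b = 1) : RepresentsSquare a b := by
  have ha : a ≠ 0 := hsa.ne_zero
  have hb : b ≠ 0 := hsb.ne_zero
  induction N generalizing a b with
  | zero => omega
  | succ N ih =>
    wlog hle : a.natAbs ≤ b.natAbs generalizing a b
    · exact (this b a (by omega) hsb hsa hpos.symm
        (fun l hl h2 => by rw [hilbertSymbol_comm, hab l hl h2]) hb ha (by omega)).symm
    by_cases hb1 : b.natAbs = 1
    · exact representsSquare_of_natAbs_eq_one (by omega) hb1 hpos
    obtain ⟨t₀, ht₀⟩ := exists_dvd_sq_sub_of_hilbertSymbol hsb hab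
    obtain ⟨t, htt, ht⟩ := exists_dvd_sub_and_four_mul_sq_le hb t₀
    obtain ⟨b', hb'⟩ : b ∣ t ^ 2 - a := by
      have : t ^ 2 - a = (t₀ ^ 2 - a) - (t₀ - t) * (t₀ + t) := by ring
      exact this ▸ dvd_sub ht₀ (htt.mul_right _)
    rcases eq_or_ne b' 0 with rfl | hb'0
    · exact ⟨t, 1, 0, by linear_combination hb', Or.inl one_ne_zero⟩
    obtain ⟨m, k, rfl, hsm, hm, hk⟩ := exists_sq_mul_squarefree_int hb'0
    have hlt := natAbs_lt_of_sq_sub_eq (by omega) hk hle ht hb'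
    refine .of_sq_sub_eq hm hk hb' <|
      ih a m (by omega) hsa hsm (pos_of_sq_sub_eq hpos ha hb') (fun l hl h2 => ?_) ha hm
    have hnorm := hilbertSymbol_sq_sub hl ha (t := t) (hb' ▸ mul_ne_zero hb hb'0)
    rwa [hb', hilbertSymbol_mul_right hl a hb hb'0, hab l hl h2, one_mul,
      hilbertSymbol_mul_sq_right hl ha hm hk] at hnorm

/-- Legendre's theorem. By the product formula no condition at the prime `2` is needed. -/
theorem representsSquare_of_hilbertSymbol {a b : ℤ} (ha : a ≠ 0) (hb : b ≠ 0)
    (hpos : 0 < a ∨ 0 < b) (h : ∀ l : ℕ, l.Prime → l ≠ 2 → hilbertSymbol l a b = 1) :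
    RepresentsSquare a b := by
  obtain ⟨m, k, rfl, hsm, hm, hk⟩ := exists_sq_mul_squarefree_int ha
  obtain ⟨n, j, rfl, hsn, hn, hj⟩ := exists_sq_mul_squarefree_int hb
  have hmn : RepresentsSquare m n := by
    refine representsSquare_of_squarefree _ m n le_rfl hsm hsn
      (hpos.imp (pos_of_mul_pos_left · (sq_nonneg k)) (pos_of_mul_pos_left · (sq_nonneg j)))
      fun l hl h2 => ?_
    rw [← h l hl h2, hilbertSymbol_mul_sq_right hl ha hn hj, hilbertSymbol_comm,
      hilbertSymbol_comm l (m * k ^ 2), hilbertSymbol_mul_sq_right hl hn hm hk]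
  exact ((hmn.mul_sq_right hj).symm.mul_sq_right hk).symm

/-! ### The product formula -/

theorem jacobiSym_eq_prod {P : Finset ℕ} (hP : ∀ l ∈ P, l.Prime) (a : ℤ) {f : ℕ} (hf : f ≠ 0)
    (hfP : f.primeFactors ⊆ P) :
    jacobiSym a f = ∏ l ∈ P, jacobiSym a l ^ padicValNat l f := by
  induction f using induction_on_primes with
  | zero => exact absurd rfl hf
  | one => simp
  | prime_mul k n hk ih =>
    have hn : n ≠ 0 := right_ne_zero_of_mul hf
    have := NeZero.mk hn
    have := NeZero.mk hk.ne_zero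
    rw [Nat.primeFactors_mul hk.ne_zero hn, Finset.union_subset_iff, hk.primeFactors,
      Finset.singleton_subset_iff] at hfP
    rw [jacobiSym.mul_right, ih hn hfP.2, ← Finset.prod_ite_eq_of_mem' P k (jacobiSym a ·) hfP.1,
      ← Finset.prod_mul_distrib]
    refine Finset.prod_congr rfl fun l hl => ?_
    have := Fact.mk (hP l hl)
    have := Fact.mk hk
    rw [padicValNat.mul hk.ne_zero hn, pow_add]
    split_ifs with h
    · rw [h, padicValNat_self, pow_one]
    · rw [padicValNat_primes h, pow_zero]

theorem prod_hilbertSymbol_of_not_dvd {P : Finset ℕ} (hP : ∀ l ∈ P, l.Prime) {f : ℕ}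
    (hf : f ≠ 0) (hfP : f.primeFactors ⊆ P) {m : ℤ} (hm : ∀ l ∈ P, ¬ (l : ℤ) ∣ m) :
    ∏ l ∈ P, hilbertSymbol l f m = jacobiSym m f := by
  rw [jacobiSym_eq_prod hP m hf hfP]
  refine Finset.prod_congr rfl fun l hl => ?_
  rw [hilbertSymbol_of_not_dvd_right f (hm l hl), padicValInt.of_nat]

theorem not_dvd_two {l : ℕ} (hl : l.Prime) (h2 : l ≠ 2) : ¬ (l : ℤ) ∣ 2 := fun h =>
  h2 ((Nat.prime_dvd_prime_iff_eq hl Nat.prime_two).1 (by exact_mod_cast h))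

theorem hilbertSymbol_prime_self {k : ℕ} (hk : k.Prime) (h2 : k ≠ 2) :
    hilbertSymbol k k k = ZMod.χ₄ k := by
  have := Fact.mk hk
  simp [hilbertSymbol, unitChar_self hk, unitChar_neg_one hk h2]

theorem not_dvd_of_prime_ne {l k : ℕ} (hl : l.Prime) (hk : k.Prime) (h : l ≠ k) :
    ¬ (l : ℤ) ∣ k := fun hd =>
  h ((Nat.prime_dvd_prime_iff_eq hl hk).1 (Int.natCast_dvd_natCast.1 hd))

theorem prod_hilbertSymbol_of_primes {P : Finset ℕ} (hP : ∀ l ∈ P, l.Prime ∧ l ≠ 2) {p k : ℕ}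
    (hp : p ∈ P) (hk : k ∈ P) : ∏ l ∈ P, hilbertSymbol l p k = qrSign p k := by
  obtain ⟨hpp, hp2⟩ := hP p hp
  obtain ⟨hkp, hk2⟩ := hP k hk
  have := Fact.mk hpp
  have := Fact.mk hkp
  rcases eq_or_ne p k with rfl | hpk
  · rw [Finset.prod_eq_single_of_mem p hp fun l hl hlp => hilbertSymbol_of_not_dvd
      (not_dvd_of_prime_ne (hP l hl).1 hpp hlp) (not_dvd_of_prime_ne (hP l hl).1 hpp hlp),
      hilbertSymbol_prime_self hpp hp2, qrSign]
    rcases Nat.odd_mod_four_iff.1 (Nat.odd_iff.1 (hpp.odd_of_ne_two hp2)) with h | h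
    · rw [ZMod.χ₄_nat_one_mod_four h, jacobiSym.one_left]
    · rw [ZMod.χ₄_nat_three_mod_four h, jacobiSym.at_neg_one (hpp.odd_of_ne_two hp2),
        ZMod.χ₄_nat_three_mod_four h]
  · rw [Finset.prod_eq_mul_of_mem p k hp hk hpk fun l hl h => hilbertSymbol_of_not_dvd
      (not_dvd_of_prime_ne (hP l hl).1 hpp h.1) (not_dvd_of_prime_ne (hP l hl).1 hkp h.2),
      hilbertSymbol_of_not_dvd_right _ (not_dvd_of_prime_ne hpp hkp hpk),
      hilbertSymbol_of_not_dvd_left _ (not_dvd_of_prime_ne hkp hpp hpk.symm),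
      padicValInt_self, padicValInt_self, pow_one, pow_one,
      jacobiSym.quadratic_reciprocity' (hkp.odd_of_ne_two hk2) (hpp.odd_of_ne_two hp2), mul_assoc]
    rw [← sq, jacobiSym.sq_one, mul_one]
    rw [Int.gcd_natCast_natCast]
    exact (Nat.coprime_primes hpp hkp).2 hpk

theorem prod_hilbertSymbol_of_prime_right {P : Finset ℕ} (hP : ∀ l ∈ P, l.Prime ∧ l ≠ 2) {k : ℕ}
    (hk : k ∈ P) {f : ℕ} (hf : f ≠ 0) (hfP : f.primeFactors ⊆ P) :
    ∏ l ∈ P, hilbertSymbol l f k = qrSign f k := by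
  induction f using induction_on_primes with
  | zero => exact absurd rfl hf
  | one =>
    rw [Finset.prod_eq_one fun l hl => ?_]
    · simp [qrSign]
    · rw [hilbertSymbol_of_not_dvd_left _ (by exact_mod_cast (hP l hl).1.not_dvd_one)]
      simp
  | prime_mul p n hp ih =>
    have hn : n ≠ 0 := right_ne_zero_of_mul hf
    rw [Nat.primeFactors_mul hp.ne_zero hn, Finset.union_subset_iff, hp.primeFactors,
      Finset.singleton_subset_iff] at hfP
    rw [qrSign.mul_left, ← prod_hilbertSymbol_of_primes hP hfP.1 hk, ← ih hn hfP.2,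
      ← Finset.prod_mul_distrib]
    refine Finset.prod_congr rfl fun l hl => ?_
    rw [Nat.cast_mul, hilbertSymbol_mul_left (hP l hl).1 _ (Nat.cast_ne_zero.2 hp.ne_zero)
      (Nat.cast_ne_zero.2 hn)]

theorem prod_hilbertSymbol_two {P : Finset ℕ} (hP : ∀ l ∈ P, l.Prime ∧ l ≠ 2) {f : ℕ}
    (hf : Odd f) (hfP : f.primeFactors ⊆ P) :
    ∏ l ∈ P, hilbertSymbol l f 2 = ZMod.χ₈ f := by
  rw [prod_hilbertSymbol_of_not_dvd (fun l hl => (hP l hl).1) hf.pos.ne' hfP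
    fun l hl => not_dvd_two (hP l hl).1 (hP l hl).2, jacobiSym.at_two hf]

theorem prod_hilbertSymbol_neg_one {P : Finset ℕ} (hP : ∀ l ∈ P, l.Prime) {f : ℕ}
    (hf : Odd f) (hfP : f.primeFactors ⊆ P) :
    ∏ l ∈ P, hilbertSymbol l f (-1) = ZMod.χ₄ f := by
  rw [prod_hilbertSymbol_of_not_dvd hP hf.pos.ne' hfP
    fun l hl h => (hP l hl).not_dvd_one (by exact_mod_cast dvd_neg.1 h), jacobiSym.at_neg_one hf]

theorem prod_hilbertSymbol_natCast {P : Finset ℕ} (hP : ∀ l ∈ P, l.Prime ∧ l ≠ 2) {f : ℕ}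
    (hf : f % 4 = 1) (hfP : f.primeFactors ⊆ P) {m : ℕ} (hm : m ≠ 0)
    (hmP : m.primeFactors.erase 2 ⊆ P) :
    ∏ l ∈ P, hilbertSymbol l f m = ZMod.χ₈ f ^ padicValNat 2 m := by
  have hodd : Odd f := Nat.odd_iff.2 (by omega)
  have := Fact.mk Nat.prime_two
  induction m using induction_on_primes with
  | zero => exact absurd rfl hm
  | one =>
    rw [prod_hilbertSymbol_of_not_dvd (fun l hl => (hP l hl).1) hodd.pos.ne' hfP fun l hl h =>
      (hP l hl).1.not_dvd_one (by exact_mod_cast h)]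
    simp
  | prime_mul k n hk ih =>
    have hn : n ≠ 0 := right_ne_zero_of_mul hm
    rw [Nat.primeFactors_mul hk.ne_zero hn, Finset.erase_union_distrib, Finset.union_subset_iff,
      hk.primeFactors] at hmP
    have hmul : ∀ l ∈ P, hilbertSymbol l f ((k * n : ℕ) : ℤ) =
        hilbertSymbol l f k * hilbertSymbol l f n := fun l hl => by
      rw [Nat.cast_mul, hilbertSymbol_mul_right (hP l hl).1 _ (Nat.cast_ne_zero.2 hk.ne_zero)
        (Nat.cast_ne_zero.2 hn)]
    rw [Finset.prod_congr rfl hmul, Finset.prod_mul_distrib, ih hn hmP.2,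
      padicValNat.mul hk.ne_zero hn, pow_add]
    congr 1
    rcases eq_or_ne k 2 with rfl | hk2
    · rw [padicValNat_self, pow_one]
      exact_mod_cast prod_hilbertSymbol_two hP hodd hfP
    · have := Fact.mk hk
      have hkP : k ∈ P := hmP.1 (by simp [hk2])
      rw [padicValNat_primes hk2.symm, pow_zero,
        prod_hilbertSymbol_of_prime_right hP hkP hodd.pos.ne' hfP, qrSign,
        ZMod.χ₄_nat_one_mod_four hf, jacobiSym.one_left]

/-- The finite set of odd prime divisors of an integer (empty for `0`). -/
def oddPrimeFactors (n : ℤ) : Finset ℕ := n.natAbs.primeFactors.erase 2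

theorem mem_oddPrimeFactors {n : ℤ} {l : ℕ} :
    l ∈ oddPrimeFactors n ↔ l ≠ 2 ∧ l.Prime ∧ (l : ℤ) ∣ n ∧ n ≠ 0 := by
  simp [oddPrimeFactors, Int.natCast_dvd]

/-- The product formula for `(f, m)` with `f ≡ 1 mod 4` positive; the symbol at `2` is then the
right-hand side and the symbol at infinity is trivial. -/
theorem prod_hilbertSymbol {P : Finset ℕ} (hP : ∀ l ∈ P, l.Prime ∧ l ≠ 2) {f : ℕ}
    (hf : f % 4 = 1) (hfP : f.primeFactors ⊆ P) {m : ℤ} (hm : m ≠ 0)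
    (hmP : oddPrimeFactors m ⊆ P) :
    ∏ l ∈ P, hilbertSymbol l f m = ZMod.χ₈ f ^ padicValInt 2 m := by
  have hodd : Odd f := Nat.odd_iff.2 (by omega)
  have hnat := prod_hilbertSymbol_natCast hP hf hfP (Int.natAbs_ne_zero.2 hm) hmP
  rw [padicValInt, ← hnat]
  rcases Int.natAbs_eq m with h | h
  · rw [← h]
  · have hneg : ∀ l ∈ P, hilbertSymbol l f m =
        hilbertSymbol l f (-1) * hilbertSymbol l f m.natAbs := fun l hl => by
      rw [← hilbertSymbol_mul_right (hP l hl).1 _ (neg_ne_zero.2 one_ne_zero) (by simpa using hm),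
        neg_one_mul, ← h]
    rw [Finset.prod_congr rfl hneg, Finset.prod_mul_distrib,
      prod_hilbertSymbol_neg_one (fun l hl => (hP l hl).1) hodd hfP, ZMod.χ₄_nat_one_mod_four hf,
      one_mul]

/-! ### Local-global principle for the ternary form `⟨c, q, -cq⟩` -/

theorem exists_prime_forall_prime_pow_dvd_sub {P : Finset ℕ} (hP : ∀ l ∈ P, l.Prime) {n : ℕ → ℕ}
    (hn : ∀ l ∈ P, n l ≠ 0) {u : ℕ → ℤ} (hu : ∀ l ∈ P, ¬ (l : ℤ) ∣ u l) :
    ∃ r : ℕ, r.Prime ∧ r ∉ P ∧ ∀ l ∈ P, (l : ℤ) ^ n l ∣ r - u l := by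
  obtain ⟨A, hA⟩ := exists_forall_prime_pow_dvd_sub hP n u
  have hcop : IsCoprime A ((∏ l ∈ P, l ^ n l : ℕ) : ℤ) := by
    push_cast
    refine IsCoprime.prod_right fun l hl => IsCoprime.pow_right ?_
    refine ((Nat.prime_iff_prime_int.1 (hP l hl)).coprime_iff_not_dvd.2 fun hd => hu l hl ?_).symm
    simpa using dvd_sub hd ((dvd_pow_self (l : ℤ) (hn l hl)).trans (hA l hl))
  have hM : ∏ l ∈ P, l ^ n l ≠ 0 :=
    Finset.prod_ne_zero_iff.2 fun l hl => pow_ne_zero _ (hP l hl).ne_zero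
  obtain ⟨r, -, hr, hrA⟩ := Nat.forall_exists_prime_gt_and_zmodEq 0 hM hcop
  have hrl : ∀ l ∈ P, (l : ℤ) ^ n l ∣ r - u l := fun l hl => by
    have hdvd : (l : ℤ) ^ n l ∣ r - A := by
      rw [← Nat.cast_pow]
      exact (Int.natCast_dvd_natCast.2 (Finset.dvd_prod_of_mem _ hl)).trans hrA.symm.dvd
    simpa using dvd_add hdvd (hA l hl)
  refine ⟨r, hr, fun hrP => hu r hrP ?_, hrl⟩
  simpa using dvd_sub_right (dvd_refl (r : ℤ)) |>.1
    ((dvd_pow_self (r : ℤ) (hn r hrP)).trans (hrl r hrP))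

theorem exists_jacobiSym_eq {l : ℕ} (hl : l.Prime) (h2 : l ≠ 2) {ε : ℤ} (hε : IsUnit ε) :
    ∃ u : ℤ, ¬ (l : ℤ) ∣ u ∧ jacobiSym u l = ε := by
  have := Fact.mk hl
  rcases Int.isUnit_iff.1 hε with rfl | rfl
  · exact ⟨1, by exact_mod_cast hl.not_dvd_one, jacobiSym.one_left l⟩
  · obtain ⟨a, ha⟩ := FiniteField.exists_nonsquare (F := ZMod l) (by rwa [ZMod.ringChar_zmod_n])
    refine ⟨a.val, fun h => ha ?_, ZMod.nonsquare_iff_jacobiSym_eq_neg_one.2 (by simpa using ha)⟩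
    have ha0 : a = 0 := by simpa using (ZMod.intCast_zmod_eq_zero_iff_dvd (a.val : ℤ) l).2 h
    exact ha0 ▸ IsSquare.zero

theorem primeFactors_prod_pow_subset {P : Finset ℕ} (hP : ∀ l ∈ P, l.Prime) (e : ℕ → ℕ) :
    (∏ l ∈ P, l ^ e l).primeFactors ⊆ P := fun l hl => by
  have hlp := Nat.prime_of_mem_primeFactors hl
  obtain ⟨k, hk, hlk⟩ := hlp.prime.exists_mem_finset_dvd (Nat.dvd_of_mem_primeFactors hl)
  rwa [(Nat.prime_dvd_prime_iff_eq hlp (hP k hk)).1 (hlp.dvd_of_dvd_pow hlk)]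

theorem padicValInt_prod_pow {P : Finset ℕ} (hP : ∀ l ∈ P, l.Prime) (e : ℕ → ℕ) {l : ℕ}
    (hl : l ∈ P) : padicValInt l (∏ k ∈ P, k ^ e k : ℕ) = e l := by
  have hPl : ∀ k ∈ P.erase l, k.Prime := fun k hk => hP k (Finset.mem_of_mem_erase hk)
  have hndvd : ¬ l ∣ ∏ k ∈ P.erase l, k ^ e k := fun hd => by
    have hne : ∏ k ∈ P.erase l, k ^ e k ≠ 0 :=
      Finset.prod_ne_zero_iff.2 fun k hk => pow_ne_zero _ (hPl k hk).ne_zero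
    exact Finset.notMem_erase l P <| primeFactors_prod_pow_subset hPl e <|
      Nat.mem_primeFactors.2 ⟨hP l hl, hd, hne⟩
  rw [← Finset.mul_prod_erase P _ hl, Nat.cast_mul, Nat.cast_pow,
    padicValInt_pow_mul (hP l hl) _ (by exact_mod_cast hndvd)]

theorem exists_prime_modEq_of_jacobiSym {P : Finset ℕ} (hP : ∀ l ∈ P, l.Prime ∧ l ≠ 2)
    {η : ℕ → ℤ} (hη : ∀ l ∈ P, IsUnit (η l)) {d : ℕ} (hd : Odd d) :
    ∃ r : ℕ, r.Prime ∧ r ≠ 2 ∧ r ∉ P ∧ r ≡ d [MOD 8] ∧ ∀ l ∈ P, jacobiSym r l = η l := by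
  choose! u hu hJ using fun l (hl : l ∈ P) => exists_jacobiSym_eq (hP l hl).1 (hP l hl).2 (hη l hl)
  obtain ⟨r, hr, hrP, hrl⟩ := exists_prime_forall_prime_pow_dvd_sub
    (fun l hl => (Finset.mem_insert.1 hl).elim (· ▸ Nat.prime_two) fun h => (hP l h).1)
    (P := insert 2 P) (n := fun l => if l = 2 then 3 else 1)
    (u := fun l => if l = 2 then d else u l) (fun l _ => by split_ifs <;> simp) fun l hl => by
      split_ifs with h
      · rw [h, Int.natCast_dvd_natCast]
        exact hd.not_two_dvd_nat
      · exact hu l (Finset.mem_of_mem_insert_of_ne hl h)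
  rw [Finset.mem_insert, not_or] at hrP
  refine ⟨r, hr, hrP.1, hrP.2, ?_, fun l hl => ?_⟩
  · have hr8 : (8 : ℤ) ∣ r - d := by simpa using hrl 2 (Finset.mem_insert_self 2 P)
    exact (Int.natCast_modEq_iff.1 (Int.modEq_iff_dvd.2 hr8)).symm
  · have hru : (l : ℤ) ∣ r - u l := by
      simpa [(hP l hl).2] using hrl l (Finset.mem_insert_of_mem hl)
    rw [jacobiSym_congr hru, hJ l hl]

/-- Valuations and characters at finitely many odd primes and a class modulo `8` can be prescribed
at the cost of a single further prime factor `r`. -/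
theorem exists_nat_of_padicValInt_of_unitChar {P : Finset ℕ} (hP : ∀ l ∈ P, l.Prime ∧ l ≠ 2)
    (e : ℕ → ℕ) {ε : ℕ → ℤ} (hε : ∀ l ∈ P, IsUnit (ε l)) {d : ℕ} (hd : Odd d) :
    ∃ f r : ℕ, r.Prime ∧ r ≠ 2 ∧ r ∉ P ∧ f ≠ 0 ∧ f.primeFactors ⊆ insert r P ∧
      f ≡ d [MOD 8] ∧ ∀ l ∈ P, padicValInt l f = e l ∧ unitChar l f = ε l := by
  have hP₁ : ∀ l ∈ P, l.Prime := fun l hl => (hP l hl).1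
  set f₀ := ∏ l ∈ P, l ^ e l
  have hf₀ : f₀ ≠ 0 := Finset.prod_ne_zero_iff.2 fun l hl => pow_ne_zero _ (hP₁ l hl).ne_zero
  have hf₀Z : (f₀ : ℤ) ≠ 0 := Nat.cast_ne_zero.2 hf₀
  have hf₀odd : Odd f₀ := by
    rw [← Nat.not_even_iff_odd, even_iff_two_dvd]
    exact fun h => (hP 2 (primeFactors_prod_pow_subset hP₁ e
      (Nat.mem_primeFactors.2 ⟨Nat.prime_two, h, hf₀⟩))).2 rfl
  obtain ⟨r, hr, hr2, hrP, hr8, hrl⟩ := exists_prime_modEq_of_jacobiSym hP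
    (fun l hl => (hε l hl).mul (isUnit_unitChar (hP₁ l hl) hf₀Z)) (hf₀odd.mul hd)
  refine ⟨f₀ * r, r, hr, hr2, hrP, mul_ne_zero hf₀ hr.ne_zero, ?_, ?_, fun l hl => ?_⟩
  · rw [Nat.primeFactors_mul hf₀ hr.ne_zero, hr.primeFactors, Finset.union_comm]
    exact Finset.union_subset_union_right (primeFactors_prod_pow_subset hP₁ e)
  · have hsq : f₀ * f₀ ≡ 1 [MOD 8] := by
      have h8 : (8 : ℤ) ∣ (f₀ : ℤ) ^ 2 - 1 :=
        Int.eight_dvd_sq_sub_one_of_odd (by exact_mod_cast hf₀odd)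
      rw [← sq]
      exact (Int.natCast_modEq_iff.1 (Int.modEq_iff_dvd.2 (by exact_mod_cast h8))).symm
    simpa [mul_assoc] using (hr8.mul_left f₀).trans (by simpa [mul_assoc] using hsq.mul_right d)
  · have := Fact.mk (hP₁ l hl)
    have hlr : ¬ (l : ℤ) ∣ r := not_dvd_of_prime_ne (hP₁ l hl) hr fun h => hrP (h ▸ hl)
    have hrZ : (r : ℤ) ≠ 0 := Nat.cast_ne_zero.2 hr.ne_zero
    rw [Nat.cast_mul, padicValInt.mul hf₀Z hrZ, padicValInt_prod_pow hP₁ e hl,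
      padicValInt.eq_zero_of_not_dvd hlr, unitChar_mul (hP₁ l hl) hf₀Z hrZ,
      unitChar_of_not_dvd hlr, hrl l hl, mul_comm (ε l), ← mul_assoc,
      unitChar_mul_self (hP₁ l hl) hf₀Z]
    exact ⟨add_zero _, one_mul _⟩

/-- The integer `d ≠ 0` is not a square in `ℚ_l`, for an odd prime `l`. -/
def IsLocalNonsquare (l : ℕ) (d : ℤ) : Prop := Odd (padicValInt l d) ∨ unitChar l d = -1

/-- In terms of parities of valuations and of characters: two conditions on the square class
`(e, ε)` of `f`, linear over `𝔽₂`, which are independent unless `d` is a square. -/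
theorem exists_signs : ∀ (vc vq vd : Fin 2) (xm xc xq xd : ℤˣ),
    (xm ^ (vq.val * vc.val) * xq ^ vc.val * xc ^ vq.val = -1 → vd = 1 ∨ xd = -1) →
    ∃ (e : Fin 2) (ε : ℤˣ),
      xm ^ (e.val * vc.val) * ε ^ vc.val * xc ^ e.val =
        xm ^ (vq.val * vc.val) * xq ^ vc.val * xc ^ vq.val ∧
      xm ^ (e.val * (vc + vd).val) * ε ^ (vc + vd).val * (xc * xd) ^ e.val =
        xm ^ (vd.val * vc.val) * xd ^ vc.val * (xm * xc) ^ vd.val := by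
  decide

theorem hilbertSymbol_eq_units {l : ℕ} {m n : ℤ} {x y z : ℤˣ} (hx : unitChar l m = x)
    (hy : unitChar l n = y) (hz : unitChar l (-1) = z) {i j : Fin 2}
    (hi : padicValInt l m % 2 = i) (hj : padicValInt l n % 2 = j) :
    hilbertSymbol l m n = ((z ^ (i.val * j.val) * x ^ j.val * y ^ i.val : ℤˣ) : ℤ) := by
  rw [hilbertSymbol, hx, hy, hz]
  norm_cast
  rw [Int.units_pow_eq_pow_mod_two z, Int.units_pow_eq_pow_mod_two x,
    Int.units_pow_eq_pow_mod_two y, Nat.mul_mod, hi, hj, ← Int.units_pow_eq_pow_mod_two z]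

theorem exists_local_signs {l : ℕ} (hl : l.Prime) {c q d : ℤ} (hc : c ≠ 0) (hq : q ≠ 0)
    (hd : d ≠ 0) (h : hilbertSymbol l q c = -1 → IsLocalNonsquare l d) :
    ∃ (e : ℕ) (ε : ℤ), IsUnit ε ∧
      ∀ f : ℤ, padicValInt l f = e → unitChar l f = ε →
        hilbertSymbol l f c = hilbertSymbol l q c ∧
          hilbertSymbol l f (c * d) = hilbertSymbol l d (-c) := by
  have := Fact.mk hl
  obtain ⟨xc, hxc⟩ := isUnit_unitChar hl hc
  obtain ⟨xq, hxq⟩ := isUnit_unitChar hl hq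
  obtain ⟨xd, hxd⟩ := isUnit_unitChar hl hd
  obtain ⟨xm, hxm⟩ := isUnit_unitChar hl (neg_ne_zero.2 one_ne_zero)
  have parity : ∀ n : ℤ, ∃ i : Fin 2, padicValInt l n % 2 = i := fun n =>
    ⟨⟨padicValInt l n % 2, Nat.mod_lt _ two_pos⟩, rfl⟩
  obtain ⟨vc, hvc⟩ := parity c
  obtain ⟨vq, hvq⟩ := parity q
  obtain ⟨vd, hvd⟩ := parity d
  have hxnc : unitChar l (-c) = ((xm * xc : ℤˣ) : ℤ) := by
    rw [← neg_one_mul, unitChar_mul hl (neg_ne_zero.2 one_ne_zero) hc, ← hxm, ← hxc, Units.val_mul]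
  have hxcd : unitChar l (c * d) = ((xc * xd : ℤˣ) : ℤ) := by
    rw [unitChar_mul hl hc hd, ← hxc, ← hxd, Units.val_mul]
  have hvnc : padicValInt l (-c) % 2 = vc := by rw [padicValInt_neg, hvc]
  have hvcd : padicValInt l (c * d) % 2 = (vc + vd : Fin 2) := by
    rw [padicValInt.mul hc hd, Nat.add_mod, hvc, hvd, Fin.val_add]
  obtain ⟨e, ε, h1, h2⟩ := exists_signs vc vq vd xm xc xq xd fun h3 => by
    rw [hilbertSymbol_eq_units hxq.symm hxc.symm hxm.symm hvq hvc, h3] at h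
    exact (h rfl).imp (fun h => Fin.ext (hvd.symm.trans (Nat.odd_iff.1 h)))
      fun h => Units.ext (hxd.trans h)
  refine ⟨e, ε, ε.isUnit, fun f hfe hfε => ?_⟩
  have hfe' : padicValInt l f % 2 = e := by rw [hfe, Nat.mod_eq_of_lt e.isLt]
  rw [hilbertSymbol_eq_units hfε hxc.symm hxm.symm hfe' hvc,
    hilbertSymbol_eq_units hxq.symm hxc.symm hxm.symm hvq hvc,
    hilbertSymbol_eq_units hfε hxcd hxm.symm hfe' hvcd,
    hilbertSymbol_eq_units hxd.symm hxnc hxm.symm hvd hvnc, h1, h2]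
  exact ⟨rfl, rfl⟩

theorem isUnit_χ₈ {d : ℕ} (hd : Odd d) : IsUnit (ZMod.χ₈ d) := by
  rw [ZMod.χ₈_nat_eq_if_mod_eight, Int.isUnit_iff]
  have := Nat.odd_iff.1 hd
  split_ifs <;> omega

theorem pow_of_isUnit_of_odd {x : ℤ} (hx : IsUnit x) {n : ℕ} (hn : Odd n) : x ^ n = x := by
  rcases Int.isUnit_iff.1 hx with rfl | rfl
  · exact one_pow n
  · exact hn.neg_one_pow

theorem hilbertSymbol_eq_one_of_prod_eq {P : Finset ℕ} (hP : ∀ l ∈ P, l.Prime ∧ l ≠ 2) {r : ℕ}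
    (hr : r.Prime) (hr2 : r ≠ 2) (hrP : r ∉ P) {f : ℕ} (hf : f % 4 = 1)
    (hfP : f.primeFactors ⊆ insert r P) {m : ℤ} (hm : m ≠ 0) (hm2 : Odd (padicValInt 2 m))
    (hmP : oddPrimeFactors m ⊆ P) (hprod : ∏ l ∈ P, hilbertSymbol l f m = ZMod.χ₈ f) :
    hilbertSymbol r f m = 1 := by
  have hχ : IsUnit (ZMod.χ₈ f) := isUnit_χ₈ (Nat.odd_iff.2 (by omega))
  have h := prod_hilbertSymbol (P := insert r P)
    (fun l hl => (Finset.mem_insert.1 hl).elim (fun h => h ▸ ⟨hr, hr2⟩) (hP l)) hf hfP hm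
    (hmP.trans (Finset.subset_insert r P))
  rw [Finset.prod_insert hrP, hprod, pow_of_isUnit_of_odd hχ hm2] at h
  exact mul_right_cancel₀ hχ.ne_zero (h.trans (one_mul _).symm)

theorem oddPrimeFactors_mul_subset {P : Finset ℕ} {m n : ℤ} (hm : oddPrimeFactors m ⊆ P)
    (hn : oddPrimeFactors n ⊆ P) : oddPrimeFactors (m * n) ⊆ P := fun l hl => by
  obtain ⟨hl2, hlp, hlmn, h0⟩ := mem_oddPrimeFactors.1 hl
  rcases (Nat.prime_iff_prime_int.1 hlp).dvd_or_dvd hlmn with h | h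
  · exact hm (mem_oddPrimeFactors.2 ⟨hl2, hlp, h, left_ne_zero_of_mul h0⟩)
  · exact hn (mem_oddPrimeFactors.2 ⟨hl2, hlp, h, right_ne_zero_of_mul h0⟩)

theorem hilbertSymbol_of_oddPrimeFactors_subset {P : Finset ℕ} {m n : ℤ} (hm0 : m ≠ 0)
    (hn0 : n ≠ 0) (hm : oddPrimeFactors m ⊆ P) (hn : oddPrimeFactors n ⊆ P) {l : ℕ} (hl : l.Prime)
    (h2 : l ≠ 2) (hlP : l ∉ P) : hilbertSymbol l m n = 1 :=
  hilbertSymbol_of_not_dvd (fun h => hlP (hm (mem_oddPrimeFactors.2 ⟨h2, hl, h, hm0⟩)))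
    fun h => hlP (hn (mem_oddPrimeFactors.2 ⟨h2, hl, h, hn0⟩))

/-- At the additional prime `r` of `f` the identities follow from the product formula, and at all
primes outside `P ∪ {r}` every symbol is trivial. -/
theorem exists_nat_forall_hilbertSymbol_eq {P : Finset ℕ} (hP : ∀ l ∈ P, l.Prime ∧ l ≠ 2)
    {c q : ℤ} {d : ℕ} (hc : c ≠ 0) (hc2 : Odd (padicValInt 2 c)) (hq : q ≠ 0) (hd : d % 4 = 1)
    (hcP : oddPrimeFactors c ⊆ P) (hqP : oddPrimeFactors q ⊆ P) (hdP : d.primeFactors ⊆ P)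
    (hprod : ∏ l ∈ P, hilbertSymbol l q c = ZMod.χ₈ d)
    (hloc : ∀ l ∈ P, hilbertSymbol l q c = -1 → IsLocalNonsquare l d) :
    ∃ f : ℕ, Odd f ∧ ∀ l : ℕ, l.Prime → l ≠ 2 →
      hilbertSymbol l f c = hilbertSymbol l q c ∧
        hilbertSymbol l f (c * d) = hilbertSymbol l d (-c) := by
  have := Fact.mk Nat.prime_two
  have hdZ : (d : ℤ) ≠ 0 := by omega
  have hdodd : Odd d := Nat.odd_iff.2 (by omega)
  choose! e ε hε hfe using fun l (hl : l ∈ P) =>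
    exists_local_signs (hP l hl).1 hc hq hdZ (hloc l hl)
  obtain ⟨f, r, hr, hr2, hrP, hf0, hfP, hf8, hfl⟩ :=
    exists_nat_of_padicValInt_of_unitChar hP e hε hdodd
  have hf4 : f % 4 = 1 := by rw [Nat.ModEq] at hf8; omega
  have hχ : ZMod.χ₈ f = ZMod.χ₈ d := by
    rw [ZMod.χ₈_nat_mod_eight, hf8, ← ZMod.χ₈_nat_mod_eight]
  have hncP : oddPrimeFactors (-c) ⊆ P := by rwa [oddPrimeFactors, Int.natAbs_neg]
  have hdoddP : oddPrimeFactors d ⊆ P := (Finset.erase_subset 2 _).trans hdP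
  have hcdP := oddPrimeFactors_mul_subset hcP hdoddP
  have hcd2 : Odd (padicValInt 2 (c * d)) := by
    rwa [padicValInt.mul hc hdZ, padicValInt.eq_zero_of_not_dvd (z := d) (by omega)]
  have hP_eq := fun l hl => hfe l hl f (hfl l hl).1 (hfl l hl).2
  refine ⟨f, Nat.odd_iff.2 (by omega), fun l hl hl2 => ?_⟩
  by_cases hlP : l ∈ P
  · exact hP_eq l hlP
  rw [hilbertSymbol_of_oddPrimeFactors_subset hq hc hqP hcP hl hl2 hlP,
    hilbertSymbol_of_oddPrimeFactors_subset hdZ (neg_ne_zero.2 hc) hdoddP hncP hl hl2 hlP]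
  rcases eq_or_ne l r with rfl | hlr
  · constructor
    · refine hilbertSymbol_eq_one_of_prod_eq hP hl hl2 hlP hf4 hfP hc hc2 hcP ?_
      rw [Finset.prod_congr rfl fun l hl => (hP_eq l hl).1, hprod, hχ]
    · refine hilbertSymbol_eq_one_of_prod_eq hP hl hl2 hlP hf4 hfP (mul_ne_zero hc hdZ) hcd2
        hcdP ?_
      rw [Finset.prod_congr rfl fun l hl => (hP_eq l hl).2,
        prod_hilbertSymbol hP hd hdP (neg_ne_zero.2 hc) hncP, padicValInt_neg, hχ,
        pow_of_isUnit_of_odd (isUnit_χ₈ hdodd) hc2]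
  · have hsymbol : ∀ {m : ℤ}, m ≠ 0 → oddPrimeFactors m ⊆ P → hilbertSymbol l f m = 1 :=
      fun hm hmP => hilbertSymbol_of_oddPrimeFactors_subset (Nat.cast_ne_zero.2 hf0) hm
        ((Finset.erase_subset 2 _).trans hfP) (hmP.trans (Finset.subset_insert r P)) hl hl2
        (by simp [hlr, hlP])
    exact ⟨hsymbol hc hcP, hsymbol (mul_ne_zero hc hdZ) hcdP⟩

theorem eq_zero_of_sq_eq_mul_sq {l : ℕ} (hl : l.Prime) {c x z : ℚ} (hc : c ≠ 0)
    (hv : Odd (padicValRat l c)) (h : x ^ 2 = c * z ^ 2) : z = 0 := by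
  have := Fact.mk hl
  by_contra hz
  have hval := congrArg (padicValRat l) h
  rw [padicValRat.mul hc (pow_ne_zero 2 hz), padicValRat.pow, padicValRat.pow] at hval
  obtain ⟨k, hk⟩ := hv
  push_cast at hval
  omega

theorem RepresentsSquare.exists_eq_mul_sq_sub {a b f : ℤ} (ha : a ≠ 0) (hb : b ≠ 0)
    (hb2 : Odd (padicValInt 2 b)) (h : RepresentsSquare (a * f) b) :
    ∃ X Z : ℚ, f = a * X ^ 2 - a * b * Z ^ 2 := by
  obtain ⟨x, y, z, e, h0⟩ := h
  have hyQ : (y : ℚ) ≠ 0 := by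
    rw [Int.cast_ne_zero]
    rintro rfl
    have hz : (z : ℚ) = 0 := eq_zero_of_sq_eq_mul_sq Nat.prime_two (x := x)
      (Int.cast_ne_zero.2 hb) (by rw [padicValRat.of_int]; exact_mod_cast hb2)
      (by exact_mod_cast e.trans (by ring))
    exact h0.elim (absurd rfl) (absurd (by exact_mod_cast hz))
  have haQ : (a : ℚ) ≠ 0 := Int.cast_ne_zero.2 ha
  have eQ : (x : ℚ) ^ 2 = a * f * y ^ 2 + b * z ^ 2 := by exact_mod_cast e
  refine ⟨x / (a * y), z / (a * y), ?_⟩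
  field_simp
  linear_combination -eQ

/-- Both `⟨q, -cq⟩` and `⟨d, -c⟩` represent the auxiliary integer `f`, so `⟨c, q, -cq⟩`
represents `d`. -/
theorem exists_ternary_representation {P : Finset ℕ} (hP : ∀ l ∈ P, l.Prime ∧ l ≠ 2) {c q : ℤ}
    {d : ℕ} (hc : c ≠ 0) (hc2 : Odd (padicValInt 2 c)) (hq : 0 < q) (hd : d % 4 = 1)
    (hcP : oddPrimeFactors c ⊆ P) (hqP : oddPrimeFactors q ⊆ P) (hdP : d.primeFactors ⊆ P)
    (hprod : ∏ l ∈ P, hilbertSymbol l q c = ZMod.χ₈ d)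
    (hloc : ∀ l ∈ P, hilbertSymbol l q c = -1 → IsLocalNonsquare l d) :
    ∃ x y z w : ℚ, w ≠ 0 ∧ d * w ^ 2 = c * x ^ 2 + q * y ^ 2 - c * q * z ^ 2 := by
  have := Fact.mk Nat.prime_two
  have hd0 : (d : ℤ) ≠ 0 := by omega
  have hdpos : (0 : ℤ) < d := by omega
  obtain ⟨f, hf, hsym⟩ := exists_nat_forall_hilbertSymbol_eq hP hc hc2 hq.ne' hd hcP hqP hdP
    hprod hloc
  have hf0 : (f : ℤ) ≠ 0 := Nat.cast_ne_zero.2 hf.pos.ne'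
  have hfpos : (0 : ℤ) < f := Nat.cast_pos.2 hf.pos
  have hf2 : padicValInt 2 (f : ℤ) = 0 :=
    padicValInt.eq_zero_of_not_dvd (by obtain ⟨k, rfl⟩ := hf; omega)
  have hd2 : padicValInt 2 (d : ℤ) = 0 := padicValInt.eq_zero_of_not_dvd (by omega)
  have hcd2 : Odd (padicValInt 2 (c * d)) := by rwa [padicValInt.mul hc hd0, hd2]
  obtain ⟨Y, Z, hYZ⟩ := (representsSquare_of_hilbertSymbol (mul_ne_zero hq.ne' hf0) hc
    (Or.inl (mul_pos hq hfpos)) fun l hl hl2 => by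
      rw [hilbertSymbol_mul_left hl _ hq.ne' hf0, (hsym l hl hl2).1,
        hilbertSymbol_mul_self hl hq.ne' hc]).exists_eq_mul_sq_sub hq.ne' hc hc2
  obtain ⟨W, X, hWX⟩ := (representsSquare_of_hilbertSymbol (mul_ne_zero hd0 hf0)
    (mul_ne_zero hc hd0) (Or.inl (mul_pos hdpos hfpos)) fun l hl hl2 => by
      have hdcd : hilbertSymbol l d (c * d) = hilbertSymbol l d (-c) := by
        rw [← neg_mul_neg, hilbertSymbol_mul_right hl _ (neg_ne_zero.2 hc) (neg_ne_zero.2 hd0),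
          hilbertSymbol_neg_self hl hd0, mul_one]
      rw [hilbertSymbol_mul_left hl _ hd0 hf0, (hsym l hl hl2).2, hdcd,
        hilbertSymbol_mul_self hl hd0 (neg_ne_zero.2 hc)]).exists_eq_mul_sq_sub hd0
          (mul_ne_zero hc hd0) hcd2
  refine ⟨d * X, Y, Z, W, ?_, by push_cast at hYZ hWX ⊢; linear_combination hYZ - hWX⟩
  rintro rfl
  have hcf : Odd (padicValInt 2 (-c * f)) := by
    rwa [padicValInt.mul (neg_ne_zero.2 hc) hf0, hf2, padicValInt_neg]
  have hX : d * X = 0 := eq_zero_of_sq_eq_mul_sq (c := (-c * f : ℤ)) (x := f) Nat.prime_two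
    (Int.cast_ne_zero.2 (mul_ne_zero (neg_ne_zero.2 hc) hf0))
    (by rw [padicValRat.of_int]; exact_mod_cast hcf)
    (by push_cast at hWX ⊢; linear_combination (f : ℚ) * hWX)
  have hfQ : ((f : ℤ) : ℚ) = 0 := by
    push_cast at hWX ⊢
    linear_combination hWX - c * (d * X) * hX
  exact hf0 (by exact_mod_cast hfQ)

/-! ### Sums of two traces -/

/-- `X ^ 2 - s X + 1` has two distinct roots `u`, `u⁻¹` in the field, so that every element of
trace `s` and norm one in a quaternion algebra over it comes from a split torus. -/
def IsSplitTrace {F : Type*} [Field F] (s : F) : Prop := ∃ u : F, u ≠ 0 ∧ u ≠ u⁻¹ ∧ u + u⁻¹ = s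

theorem isSplitTrace_of_sq_sub_four_eq_sq {F : Type*} [Field F] (h2 : (2 : F) ≠ 0) {s y : F}
    (hy : y ≠ 0) (h : s ^ 2 - 4 = y ^ 2) : IsSplitTrace s := by
  have hprod : (s + y) / 2 * ((s - y) / 2) = 1 := by
    field_simp
    linear_combination h
  have hinv : ((s + y) / 2)⁻¹ = (s - y) / 2 := inv_eq_of_mul_eq_one_right hprod
  refine ⟨(s + y) / 2, left_ne_zero_of_mul_eq_one hprod, fun heq => hy ?_, ?_⟩
  · rw [hinv, div_left_inj' h2] at heq
    exact (mul_eq_zero.1 (show 2 * y = 0 by linear_combination heq)).resolve_left h2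
  · rw [hinv]
    field_simp
    ring

open scoped Classical in
/-- `u ↦ u + u⁻¹` is two-to-one onto the split traces, and it misses `u = 0`. -/
theorem two_mul_card_isSplitTrace_lt {F : Type*} [Field F] [Fintype F] :
    2 * (Finset.univ.filter fun s : F => IsSplitTrace s).card < Fintype.card F := by
  set U := Finset.univ.filter fun u : F => u ≠ 0 ∧ u ≠ u⁻¹ with hU
  have hfiber : ∀ s ∈ Finset.univ.filter fun s : F => IsSplitTrace s,
      2 ≤ (U.filter fun u => u + u⁻¹ = s).card := by
    intro s hs
    obtain ⟨u, hu, hne, hus⟩ := (Finset.mem_filter.1 hs).2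
    refine Nat.succ_le_of_lt (Finset.one_lt_card.2 ⟨u, ?_, u⁻¹, ?_, hne⟩)
    · simp [hU, hu, hne, hus]
    · simp [hU, hu, hne.symm, add_comm, hus]
  refine (Finset.mul_card_image_le_card_of_maps_to (fun u hu => ?_) 2 hfiber).trans_lt ?_
  · obtain ⟨hu, hne⟩ := (Finset.mem_filter.1 hu).2
    exact Finset.mem_filter.2 ⟨Finset.mem_univ _, u, hu, hne, rfl⟩
  · exact Finset.card_lt_univ_of_notMem (x := 0) (by simp [hU])

theorem exists_not_isSplitTrace_add {F : Type*} [Field F] [Finite F] (t : F) :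
    ∃ s : F, ¬ IsSplitTrace s ∧ ¬ IsSplitTrace (t - s) := by
  classical
  have := Fintype.ofFinite F
  by_contra! hcover
  set W := Finset.univ.filter fun s : F => IsSplitTrace s
  have hsub : (Finset.univ : Finset F) ⊆ W ∪ W.image fun s => t - s := fun s _ => by
    by_cases hs : IsSplitTrace s
    · exact Finset.mem_union_left _ (by simpa [W] using hs)
    · exact Finset.mem_union_right _ (Finset.mem_image.2
        ⟨t - s, by simpa [W] using hcover s hs, sub_sub_cancel t s⟩)
  have hcard := (Finset.card_le_card hsub).trans (Finset.card_union_le _ _)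
  have himage := Finset.card_image_le (s := W) (f := fun s => t - s)
  have hW : 2 * W.card < Fintype.card F := two_mul_card_isSplitTrace_lt
  rw [Finset.card_univ] at hcard
  omega

/-- The discriminant of `X ^ 2 - s X + 1` is a nonzero nonsquare modulo `l`, or exactly divisible
by `l`. This is a property of `s` modulo `l ^ 2` which makes the polynomial irreducible over the
`l`-adic numbers. -/
def Nonsplit (l : ℕ) (s : ℤ) : Prop :=
  jacobiSym (s ^ 2 - 4) l = -1 ∨ ((l : ℤ) ∣ s ^ 2 - 4 ∧ ¬ (l : ℤ) ^ 2 ∣ s ^ 2 - 4)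

section Nonsplit

variable {l : ℕ}

theorem jacobiSym_eq_neg_one_of_not_isSplitTrace [Fact l.Prime] (h2 : l ≠ 2) {s : ℤ}
    (hs : ¬ IsSplitTrace (s : ZMod l)) (hd : ¬ (l : ℤ) ∣ s ^ 2 - 4) :
    jacobiSym (s ^ 2 - 4) l = -1 := by
  refine ZMod.nonsquare_iff_jacobiSym_eq_neg_one.2 fun ⟨y, hy⟩ => hs ?_
  have htwo : (2 : ZMod l) ≠ 0 := fun h =>
    not_dvd_two Fact.out h2 ((ZMod.intCast_zmod_eq_zero_iff_dvd 2 l).1 (by exact_mod_cast h))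
  refine isSplitTrace_of_sq_sub_four_eq_sq htwo (y := y) ?_ (by push_cast at hy; rw [hy, sq])
  rintro rfl
  exact hd ((ZMod.intCast_zmod_eq_zero_iff_dvd _ l).1 (by rw [hy, mul_zero]))

theorem not_dvd_of_dvd_sq_sub_four (hl : l.Prime) (h2 : l ≠ 2) {s : ℤ}
    (hd : (l : ℤ) ∣ s ^ 2 - 4) : ¬ (l : ℤ) ∣ s := fun hs => by
  have h4 : (l : ℤ) ∣ 2 * 2 := by simpa using dvd_sub (dvd_pow hs two_ne_zero) hd
  exact ((Nat.prime_iff_prime_int.1 hl).dvd_or_dvd h4).elim (not_dvd_two hl h2) (not_dvd_two hl h2)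

/-- The derivative `2 s` of the discriminant does not vanish modulo `l`, so at most one lift of
`s` to `ℤ / l ^ 2` is a zero of it. -/
theorem nonsplit_add_mul_of_dvd (hl : l.Prime) (h2 : l ≠ 2) {s : ℤ} (hd : (l : ℤ) ∣ s ^ 2 - 4)
    {j k : ℤ} (hjk : ¬ (l : ℤ) ∣ j - k) : Nonsplit l (s + l * j) ∨ Nonsplit l (s + l * k) := by
  have hl' := Nat.prime_iff_prime_int.1 hl
  have hdvd : ∀ i : ℤ, (l : ℤ) ∣ (s + l * i) ^ 2 - 4 := fun i => by
    rw [show (s + l * i) ^ 2 - 4 = (s ^ 2 - 4) + l * (2 * s * i + l * i ^ 2) by ring]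
    exact dvd_add hd (dvd_mul_right _ _)
  by_contra! hcon
  obtain ⟨a, ha⟩ : (l : ℤ) ^ 2 ∣ (s + l * j) ^ 2 - 4 :=
    by_contra fun h => hcon.1 (Or.inr ⟨hdvd j, h⟩)
  obtain ⟨b, hb⟩ : (l : ℤ) ^ 2 ∣ (s + l * k) ^ 2 - 4 :=
    by_contra fun h => hcon.2 (Or.inr ⟨hdvd k, h⟩)
  have hsq : (l : ℤ) * l ∣ l * (2 * (s * (j - k))) :=
    ⟨a - b - j ^ 2 + k ^ 2, by linear_combination ha - hb⟩
  exact hl'.not_dvd_mul (not_dvd_two hl h2)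
    (hl'.not_dvd_mul (not_dvd_of_dvd_sq_sub_four hl h2 hd) hjk)
    (Int.dvd_of_mul_dvd_mul_left (Int.natCast_ne_zero.2 hl.ne_zero) hsq)

theorem nonsplit_add_mul [Fact l.Prime] (h2 : l ≠ 2) {s : ℤ} (hs : ¬ IsSplitTrace (s : ZMod l))
    {j k : ℤ} (hjk : ¬ (l : ℤ) ∣ j - k) : Nonsplit l (s + l * j) ∨ Nonsplit l (s + l * k) := by
  by_cases hd : (l : ℤ) ∣ s ^ 2 - 4
  · exact nonsplit_add_mul_of_dvd Fact.out h2 hd hjk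
  · refine Or.inl (Or.inl ?_)
    rw [jacobiSym_congr (n := s ^ 2 - 4) ⟨2 * s * j + l * j ^ 2, by ring⟩]
    exact jacobiSym_eq_neg_one_of_not_isSplitTrace h2 hs hd

theorem exists_and_of_pairwise_or {C D : Fin 3 → Prop} (hC : ∀ i j, i ≠ j → C i ∨ C j)
    (hD : ∀ i j, i ≠ j → D i ∨ D j) : ∃ i, C i ∧ D i := by
  have hC' := And.intro (hC 0 1 (by decide)) (And.intro (hC 0 2 (by decide)) (hC 1 2 (by decide)))
  have hD' := And.intro (hD 0 1 (by decide)) (And.intro (hD 0 2 (by decide)) (hD 1 2 (by decide)))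
  by_contra! hcon
  have h0 := hcon 0
  have h1 := hcon 1
  have h2 := hcon 2
  tauto

theorem exists_nonsplit_add [Fact l.Prime] (h2 : l ≠ 2) (t : ℤ) :
    ∃ s : ℤ, Nonsplit l s ∧ Nonsplit l (t - s) := by
  have hl : l.Prime := Fact.out
  obtain ⟨x, hx, htx⟩ := exists_not_isSplitTrace_add (t : ZMod l)
  obtain ⟨r, rfl⟩ := ZMod.intCast_surjective x
  have hfin : ∀ i j : Fin 3, i ≠ j → ¬ (l : ℤ) ∣ (i : ℕ) - (j : ℕ) := fun i j hij hdvd => by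
    have := hl.two_le
    have := Int.eq_zero_of_abs_lt_dvd hdvd (by grind)
    exact hij (Fin.ext (by omega))
  obtain ⟨i, hs, hts⟩ := exists_and_of_pairwise_or
    (C := fun i => Nonsplit l (r + l * (i : ℕ))) (D := fun i => Nonsplit l (t - r + l * -(i : ℕ)))
    (fun i j hij => nonsplit_add_mul h2 hx (hfin i j hij))
    (fun i j hij => nonsplit_add_mul h2 (by rwa [Int.cast_sub])
      (by rw [neg_sub_neg]; exact hfin j i hij.symm))
  exact ⟨_, hs, by rwa [show t - (r + l * (i : ℕ)) = t - r + l * -(i : ℕ) by ring]⟩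

theorem Nonsplit.isLocalNonsquare (hl : l.Prime) {A m s : ℤ} (hs : Nonsplit l s)
    (hm : ¬ (l : ℤ) ∣ m) (hA : (l : ℤ) ^ 2 ∣ A - s * m) :
    IsLocalNonsquare l (A ^ 2 - 4 * m ^ 2) := by
  have hl' := Nat.prime_iff_prime_int.1 hl
  obtain ⟨k, hk⟩ := hA
  rcases hs with h | ⟨⟨c, hc⟩, hsq⟩
  · have hJ : jacobiSym (A ^ 2 - 4 * m ^ 2) l = -1 := by
      rw [jacobiSym_congr (n := m ^ 2 * (s ^ 2 - 4))
        ⟨l * (k * (A + s * m)), by linear_combination (A + s * m) * hk⟩,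
        jacobiSym.mul_left, jacobiSym.sq_one' (Int.isCoprime_iff_gcd_eq_one.1
          (hl'.coprime_iff_not_dvd.2 hm).symm), h, one_mul]
    refine Or.inr ((unitChar_of_not_dvd fun h0 => ?_).trans hJ)
    rw [jacobiSym_congr (n := 0) (by rwa [sub_zero]), jacobiSym.zero_left hl.one_lt] at hJ
    exact absurd hJ (by norm_num)
  · have hlc : ¬ (l : ℤ) ∣ c := by
      rintro ⟨b, rfl⟩
      exact hsq ⟨b, by rw [hc]; ring⟩
    have hfactor : A ^ 2 - 4 * m ^ 2 = (l : ℤ) ^ 1 * (m ^ 2 * c + l * (k * (A + s * m))) := by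
      linear_combination (A + s * m) * hk + m ^ 2 * hc
    rw [IsLocalNonsquare, hfactor, padicValInt_pow_mul hl 1 fun h => ?_]
    · exact Or.inl odd_one
    exact hl'.not_dvd_mul (fun h => hm (hl'.dvd_of_dvd_pow h)) hlc
      ((dvd_add_left (dvd_mul_right _ _)).1 h)

theorem IsLocalNonsquare.of_mul_sq (hl : l.Prime) {d k : ℤ} (hd : d ≠ 0) (hk : k ≠ 0)
    (h : IsLocalNonsquare l (d * k ^ 2)) : IsLocalNonsquare l d := by
  have := Fact.mk hl
  have hkk := mul_ne_zero hk hk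
  rw [IsLocalNonsquare, sq, padicValInt.mul hd hkk, padicValInt.mul hk hk, unitChar_mul hl hd hkk,
    unitChar_mul hl hk hk, unitChar_mul_self hl hk, mul_one, ← two_mul] at h
  exact h.imp_left fun h => (Nat.odd_add.1 h).2 (even_two_mul _)

end Nonsplit

/-- The odd primes at which the quaternion algebra `(q, c)` over `ℚ` is ramified. -/
def oddRamified (q c : ℤ) : Finset ℕ :=
  (oddPrimeFactors (q * c)).filter fun l => hilbertSymbol l q c = -1

theorem prime_of_mem_oddRamified {q c : ℤ} {l : ℕ} (h : l ∈ oddRamified q c) :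
    l.Prime ∧ l ≠ 2 :=
  have hmem := mem_oddPrimeFactors.1 (Finset.mem_filter.1 h).1
  ⟨hmem.2.1, hmem.1⟩

theorem hilbertSymbol_of_notMem_oddPrimeFactors {q c : ℤ} (hqc : q * c ≠ 0) {l : ℕ} (hl : l.Prime)
    (h2 : l ≠ 2) (h : l ∉ oddPrimeFactors (q * c)) : hilbertSymbol l q c = 1 := by
  have hnd : ¬ (l : ℤ) ∣ q * c := fun hd => h (mem_oddPrimeFactors.2 ⟨h2, hl, hd, hqc⟩)
  exact hilbertSymbol_of_not_dvd (fun h => hnd (h.mul_right _)) fun h => hnd (h.mul_left _)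

theorem oddPrimeFactors_subset_of_dvd {m n : ℤ} (hn : n ≠ 0) (h : m ∣ n) :
    oddPrimeFactors m ⊆ oddPrimeFactors n := fun _ hl =>
  have hmem := mem_oddPrimeFactors.1 hl
  mem_oddPrimeFactors.2 ⟨hmem.1, hmem.2.1, hmem.2.2.1.trans h, hn⟩

section Traces

variable {c q : ℤ}

theorem mem_S_of_ternary_representation {A m k d : ℤ} (hm : m ≠ 0)
    (hAm : A ^ 2 - 4 * m ^ 2 = d * k ^ 2)
    (h : ∃ x y z w : ℚ, w ≠ 0 ∧ d * w ^ 2 = c * x ^ 2 + q * y ^ 2 - c * q * z ^ 2) :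
    (A / m : ℚ) ∈ S c q := by
  obtain ⟨x, y, z, w, hw, e⟩ := h
  have hmQ : (m : ℚ) ≠ 0 := Int.cast_ne_zero.2 hm
  have hAmQ : (A : ℚ) ^ 2 - 4 * m ^ 2 = d * k ^ 2 := by exact_mod_cast hAm
  refine ⟨A / (2 * m), k / (2 * m * w) * x, k / (2 * m * w) * y, k / (2 * m * w) * z, ?_, ?_⟩
  · field_simp
    linear_combination w ^ 2 * hAmQ + k ^ 2 * e
  · field_simp

variable (hc : c ≠ 0) (hc2 : Odd (padicValInt 2 c)) (hq : 0 < q)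

include hc hc2 hq

theorem mem_S_of_isLocalNonsquare {A m k : ℤ} {d : ℕ} (hm : m ≠ 0) (hk : k ≠ 0) (hd : d % 4 = 1)
    (hAm : A ^ 2 - 4 * m ^ 2 = d * k ^ 2)
    (hprod : ∏ l ∈ oddPrimeFactors (q * c), hilbertSymbol l q c = ZMod.χ₈ d)
    (hloc : ∀ l ∈ oddRamified q c, IsLocalNonsquare l (A ^ 2 - 4 * m ^ 2)) :
    (A / m : ℚ) ∈ S c q := by
  have hqc := mul_ne_zero hq.ne' hc
  have hdZ : (d : ℤ) ≠ 0 := by omega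
  have hqcd := mul_ne_zero hqc hdZ
  have hP : ∀ l ∈ oddPrimeFactors (q * c * d), l.Prime ∧ l ≠ 2 := fun l hl =>
    have hmem := mem_oddPrimeFactors.1 hl
    ⟨hmem.2.1, hmem.1⟩
  have hone : ∀ l ∈ oddPrimeFactors (q * c * d), l ∉ oddPrimeFactors (q * c) →
      hilbertSymbol l q c = 1 := fun l hl hl' =>
    hilbertSymbol_of_notMem_oddPrimeFactors hqc (hP l hl).1 (hP l hl).2 hl'
  refine mem_S_of_ternary_representation (d := d) hm hAm
    (exists_ternary_representation hP hc hc2 hq hd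
      (oddPrimeFactors_subset_of_dvd hqcd ((dvd_mul_left c q).mul_right _))
      (oddPrimeFactors_subset_of_dvd hqcd ((dvd_mul_right q c).mul_right _)) ?_ ?_ ?_)
  · intro l hl
    have hld := Nat.mem_primeFactors.1 hl
    exact mem_oddPrimeFactors.2 ⟨by rintro rfl; omega, hld.1,
      (Int.natCast_dvd_natCast.2 hld.2.1).mul_left _, hqcd⟩
  · rw [← hprod, Finset.prod_subset
      (oddPrimeFactors_subset_of_dvd hqcd (dvd_mul_right _ _)) hone]
  · intro l hl hram
    have hl' : l ∈ oddPrimeFactors (q * c) := by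
      by_contra hn
      exact absurd ((hone l hl hn).symm.trans hram) (by norm_num)
    refine IsLocalNonsquare.of_mul_sq (hP l hl).1 hdZ hk ?_
    rw [← hAm]
    exact hloc l (Finset.mem_filter.2 ⟨hl', hram⟩)

end Traces

theorem exists_gt_forall_prime_pow_dvd_sub {P : Finset ℕ} (hP : ∀ l ∈ P, l.Prime) (n : ℕ → ℕ)
    (a : ℕ → ℤ) (B : ℤ) : ∃ A : ℤ, B < A ∧ ∀ l ∈ P, (l : ℤ) ^ n l ∣ A - a l := by
  obtain ⟨A, hA⟩ := exists_forall_prime_pow_dvd_sub hP n a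
  have hM : (0 : ℤ) < ∏ l ∈ P, (l : ℤ) ^ n l :=
    Finset.prod_pos fun l hl => pow_pos (by exact_mod_cast (hP l hl).pos) _
  refine ⟨A + (∏ l ∈ P, (l : ℤ) ^ n l) * (|A| + |B| + 1), ?_, fun l hl => ?_⟩
  · have hle : |A| + |B| + 1 ≤ (∏ l ∈ P, (l : ℤ) ^ n l) * (|A| + |B| + 1) :=
      le_mul_of_one_le_left (by positivity) hM
    linarith [neg_abs_le A, le_abs_self B]
  · rw [add_sub_right_comm]
    exact dvd_add (hA l hl)
      ((Finset.dvd_prod_of_mem (fun k : ℕ => (k : ℤ) ^ n k) hl).mul_right _)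

theorem exists_nonsplit_of_not_dvd {l : ℕ} (hl : l.Prime) (h2 : l ≠ 2) (n : ℤ) {m : ℤ}
    (hm : ¬ (l : ℤ) ∣ m) :
    ∃ s t : ℤ, Nonsplit l s ∧ Nonsplit l t ∧ (l : ℤ) ^ 2 ∣ n - (s + t) * m := by
  have := Fact.mk hl
  obtain ⟨u, v, huv⟩ :=
    ((Nat.prime_iff_prime_int.1 hl).coprime_iff_not_dvd.2 hm).pow_left (m := 2)
  obtain ⟨s, hs, ht⟩ := exists_nonsplit_add h2 (n * v)
  exact ⟨s, n * v - s, hs, ht, n * u, by linear_combination -n * huv⟩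

theorem sq_sub_four_mul_sq_pos {B m : ℤ} (h : 2 * |m| < |B|) : 0 < B ^ 2 - 4 * m ^ 2 := by
  have : |2 * m| < |B| := by rwa [abs_mul, abs_two]
  linarith [sq_lt_sq.2 this]

theorem exists_add_eq_forall_isLocalNonsquare {P : Finset ℕ} (hP : ∀ l ∈ P, l.Prime ∧ l ≠ 2)
    (n a : ℤ) {m : ℤ} (hm : ∀ l ∈ P, ¬ (l : ℤ) ∣ m) :
    ∃ A B : ℤ, A + B = n ∧ (128 : ℤ) ∣ A - a ∧
      0 < A ^ 2 - 4 * m ^ 2 ∧ 0 < B ^ 2 - 4 * m ^ 2 ∧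
      ∀ l ∈ P, IsLocalNonsquare l (A ^ 2 - 4 * m ^ 2) ∧
        IsLocalNonsquare l (B ^ 2 - 4 * m ^ 2) := by
  choose! s t hs ht hn using fun l hl => exists_nonsplit_of_not_dvd (hP l hl).1 (hP l hl).2 n
    (hm l hl)
  obtain ⟨A, hAB, hA⟩ := exists_gt_forall_prime_pow_dvd_sub (P := insert 2 P)
    (fun l hl => (Finset.mem_insert.1 hl).elim (fun h => h ▸ Nat.prime_two) fun h => (hP l h).1)
    (fun l => if l = 2 then 7 else 2) (fun l => if l = 2 then a else s l * m) (2 * |m| + |n|)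
  have hA2 : (128 : ℤ) ∣ A - a := by simpa using hA 2 (Finset.mem_insert_self 2 P)
  have hAl : ∀ l ∈ P, (l : ℤ) ^ 2 ∣ A - s l * m := fun l hl => by
    simpa [(hP l hl).2] using hA l (Finset.mem_insert_of_mem hl)
  have habs := abs_nonneg n
  have hle := le_abs_self n
  refine ⟨A, n - A, add_sub_cancel _ _, hA2,
    sq_sub_four_mul_sq_pos (lt_of_lt_of_le (by linarith) (le_abs_self A)),
    sq_sub_four_mul_sq_pos (lt_of_lt_of_le (by linarith) (neg_le_abs (n - A))), fun l hl =>
    ⟨(hs l hl).isLocalNonsquare (hP l hl).1 (hm l hl) (hAl l hl),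
      (ht l hl).isLocalNonsquare (hP l hl).1 (hm l hl) ?_⟩⟩
  rw [show (n - A) - t l * m = (n - (s l + t l) * m) - (A - s l * m) by ring]
  exact dvd_sub (hn l hl) (hAl l hl)

theorem sq_emod_eight {x : ℤ} (hx : Odd x) : x ^ 2 % 8 = 1 := by
  have := Int.eight_dvd_sq_sub_one_of_odd hx
  omega

theorem exists_sq_sub_eq_mul_sixty_four {m B : ℤ} (hm : Odd m) (hB : (128 : ℤ) ∣ B - 18 * m) :
    ∃ e : ℤ, e % 8 = 5 ∧ B ^ 2 - 4 * m ^ 2 = e * 8 ^ 2 := by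
  obtain ⟨j, hj⟩ := hB
  obtain rfl : B = 18 * m + 128 * j := by linarith
  have hm8 := sq_emod_eight hm
  refine ⟨5 * m ^ 2 + 8 * (9 * m * j + 32 * j ^ 2), by omega, by ring⟩

section Integers

variable {c q : ℤ} (hc : c ≠ 0) (hc2 : Odd (padicValInt 2 c)) (hq : 0 < q)

include hc hc2 hq

theorem mem_T_of_forall_exists {n m a : ℤ} (hm : m ≠ 0)
    (hloc : ∀ l ∈ oddRamified q c, ¬ (l : ℤ) ∣ m)
    (hd : ∀ A B : ℤ, A + B = n → (128 : ℤ) ∣ A - a → ∀ C, C = A ∨ C = B →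
      0 < C ^ 2 - 4 * m ^ 2 → ∃ (k : ℤ) (d : ℕ), k ≠ 0 ∧ d % 4 = 1 ∧
        C ^ 2 - 4 * m ^ 2 = d * k ^ 2 ∧
        ∏ l ∈ oddPrimeFactors (q * c), hilbertSymbol l q c = ZMod.χ₈ d) :
    (n / m : ℚ) ∈ T c q := by
  obtain ⟨A, B, rfl, hAa, hA, hB, hAB⟩ :=
    exists_add_eq_forall_isLocalNonsquare (fun l => prime_of_mem_oddRamified) n a hloc
  refine Set.mem_add.2 ⟨A / m, ?_, B / m, ?_, by push_cast; rw [add_div]⟩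
  · obtain ⟨k, d, hk, hd4, e, hprod⟩ := hd A B rfl hAa A (Or.inl rfl) hA
    exact mem_S_of_isLocalNonsquare hc hc2 hq hm hk hd4 e hprod fun l hl => (hAB l hl).1
  · obtain ⟨k, d, hk, hd4, e, hprod⟩ := hd A B rfl hAa B (Or.inr rfl) hB
    exact mem_S_of_isLocalNonsquare hc hc2 hq hm hk hd4 e hprod fun l hl => (hAB l hl).2

theorem mem_T_of_prod_eq_one
    (hprod : ∏ l ∈ oddPrimeFactors (q * c), hilbertSymbol l q c = 1) {t : ℚ}
    (ht : ∀ l ∈ oddRamified q c, ¬ l ∣ t.den) : t ∈ T c q := by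
  have ht_eq : t = ((2 * t.num : ℤ) : ℚ) / ((2 * t.den : ℤ) : ℚ) := by
    push_cast
    rw [mul_div_mul_left _ _ two_ne_zero, Rat.num_div_den]
  rw [ht_eq]
  refine mem_T_of_forall_exists hc hc2 hq (a := 1)
    (mul_ne_zero two_ne_zero (by exact_mod_cast t.den_nz)) (fun l hl => ?_) ?_
  · obtain ⟨hlp, h2⟩ := prime_of_mem_oddRamified hl
    exact (Nat.prime_iff_prime_int.1 hlp).not_dvd_mul (not_dvd_two hlp h2)
      (by exact_mod_cast ht l hl)
  · intro A B hAB hA C hC hpos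
    have hC8 := sq_emod_eight (x := C) (Int.odd_iff.2 (by omega))
    lift C ^ 2 - 4 * (2 * (t.den : ℤ)) ^ 2 to ℕ using hpos.le with d hd
    have hd8 : d % 8 = 1 := by
      have : 4 * (2 * (t.den : ℤ)) ^ 2 = 8 * (2 * (t.den : ℤ) ^ 2) := by ring
      omega
    exact ⟨1, d, one_ne_zero, by omega, by ring,
      by rw [hprod, ZMod.χ₈_nat_mod_eight, hd8]; decide⟩

/-- Odd `A` makes the discriminant `A ^ 2 - 4 m ^ 2` congruent to `5` modulo `8`. An odd numerator
forces one of the two summands to be even, and `A = 18 m` makes its discriminant `5 m ^ 2 8 ^ 2`. -/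
theorem mem_T_of_prod_eq_neg_one
    (hprod : ∏ l ∈ oddPrimeFactors (q * c), hilbertSymbol l q c = -1) {t : ℚ}
    (ht2 : ¬ 2 ∣ t.den) (ht : ∀ l ∈ oddRamified q c, ¬ l ∣ t.den) : t ∈ T c q := by
  have hm2 : Odd (t.den : ℤ) := Int.odd_iff.2 (by omega)
  have hm8 := sq_emod_eight hm2
  rw [← Rat.num_div_den t, ← Int.cast_natCast]
  refine mem_T_of_forall_exists hc hc2 hq (a := if t.num % 2 = 0 then 1 else 18 * t.den)
    (by exact_mod_cast t.den_nz) (fun l hl => by exact_mod_cast ht l hl) ?_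
  intro A B hAB hA C hC hpos
  by_cases hC2 : Odd C
  · have hC8 := sq_emod_eight hC2
    lift C ^ 2 - 4 * (t.den : ℤ) ^ 2 to ℕ using hpos.le with d hd
    have hd8 : d % 8 = 5 := by omega
    exact ⟨1, d, one_ne_zero, by omega, by ring,
      by rw [hprod, ZMod.χ₈_nat_mod_eight, hd8]; decide⟩
  · have hC' := Int.not_odd_iff.1 hC2
    split_ifs at hA with hn
    · omega
    · obtain rfl : C = A := by omega
      obtain ⟨e, he8, he⟩ := exists_sq_sub_eq_mul_sixty_four hm2 hA
      lift e to ℕ using by omega with d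
      have hd8 : d % 8 = 5 := by omega
      exact ⟨8, d, by norm_num, by omega, he, by rw [hprod, ZMod.χ₈_nat_mod_eight, hd8]; decide⟩

end Integers

/-! ### Anisotropy at ramified primes -/

section padicNorm

variable {l : ℕ} [Fact l.Prime]

theorem padicNorm_sq (x : ℚ) : padicNorm l (x ^ 2) = padicNorm l x ^ 2 := by
  rw [sq, padicNorm.mul, sq]

theorem padicNorm_le_one_iff {x : ℚ} : padicNorm l x ≤ 1 ↔ ¬ l ∣ x.den := by
  constructor
  · intro hx hden
    have hnum : ¬ (l : ℤ) ∣ x.num := fun hn =>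
      Nat.not_coprime_of_dvd_of_dvd (Fact.out : l.Prime).one_lt (Int.natCast_dvd.1 hn) hden
        x.reduced
    have hmul : padicNorm l x * padicNorm l x.den = 1 := by
      rw [← padicNorm.mul, Rat.mul_den_eq_num, (padicNorm.int_eq_one_iff _).2 hnum]
    exact hmul.not_lt (mul_lt_one_of_nonneg_of_lt_one_right hx (padicNorm.nonneg _)
      ((padicNorm.nat_lt_one_iff _).2 hden))
  · intro hden
    rw [← Rat.num_div_den x, padicNorm.div, (padicNorm.nat_eq_one_iff _).2 hden, div_one]
    exact padicNorm.of_int _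

theorem padicNorm_eq_one_of_jacobiSym_eq_neg_one {u : ℤ} (hu : jacobiSym u l = -1) :
    padicNorm l u = 1 := by
  refine (padicNorm.int_eq_one_iff u).2 fun h => ?_
  rw [jacobiSym_congr (n := 0) (by rwa [sub_zero]),
    jacobiSym.zero_left (Fact.out : l.Prime).one_lt] at hu
  exact absurd hu (by norm_num)

theorem padicNorm_sq_sub_eq_one {u : ℤ} (hu : jacobiSym u l = -1) {r : ℚ}
    (hr : padicNorm l r ≤ 1) : padicNorm l (r ^ 2 - u) = 1 := by
  have hden : ¬ l ∣ r.den := padicNorm_le_one_iff.1 hr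
  have hsub : ¬ (l : ℤ) ∣ r.num ^ 2 - u * r.den ^ 2 := fun hd =>
    hden (by exact_mod_cast (jacobiSym.prime_dvd_of_eq_neg_one hu hd).2)
  have hd0 : (r.den : ℚ) ≠ 0 := Nat.cast_ne_zero.2 r.den_nz
  have hr2 : r ^ 2 - u = (r.num ^ 2 - u * r.den ^ 2 : ℤ) / (r.den : ℚ) ^ 2 := by
    push_cast
    rw [← Rat.mul_den_eq_num r]
    field_simp
  rw [hr2, padicNorm.div, (padicNorm.int_eq_one_iff _).2 hsub, padicNorm_sq,
    (padicNorm.nat_eq_one_iff _).2 hden]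
  norm_num

theorem padicNorm_sq_sub {u : ℤ} (hu : jacobiSym u l = -1) (X Y : ℚ) :
    padicNorm l (X ^ 2 - u * Y ^ 2) = max (padicNorm l X) (padicNorm l Y) ^ 2 := by
  rcases le_or_gt (padicNorm l X) (padicNorm l Y) with hle | hlt
  · rcases eq_or_ne Y 0 with rfl | hY
    · simp [padicNorm_sq, max_eq_left (padicNorm.nonneg X)]
    have hr : padicNorm l (X / Y) ≤ 1 := by
      rw [padicNorm.div]
      exact div_le_one_of_le₀ hle (padicNorm.nonneg _)
    rw [show X ^ 2 - u * Y ^ 2 = ((X / Y) ^ 2 - u) * Y ^ 2 by field_simp, padicNorm.mul,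
      padicNorm_sq_sub_eq_one hu hr, one_mul, padicNorm_sq, max_eq_right hle]
  · have hY : padicNorm l (-(u * Y ^ 2)) = padicNorm l Y ^ 2 := by
      rw [padicNorm.neg, padicNorm.mul, padicNorm_eq_one_of_jacobiSym_eq_neg_one hu, one_mul,
        padicNorm_sq]
    have hsq : padicNorm l Y ^ 2 < padicNorm l X ^ 2 :=
      pow_lt_pow_left₀ hlt (padicNorm.nonneg _) two_ne_zero
    rw [sub_eq_add_neg, padicNorm.add_eq_max_of_ne (by rw [hY, padicNorm_sq]; exact hsq.ne'), hY,
      padicNorm_sq, max_eq_left hsq.le, max_eq_left hlt.le]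

theorem exists_padicNorm_sq_sub_eq {u : ℤ} (hu : jacobiSym u l = -1) (X Y : ℚ) :
    ∃ x : ℚ, padicNorm l (X ^ 2 - u * Y ^ 2) = padicNorm l (x ^ 2) ∧
      padicNorm l X ≤ padicNorm l x := by
  rw [padicNorm_sq_sub hu]
  rcases le_total (padicNorm l X) (padicNorm l Y) with hle | hle
  · exact ⟨Y, by rw [max_eq_right hle, padicNorm_sq], hle⟩
  · exact ⟨X, by rw [max_eq_left hle, padicNorm_sq], le_rfl⟩

theorem padicNorm_sq_ne_padicNorm_mul_sq {k x : ℚ} (hk0 : k ≠ 0) (hk : Odd (padicValRat l k))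
    (hx : x ≠ 0) (z : ℚ) : padicNorm l (x ^ 2) ≠ padicNorm l (k * z ^ 2) := by
  intro h
  have hl1 : (1 : ℚ) < l := Nat.one_lt_cast.2 (Fact.out : l.Prime).one_lt
  have hx2 := pow_ne_zero 2 hx
  rcases eq_or_ne z 0 with rfl | hz
  · rw [zero_pow two_ne_zero, mul_zero, padicNorm.zero] at h
    exact padicNorm.nonzero hx2 h
  have hz2 := pow_ne_zero 2 hz
  rw [padicNorm.eq_zpow_of_nonzero hx2, padicNorm.eq_zpow_of_nonzero (mul_ne_zero hk0 hz2)] at h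
  have hval := zpow_right_injective₀ (by linarith) hl1.ne' h
  rw [padicValRat.mul hk0 hz2, padicValRat.pow, padicValRat.pow] at hval
  obtain ⟨j, hj⟩ := hk
  push_cast at hval
  omega

/-- The terms `X ^ 2 - u Y ^ 2` and `k (Z ^ 2 - u W ^ 2)` have valuations of different parities,
so they cannot cancel. -/
theorem padicNorm_le_one_of_norm_eq_one {u : ℤ} (hu : jacobiSym u l = -1) {k : ℚ} (hk0 : k ≠ 0)
    (hk : Odd (padicValRat l k)) {X Y Z W : ℚ}
    (h : X ^ 2 - u * Y ^ 2 + k * (Z ^ 2 - u * W ^ 2) = 1) : padicNorm l X ≤ 1 := by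
  obtain ⟨x, hx, hXx⟩ := exists_padicNorm_sq_sub_eq hu X Y
  obtain ⟨z, hz, -⟩ := exists_padicNorm_sq_sub_eq hu Z W
  rcases eq_or_ne x 0 with rfl | hx0
  · exact hXx.trans (by rw [padicNorm.zero]; exact zero_le_one)
  have hkz : padicNorm l (k * (Z ^ 2 - u * W ^ 2)) = padicNorm l (k * z ^ 2) := by
    rw [padicNorm.mul, hz, padicNorm.mul]
  have hne : padicNorm l (X ^ 2 - u * Y ^ 2) ≠ padicNorm l (k * (Z ^ 2 - u * W ^ 2)) := by
    rw [hx, hkz]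
    exact padicNorm_sq_ne_padicNorm_mul_sq hk0 hk hx0 z
  have hmax := padicNorm.add_eq_max_of_ne hne
  rw [h, padicNorm.one, hx, padicNorm_sq] at hmax
  have hx1 : padicNorm l x ^ 2 ≤ 1 := hmax ▸ le_max_left _ _
  exact hXx.trans ((sq_le_one_iff₀ (padicNorm.nonneg _)).1 hx1)

theorem padicNorm_le_zpow_iff {k : ℤ} {x : ℚ} :
    padicNorm l x ≤ (l : ℚ) ^ (-k) ↔ x = 0 ∨ k ≤ padicValRat l x := by
  have hl1 : (1 : ℚ) < l := Nat.one_lt_cast.2 (Fact.out : l.Prime).one_lt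
  rcases eq_or_ne x 0 with rfl | hx
  · simp only [padicNorm.zero, true_or, iff_true]
    positivity
  · rw [padicNorm.eq_zpow_of_nonzero hx, zpow_le_zpow_iff_right₀ hl1]
    simp [hx]

theorem padicNorm_le_zpow_neg_one_iff {x : ℚ} :
    padicNorm l x ≤ (l : ℚ) ^ (-1 : ℤ) ↔ padicNorm l x < 1 := by
  have hl1 : (1 : ℚ) < l := Nat.one_lt_cast.2 (Fact.out : l.Prime).one_lt
  rw [padicNorm_le_zpow_iff]
  rcases eq_or_ne x 0 with rfl | hx
  · simp
  · rw [padicNorm.eq_zpow_of_nonzero hx, zpow_lt_one_iff_right₀ hl1]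
    simp only [hx, false_or]
    omega

theorem padicNorm_add_le {x y B : ℚ} (hx : padicNorm l x ≤ B) (hy : padicNorm l y ≤ B) :
    padicNorm l (x + y) ≤ B :=
  padicNorm.nonarchimedean.trans (max_le hx hy)

theorem padicNorm_int_mul_le (n : ℤ) {x B : ℚ} (hx : padicNorm l x ≤ B) :
    padicNorm l (n * x) ≤ B := by
  rw [padicNorm.mul]
  exact (mul_le_of_le_one_left (padicNorm.nonneg _) (padicNorm.of_int n)).trans hx

theorem exists_pow_forall_padicNorm_mul_le (k : ℤ) (x : ℚ) :
    ∃ N : ℕ, ∀ n : ℤ, (l : ℤ) ^ N ∣ n → padicNorm l (n * x) ≤ (l : ℚ) ^ (-k) := by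
  have hl1 : (1 : ℚ) < l := Nat.one_lt_cast.2 (Fact.out : l.Prime).one_lt
  rcases eq_or_ne x 0 with rfl | hx
  · refine ⟨0, fun n _ => ?_⟩
    rw [mul_zero, padicNorm.zero]
    positivity
  refine ⟨(k - padicValRat l x).toNat, fun n hn => ?_⟩
  have hnorm := padicNorm.dvd_iff_norm_le.1 (by exact_mod_cast hn)
  rw [padicNorm.mul, padicNorm.eq_zpow_of_nonzero hx]
  calc _ ≤ (l : ℚ) ^ (-((k - padicValRat l x).toNat : ℤ)) * (l : ℚ) ^ (-padicValRat l x) :=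
        mul_le_mul_of_nonneg_right hnorm (by positivity)
    _ = (l : ℚ) ^ (-((k - padicValRat l x).toNat : ℤ) + -padicValRat l x) :=
        (zpow_add₀ (by linarith) _ _).symm
    _ ≤ _ := zpow_le_zpow_right₀ hl1.le (by omega)

end padicNorm

/-! ### Semilocal subrings of `ℚ` -/

/-- The rationals of `l`-adic valuation at least `k` for all `l ∈ Δ`: the semilocal ring of `Δ` for
`k = 0`, and its Jacobson radical for `k = 1`. -/
def adicBall (Δ : Finset ℕ) (k : ℤ) : Set ℚ :=
  {x | ∀ l ∈ Δ, padicNorm l x ≤ (l : ℚ) ^ (-k)}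

theorem mem_adicBall_zero {Δ : Finset ℕ} {x : ℚ} :
    x ∈ adicBall Δ 0 ↔ ∀ l ∈ Δ, padicNorm l x ≤ 1 :=
  forall₂_congr fun l _ => by rw [neg_zero, zpow_zero]

theorem forall_prime_singleton {l : ℕ} (hl : l.Prime) : ∀ k ∈ ({l} : Finset ℕ), k.Prime :=
  fun _ hk => Finset.mem_singleton.1 hk ▸ hl

theorem isCoprime_prod_pow_sdiff {Δ₁ Δ₂ : Finset ℕ} (h₁ : ∀ l ∈ Δ₁, l.Prime)
    (h₂ : ∀ l ∈ Δ₂, l.Prime) (N : ℕ → ℕ) :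
    IsCoprime (∏ l ∈ Δ₁ \ Δ₂, (l : ℤ) ^ N l) (∏ l ∈ Δ₂ \ Δ₁, (l : ℤ) ^ N l) := by
  refine IsCoprime.prod_left fun i hi => IsCoprime.prod_right fun j hj => IsCoprime.pow ?_
  rw [Finset.mem_sdiff] at hi hj
  exact Nat.isCoprime_iff_coprime.2 ((Nat.coprime_primes (h₁ i hi.1) (h₂ j hj.1)).2
    (ne_of_mem_of_not_mem hi.1 hj.2))

theorem mul_mem_adicBall {Δ Δ' : Finset ℕ} (hΔ : ∀ l ∈ Δ, l.Prime) {k : ℤ} {x : ℚ}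
    (hx : x ∈ adicBall (Δ ∩ Δ') k) {n : ℤ}
    (hn : ∀ l ∈ Δ \ Δ', padicNorm l (n * x) ≤ (l : ℚ) ^ (-k)) : n * x ∈ adicBall Δ k := by
  intro l hl
  have := Fact.mk (hΔ l hl)
  by_cases h : l ∈ Δ'
  · exact padicNorm_int_mul_le _ (hx l (Finset.mem_inter.2 ⟨hl, h⟩))
  · exact hn l (Finset.mem_sdiff.2 ⟨hl, h⟩)

theorem adicBall_add {Δ₁ Δ₂ : Finset ℕ} (h₁ : ∀ l ∈ Δ₁, l.Prime) (h₂ : ∀ l ∈ Δ₂, l.Prime)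
    (k : ℤ) : adicBall Δ₁ k + adicBall Δ₂ k = adicBall (Δ₁ ∩ Δ₂) k := by
  refine Set.Subset.antisymm ?_ fun x hx => ?_
  · rintro _ ⟨y, hy, z, hz, rfl⟩ l hl
    rw [Finset.mem_inter] at hl
    have := Fact.mk (h₁ l hl.1)
    exact padicNorm_add_le (hy l hl.1) (hz l hl.2)
  · have hexists : ∀ l ∈ Δ₁ ∪ Δ₂, ∃ N : ℕ, ∀ n : ℤ, (l : ℤ) ^ N ∣ n →
        padicNorm l (n * x) ≤ (l : ℚ) ^ (-k) := fun l hl =>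
      have := Fact.mk ((Finset.mem_union.1 hl).elim (h₁ l) (h₂ l))
      exists_pow_forall_padicNorm_mul_le k x
    choose! N hN using hexists
    have hdvd : ∀ (Δ : Finset ℕ) (u : ℤ), ∀ l ∈ Δ, (l : ℤ) ^ N l ∣ u * ∏ l ∈ Δ, (l : ℤ) ^ N l :=
      fun Δ u l hl => (Finset.dvd_prod_of_mem (fun l : ℕ => (l : ℤ) ^ N l) hl).mul_left u
    obtain ⟨u, v, huv⟩ := isCoprime_prod_pow_sdiff h₁ h₂ N
    refine ⟨_, mul_mem_adicBall h₁ hx fun l hl =>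
        hN l (Finset.mem_union_left _ (Finset.mem_sdiff.1 hl).1) _ (hdvd _ u l hl),
      _, mul_mem_adicBall h₂ (by rwa [Finset.inter_comm]) fun l hl =>
        hN l (Finset.mem_union_right _ (Finset.mem_sdiff.1 hl).1) _ (hdvd _ v l hl), ?_⟩
    change _ * x + _ * x = x
    rw [← add_mul, ← Int.cast_add, huv, Int.cast_one, one_mul]

/-- The semilocal ring of rationals that are integral at all primes in `Δ`. -/
def semilocalRing (Δ : Finset ℕ) (hΔ : ∀ l ∈ Δ, l.Prime) : Subring ℚ where
  carrier := adicBall Δ 0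
  mul_mem' {x y} hx hy := mem_adicBall_zero.2 fun l hl => by
    have := Fact.mk (hΔ l hl)
    rw [padicNorm.mul]
    exact mul_le_one₀ (mem_adicBall_zero.1 hx l hl) (padicNorm.nonneg _)
      (mem_adicBall_zero.1 hy l hl)
  one_mem' _ _ := by simp
  add_mem' hx hy l hl :=
    have := Fact.mk (hΔ l hl)
    padicNorm_add_le (hx l hl) (hy l hl)
  zero_mem' _ _ := by simp
  neg_mem' hx l hl := by
    rw [padicNorm.neg]
    exact hx l hl

theorem adicBall_zero_ne_univ {Δ : Finset ℕ} (hΔ : ∀ l ∈ Δ, l.Prime) (hne : Δ.Nonempty) :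
    adicBall Δ 0 ≠ Set.univ := by
  obtain ⟨l, hl⟩ := hne
  have := Fact.mk (hΔ l hl)
  intro h
  have hinv : padicNorm l (l : ℚ)⁻¹ ≤ 1 := mem_adicBall_zero.1 (h ▸ Set.mem_univ _) l hl
  rw [padicNorm_le_one_iff, Rat.inv_natCast_den_of_pos (hΔ l hl).pos] at hinv
  exact hinv dvd_rfl

/-- If `j` were prime to `l`, a multiple of `j` by an integer would be `-1` modulo `l`. -/
theorem padicNorm_lt_one_of_mem_jacobson {A : Subring ℚ} {l : ℕ} [Fact l.Prime]
    (hA : ∀ x ∈ A, padicNorm l x ≤ 1) {j : A} (hj : j ∈ Ring.jacobson A) :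
    padicNorm l j < 1 := by
  have hl : l.Prime := Fact.out
  have hnum : (l : ℤ) ∣ (j : ℚ).num := by
    by_contra hd
    obtain ⟨u, v, huv⟩ := (Nat.prime_iff_prime_int.1 hl).coprime_iff_not_dvd.2 hd
    rw [← Ideal.jacobson_bot, Ideal.mem_jacobson_bot] at hj
    obtain ⟨w, hw⟩ := hj (-v * (j : ℚ).den)
    have hwl : ((w : A) : ℚ) = u * l := by
      have huvQ : (u * l + v * (j : ℚ).num : ℚ) = 1 := by exact_mod_cast huv
      rw [hw]
      push_cast
      linear_combination -(v : ℚ) * Rat.mul_den_eq_num (j : ℚ) - huvQ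
    have hinv : (u * l : ℚ) * ((w⁻¹ : Aˣ) : A) = 1 := by
      rw [← hwl]
      exact_mod_cast congrArg Subtype.val w.mul_inv
    have hlt : padicNorm l (u * l * ((w⁻¹ : Aˣ) : A) : ℚ) < 1 := by
      rw [mul_assoc]
      refine (padicNorm_int_mul_le u (B := padicNorm l l) ?_).trans_lt
        padicNorm.padicNorm_p_lt_one_of_prime
      rw [padicNorm.mul]
      exact mul_le_of_le_one_right (padicNorm.nonneg _) (hA _ ((w⁻¹ : Aˣ) : A).2)
    rw [hinv, padicNorm.one] at hlt
    exact lt_irrefl 1 hlt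
  rw [← Rat.num_div_den (j : ℚ), padicNorm.div,
    (padicNorm.nat_eq_one_iff _).2 (padicNorm_le_one_iff.1 (hA j j.2)), div_one]
  exact (padicNorm.int_lt_one_iff _).2 hnum

theorem jacobsonRadical_subset_adicBall_one {Δ : Finset ℕ} (hΔ : ∀ l ∈ Δ, l.Prime) {R : Set ℚ}
    (hR : R ⊆ adicBall Δ 0) : jacobsonRadical R ⊆ adicBall Δ 1 := by
  rintro _ ⟨j, hj, rfl⟩ l hl
  have := Fact.mk (hΔ l hl)
  have hle : Subring.closure R ≤ semilocalRing Δ hΔ := Subring.closure_le.2 hR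
  exact padicNorm_le_zpow_neg_one_iff.2 (padicNorm_lt_one_of_mem_jacobson
    (fun x hx => mem_adicBall_zero.1 (hle hx) l hl) hj)

theorem mem_jacobson_semilocalRing {Δ : Finset ℕ} (hΔ : ∀ l ∈ Δ, l.Prime) (hne : Δ.Nonempty)
    {x : semilocalRing Δ hΔ} (hx : ∀ l ∈ Δ, padicNorm l x < 1) :
    x ∈ Ring.jacobson (semilocalRing Δ hΔ) := by
  rw [← Ideal.jacobson_bot, Ideal.mem_jacobson_bot]
  intro y
  have hnorm : ∀ l ∈ Δ, padicNorm l (x * y + 1) = 1 := fun l hl => by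
    have := Fact.mk (hΔ l hl)
    have hxy : padicNorm l (x * y) < 1 := by
      rw [padicNorm.mul]
      exact mul_lt_one_of_nonneg_of_lt_one_left (padicNorm.nonneg _) (hx l hl)
        (mem_adicBall_zero.1 y.2 l hl)
    rw [padicNorm.add_eq_max_of_ne (by rw [padicNorm.one]; exact hxy.ne), padicNorm.one,
      max_eq_right hxy.le]
  have h0 : (x * y + 1 : ℚ) ≠ 0 := fun h0 => by
    obtain ⟨l, hl⟩ := hne
    exact zero_ne_one ((padicNorm.zero (p := l)).symm.trans (h0 ▸ hnorm l hl))
  have hinv : (x * y + 1 : ℚ)⁻¹ ∈ semilocalRing Δ hΔ := mem_adicBall_zero.2 fun l hl => by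
    have := Fact.mk (hΔ l hl)
    rw [inv_eq_one_div, padicNorm.div, hnorm l hl, padicNorm.one, div_one]
  exact IsUnit.of_mul_eq_one (⟨_, hinv⟩ : semilocalRing Δ hΔ) (Subtype.ext (mul_inv_cancel₀ h0))

theorem jacobsonRadical_adicBall {Δ : Finset ℕ} (hΔ : ∀ l ∈ Δ, l.Prime) (hne : Δ.Nonempty) :
    jacobsonRadical (adicBall Δ 0) = adicBall Δ 1 := by
  refine (jacobsonRadical_subset_adicBall_one hΔ subset_rfl).antisymm fun x hx => ?_
  have hlt : ∀ l ∈ Δ, padicNorm l x < 1 := fun l hl =>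
    have := Fact.mk (hΔ l hl)
    padicNorm_le_zpow_neg_one_iff.1 (hx l hl)
  have hmem : x ∈ semilocalRing Δ hΔ := mem_adicBall_zero.2 fun l hl => (hlt l hl).le
  exact (jacobsonRadical_coe (semilocalRing Δ hΔ)).symm ▸
    ⟨⟨x, hmem⟩, mem_jacobson_semilocalRing hΔ hne hlt, rfl⟩

theorem exists_padicValRat_eq {Δ : Finset ℕ} (hΔ : ∀ l ∈ Δ, l.Prime) (e : ℕ → ℤ) :
    ∃ w : ℚ, w ≠ 0 ∧ ∀ l ∈ Δ, padicValRat l w = e l := by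
  induction Δ using Finset.induction_on with
  | empty => exact ⟨1, one_ne_zero, by simp⟩
  | insert k Δ hk ih =>
    obtain ⟨w, hw, h⟩ := ih fun l hl => hΔ l (Finset.mem_insert_of_mem hl)
    have hkp := Fact.mk (hΔ k (Finset.mem_insert_self k Δ))
    have hz : (k : ℚ) ^ (e k - padicValRat k w) ≠ 0 :=
      zpow_ne_zero _ (Nat.cast_ne_zero.2 hkp.out.ne_zero)
    refine ⟨w * (k : ℚ) ^ (e k - padicValRat k w), mul_ne_zero hw hz, fun l hl => ?_⟩
    have hlp := Fact.mk (hΔ l hl)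
    rw [padicValRat.mul hw hz, padicValRat.zpow]
    rcases Finset.mem_insert.1 hl with rfl | hl'
    · rw [padicValRat.self hkp.out.one_lt]
      ring
    · rw [h l hl', padicValRat.of_nat, padicValNat_primes (ne_of_mem_of_not_mem hl' hk)]
      simp

section padicValRat

variable {l : ℕ} [Fact l.Prime] {x y : ℚ}

theorem padicValRat_sub_of_lt (hx : x ≠ 0) (h : y = 0 ∨ padicValRat l x < padicValRat l y) :
    padicValRat l (x - y) = padicValRat l x := by
  rcases eq_or_ne y 0 with rfl | hy
  · rw [sub_zero]
  have hlt := h.resolve_left hy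
  rw [sub_eq_add_neg]
  refine padicValRat.add_eq_of_lt (fun h0 => ?_) hx (neg_ne_zero.2 hy) (by rwa [padicValRat.neg])
  rw [eq_neg_of_add_eq_zero_left h0, neg_neg] at hlt
  exact lt_irrefl _ hlt

theorem padicValRat_sub_of_gt (hy : y ≠ 0) (h : x = 0 ∨ padicValRat l y < padicValRat l x) :
    padicValRat l (x - y) = padicValRat l y := by
  rw [← neg_sub, padicValRat.neg, padicValRat_sub_of_lt hy h]

theorem even_padicValRat_one_sub_of_pos (hy : 0 < padicValRat l y) :
    Even (padicValRat l (1 - y)) := by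
  rw [padicValRat_sub_of_lt one_ne_zero (Or.inr (by rwa [padicValRat.one])), padicValRat.one]
  exact Even.zero

theorem padicValRat_one_sub_of_neg (hy : padicValRat l y < 0) :
    padicValRat l (1 - y) = padicValRat l y := by
  have hy0 : y ≠ 0 := fun h => by simp [h] at hy
  exact padicValRat_sub_of_gt hy0 (Or.inr (by rwa [padicValRat.one]))

/-- If the valuation of `c` is odd, take `y` of odd valuation such that `x - y` has valuation `1`;
if it is even, let `y` have a pole of even order. -/
theorem exists_forall_even_padicValRat (c : ℚ) (hx : x = 0 ∨ 1 ≤ padicValRat l x) :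
    ∃ e : ℤ, ∀ y : ℚ, y ≠ 0 → padicValRat l y = e →
      (Even (padicValRat l y - padicValRat l c) ∧ Even (padicValRat l (1 - y))) ∧
        Even (padicValRat l (x - y) - padicValRat l c) ∧ Even (padicValRat l (1 - (x - y))) := by
  rcases Int.even_or_odd (padicValRat l c) with hc | hc
  · refine ⟨-2, fun y hy0 hy => ?_⟩
    have hxy : padicValRat l (x - y) = -2 := by
      rw [padicValRat_sub_of_gt hy0 (hx.imp_right (by omega)), hy]
    rw [padicValRat_one_sub_of_neg (by omega), padicValRat_one_sub_of_neg (by omega), hy, hxy]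
    have h2 : Even (-2 : ℤ) := by decide
    exact ⟨⟨h2.sub hc, h2⟩, h2.sub hc, h2⟩
  · suffices ∃ e : ℤ, 0 < e ∧ Odd e ∧ ∀ y : ℚ, y ≠ 0 → padicValRat l y = e →
        padicValRat l (x - y) = 1 by
      obtain ⟨e, he0, heo, he⟩ := this
      refine ⟨e, fun y hy0 hy => ⟨⟨by rw [hy]; exact heo.sub_odd hc, ?_⟩, ?_, ?_⟩⟩
      · exact even_padicValRat_one_sub_of_pos (by omega)
      · rw [he y hy0 hy]
        exact odd_one.sub_odd hc
      · exact even_padicValRat_one_sub_of_pos (by rw [he y hy0 hy]; exact one_pos)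
    by_cases hx1 : padicValRat l x = 1
    · have hx0 : x ≠ 0 := fun h => by simp [h] at hx1
      refine ⟨3, by norm_num, by decide, fun y _ hy => ?_⟩
      rw [padicValRat_sub_of_lt hx0 (Or.inr (by omega)), hx1]
    · refine ⟨1, one_pos, odd_one, fun y hy0 hy => ?_⟩
      rw [padicValRat_sub_of_gt hy0 (hx.imp_right (by omega)), hy]

end padicValRat

section

variable {a b : ℚ} {Δ : Finset ℕ}

theorem mem_adicBall_iff (hΔ : ∀ l ∈ Δ, l.Prime) {k : ℤ} {x : ℚ} :
    x ∈ adicBall Δ k ↔ ∀ l ∈ Δ, x = 0 ∨ k ≤ padicValRat l x :=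
  forall₂_congr fun l hl =>
    have := Fact.mk (hΔ l hl)
    padicNorm_le_zpow_iff

theorem mem_TUnits_iff (hΔ : ∀ l ∈ Δ, l.Prime) (hT : T a b = adicBall Δ 0) {u : ℚ} :
    u ∈ TUnits a b ↔ u ≠ 0 ∧ ∀ l ∈ Δ, padicValRat l u = 0 := by
  unfold TUnits
  rw [Set.mem_ofPred_eq, hT]
  simp only [mem_adicBall_iff hΔ]
  constructor
  · rintro ⟨hu, v, hv, huv⟩
    have hu0 := left_ne_zero_of_mul_eq_one huv
    have hv0 := right_ne_zero_of_mul_eq_one huv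
    refine ⟨hu0, fun l hl => ?_⟩
    have := Fact.mk (hΔ l hl)
    have hadd := congrArg (padicValRat l) huv
    rw [padicValRat.mul hu0 hv0, padicValRat.one] at hadd
    have hul := (hu l hl).resolve_left hu0
    have hvl := (hv l hl).resolve_left hv0
    omega
  · rintro ⟨hu0, hu⟩
    refine ⟨fun l hl => Or.inr (hu l hl).ge, u⁻¹, fun l hl => Or.inr ?_, mul_inv_cancel₀ hu0⟩
    have := Fact.mk (hΔ l hl)
    rw [padicValRat.inv, hu l hl, neg_zero]

theorem mem_sqClass_iff (hΔ : ∀ l ∈ Δ, l.Prime) (hT : T a b = adicBall Δ 0) {c x : ℚ}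
    (hc : c ≠ 0) :
    x ∈ sqClass a b c ↔ x = 0 ∨ ∀ l ∈ Δ, Even (padicValRat l x - padicValRat l c) := by
  unfold sqClass
  simp only [Set.mem_ofPred_eq, mem_TUnits_iff hΔ hT]
  constructor
  · rintro ⟨w, u, ⟨hu, hul⟩, rfl⟩
    rcases eq_or_ne w 0 with rfl | hw
    · left
      ring
    · refine Or.inr fun l hl => ?_
      have := Fact.mk (hΔ l hl)
      rw [padicValRat.mul (mul_ne_zero hc (pow_ne_zero 2 hw)) hu,
        padicValRat.mul hc (pow_ne_zero 2 hw), padicValRat.pow, hul l hl]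
      exact ⟨padicValRat l w, by push_cast; ring⟩
  · intro h
    rcases eq_or_ne x 0 with rfl | hx
    · exact ⟨0, 1, ⟨one_ne_zero, fun l _ => padicValRat.one⟩, by ring⟩
    obtain ⟨w, hw, hwl⟩ := exists_padicValRat_eq hΔ
      fun l => (padicValRat l x - padicValRat l c) / 2
    have hcw := mul_ne_zero hc (pow_ne_zero 2 hw)
    refine ⟨w, x / (c * w ^ 2), ⟨div_ne_zero hx hcw, fun l hl => ?_⟩, by field_simp⟩
    have := Fact.mk (hΔ l hl)
    obtain ⟨r, hr⟩ := h.resolve_left hx l hl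
    rw [padicValRat.div hx hcw, padicValRat.mul hc (pow_ne_zero 2 hw), padicValRat.pow, hwl l hl]
    push_cast
    omega

theorem mem_K_iff (hΔ : ∀ l ∈ Δ, l.Prime) (hT : T a b = adicBall Δ 0) {c y : ℚ} (hc : c ≠ 0) :
    y ∈ K a b c ↔ (y = 0 ∨ ∀ l ∈ Δ, Even (padicValRat l y - padicValRat l c)) ∧
      (1 - y = 0 ∨ ∀ l ∈ Δ, Even (padicValRat l (1 - y))) := by
  have hsub : (∃ z ∈ sqClass a b 1, y = 1 - z) ↔ 1 - y ∈ sqClass a b 1 :=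
    ⟨fun ⟨z, hz, h⟩ => by rwa [h, sub_sub_cancel], fun h => ⟨_, h, by ring⟩⟩
  unfold K
  rw [Set.mem_ofPred_eq, hsub, mem_sqClass_iff hΔ hT hc, mem_sqClass_iff hΔ hT one_ne_zero]
  simp

/-- A pole of `y` at `l` would have odd order, as has `c`, and even order, as has `1 - y`. -/
theorem padicNorm_le_of_mem_K (hΔ : ∀ l ∈ Δ, l.Prime) (hT : T a b = adicBall Δ 0) {c y : ℚ}
    (hc : c ≠ 0) (hy : y ∈ K a b c) {l : ℕ} (hl : l ∈ Δ) (hcl : Odd (padicValRat l c)) :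
    padicNorm l y ≤ (l : ℚ) ^ (-1 : ℤ) := by
  have := Fact.mk (hΔ l hl)
  rw [padicNorm_le_zpow_iff]
  obtain ⟨hyc, hy1⟩ := (mem_K_iff hΔ hT hc).1 hy
  refine hyc.imp_right fun hyc => ?_
  obtain ⟨r, hr⟩ := hcl
  obtain ⟨s, hs⟩ := hyc l hl
  by_contra! hlt
  have hneg : padicValRat l y < 0 := by omega
  have hval := padicValRat_one_sub_of_neg hneg
  rcases hy1 with h0 | heven
  · rw [h0, padicValRat.zero] at hval
    omega
  · obtain ⟨m, hm⟩ := heven l hl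
    omega

theorem exists_mem_K (hΔ : ∀ l ∈ Δ, l.Prime) (hT : T a b = adicBall Δ 0) {c x : ℚ}
    (hc : c ≠ 0) (hx : x ∈ adicBall Δ 1) : ∃ y, y ∈ K a b c ∧ x - y ∈ K a b c := by
  rw [mem_adicBall_iff hΔ] at hx
  choose! e he using fun l hl =>
    have := Fact.mk (hΔ l hl)
    exists_forall_even_padicValRat c (hx l hl)
  obtain ⟨y, hy0, hy⟩ := exists_padicValRat_eq hΔ e
  have hlocal := fun l hl => he l hl y hy0 (hy l hl)
  exact ⟨y, (mem_K_iff hΔ hT hc).2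
      ⟨Or.inr fun l hl => (hlocal l hl).1.1, Or.inr fun l hl => (hlocal l hl).1.2⟩,
    (mem_K_iff hΔ hT hc).2
      ⟨Or.inr fun l hl => (hlocal l hl).2.1, Or.inr fun l hl => (hlocal l hl).2.2⟩⟩

theorem padicNorm_le_of_exists_mem_K (hΔ : ∀ l ∈ Δ, l.Prime) (hT : T a b = adicBall Δ 0)
    {c x y : ℚ} (hc : c ≠ 0) (hy : y ∈ K a b c) (hxy : x - y ∈ K a b c) {l : ℕ} (hl : l ∈ Δ)
    (hcl : Odd (padicValRat l c)) : padicNorm l x ≤ (l : ℚ) ^ (-1 : ℤ) := by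
  have := Fact.mk (hΔ l hl)
  rw [← add_sub_cancel y x]
  exact padicNorm_add_le (padicNorm_le_of_mem_K hΔ hT hc hy hl hcl)
    (padicNorm_le_of_mem_K hΔ hT hc hxy hl hcl)

theorem J_eq_adicBall (hΔ : ∀ l ∈ Δ, l.Prime) (hT : T a b = adicBall Δ 0) (ha : a ≠ 0)
    (hb : b ≠ 0) (hab : ∀ l ∈ Δ, Odd (padicValRat l a) ∨ Odd (padicValRat l b)) :
    J a b = adicBall Δ 1 := by
  ext x
  constructor
  · rintro ⟨y₁, y₂, ⟨hy₁, hxy₁⟩, hy₂, hxy₂⟩ l hl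
    exact (hab l hl).elim (padicNorm_le_of_exists_mem_K hΔ hT ha hy₁ hxy₁ hl)
      (padicNorm_le_of_exists_mem_K hΔ hT hb hy₂ hxy₂ hl)
  · intro hx
    obtain ⟨y₁, h₁⟩ := exists_mem_K hΔ hT ha hx
    obtain ⟨y₂, h₂⟩ := exists_mem_K hΔ hT hb hx
    exact ⟨y₁, y₂, h₁, h₂⟩

end

/-! ### The traces are integral at the ramified primes -/

theorem S_mul_sq_left (a b : ℚ) {w : ℚ} (hw : w ≠ 0) : S (a * w ^ 2) b = S a b := by
  ext t
  constructor
  · rintro ⟨x₁, x₂, x₃, x₄, h, rfl⟩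
    exact ⟨x₁, w * x₂, x₃, w * x₄, by rw [← h]; ring, rfl⟩
  · rintro ⟨x₁, x₂, x₃, x₄, h, rfl⟩
    exact ⟨x₁, x₂ / w, x₃, x₄ / w, by rw [← h]; field_simp, rfl⟩

theorem S_comm (a b : ℚ) : S a b = S b a := by
  ext t
  constructor <;>
  · rintro ⟨x₁, x₂, x₃, x₄, h, rfl⟩
    exact ⟨x₁, x₃, x₂, x₄, by rw [← h]; ring, rfl⟩

theorem S_mul_sq_right (a b : ℚ) {w : ℚ} (hw : w ≠ 0) : S a (b * w ^ 2) = S a b := by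
  rw [S_comm, S_mul_sq_left _ _ hw, S_comm]

theorem S_neg_mul (c : ℚ) {b : ℚ} (hb : b ≠ 0) : S (-(c * b)) b = S c b := by
  ext t
  constructor
  · rintro ⟨x₁, x₂, x₃, x₄, h, rfl⟩
    exact ⟨x₁, b * x₄, x₃, x₂, by rw [← h]; ring, rfl⟩
  · rintro ⟨x₁, x₂, x₃, x₄, h, rfl⟩
    exact ⟨x₁, x₄, x₃, x₂ / b, by rw [← h]; field_simp; ring, rfl⟩

theorem T_subset_adicBall {a b : ℚ} {Δ : Finset ℕ} (hΔ : ∀ l ∈ Δ, l.Prime)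
    (h : ∀ t ∈ S a b, ∀ l ∈ Δ, padicNorm l t ≤ 1) : T a b ⊆ adicBall Δ 0 := by
  rintro _ ⟨s, hs, s', hs', rfl⟩
  exact (semilocalRing Δ hΔ).add_mem (mem_adicBall_zero.2 (h s hs)) (mem_adicBall_zero.2 (h s' hs'))

section

variable {l : ℕ} [Fact l.Prime]

theorem padicNorm_le_one_of_mem_S {u : ℤ} (hu : jacobiSym u l = -1) {b t : ℚ} (hb0 : b ≠ 0)
    (hb : Odd (padicValRat l b)) (ht : t ∈ S u b) : padicNorm l t ≤ 1 := by
  obtain ⟨x₁, x₂, x₃, x₄, hx, rfl⟩ := ht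
  have hnorm : x₁ ^ 2 - u * x₂ ^ 2 + -b * (x₃ ^ 2 - u * x₄ ^ 2) = 1 := by
    rw [← hx]
    ring
  exact_mod_cast padicNorm_int_mul_le 2
    (padicNorm_le_one_of_norm_eq_one hu (neg_ne_zero.2 hb0) (by rwa [padicValRat.neg]) hnorm)

theorem padicNorm_le_one_of_mem_S_of_not_dvd {c q : ℤ} (hlc : ¬ (l : ℤ) ∣ c) (hq : q ≠ 0)
    (h : hilbertSymbol l q c = -1) {t : ℚ} (ht : t ∈ S c q) : padicNorm l t ≤ 1 := by
  rw [hilbertSymbol_of_not_dvd_right q hlc] at h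
  have hc : jacobiSym c l = -1 :=
    (jacobiSym_eq_one_or Fact.out hlc).resolve_left fun h1 => by
      rw [h1, one_pow] at h
      exact absurd h (by norm_num)
  have hval : Odd (padicValInt l q) := by
    by_contra heven
    rw [hc, (Nat.not_odd_iff_even.1 heven).neg_one_pow] at h
    exact absurd h (by norm_num)
  refine padicNorm_le_one_of_mem_S hc (Int.cast_ne_zero.2 hq) ?_ ht
  rw [padicValRat.of_int]
  exact_mod_cast hval

/-- When `l` divides both entries, the algebra `(c, q)` is also `(-c q, q)`, and `-c q` is `l ^ 2`
times an integer prime to `l`. -/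
theorem padicNorm_le_one_of_mem_S_of_hilbertSymbol {c q : ℤ} (hc : Squarefree c)
    (hq : Squarefree q) (h : hilbertSymbol l q c = -1) {t : ℚ} (ht : t ∈ S c q) :
    padicNorm l t ≤ 1 := by
  have hl : l.Prime := Fact.out
  by_cases hlc : (l : ℤ) ∣ c
  swap
  · exact padicNorm_le_one_of_mem_S_of_not_dvd hlc hq.ne_zero h ht
  by_cases hlq : (l : ℤ) ∣ q
  swap
  · rw [hilbertSymbol_comm] at h
    exact padicNorm_le_one_of_mem_S_of_not_dvd hlq hc.ne_zero h (by rwa [S_comm])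
  obtain ⟨c', rfl⟩ := hlc
  obtain ⟨q', rfl⟩ := hlq
  have hndvd : ∀ {n : ℤ}, Squarefree (l * n) → ¬ (l : ℤ) ∣ n := fun hn hd =>
    (Nat.prime_iff_prime_int.1 hl).not_isUnit (hn l (mul_dvd_mul_left _ hd))
  have hlu : ¬ (l : ℤ) ∣ -(c' * q') := by
    rw [dvd_neg]
    exact (Nat.prime_iff_prime_int.1 hl).not_dvd_mul (hndvd hc) (hndvd hq)
  have hlu0 : -(c' * q') ≠ 0 := fun h0 => hlu (h0.symm ▸ dvd_zero _)
  have hl0 : (l : ℤ) ≠ 0 := Nat.cast_ne_zero.2 hl.ne_zero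
  have hmul : l * c' * -(l * q') = -(c' * q') * (l : ℤ) ^ 2 := by ring
  refine padicNorm_le_one_of_mem_S_of_not_dvd (q := l * q') hlu hq.ne_zero ?_ ?_
  · rw [← hilbertSymbol_mul_sq_right hl hq.ne_zero hlu0 hl0, ← hmul,
      hilbertSymbol_mul_right hl _ hc.ne_zero (neg_ne_zero.2 hq.ne_zero), h,
      hilbertSymbol_neg_self hl hq.ne_zero, mul_one]
  · rw [← S_neg_mul _ (Int.cast_ne_zero.2 hq.ne_zero)] at ht
    rw [← S_mul_sq_left _ _ (w := l) (Nat.cast_ne_zero.2 hl.ne_zero)]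
    convert ht using 2
    push_cast
    ring

end

theorem not_four_dvd_sq_add_sq_add_one (x y : ℤ) : ¬ 4 ∣ x ^ 2 + y ^ 2 + 1 := by
  have h : ∀ n : ℤ, n ^ 2 % 4 = 0 ∨ n ^ 2 % 4 = 1 := fun n => by
    rcases Int.even_or_odd' n with ⟨k, rfl | rfl⟩ <;> ring_nf <;> omega
  have hx := h x
  have hy := h y
  omega

theorem two_dvd_of_sixteen_dvd_form {P Q : ℤ} (hP : P % 8 = 1) (hQ : Q % 8 = 3) {x y z w : ℤ}
    (h : 16 ∣ x ^ 2 - 2 * P * y ^ 2 - Q * z ^ 2 + 2 * P * Q * w ^ 2) :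
    2 ∣ x ∧ 2 ∣ y ∧ 2 ∣ z ∧ 2 ∣ w := by
  obtain ⟨p, rfl⟩ : ∃ p, P = 8 * p + 1 := ⟨P / 8, by omega⟩
  obtain ⟨q, rfl⟩ : ∃ q, Q = 8 * q + 3 := ⟨Q / 8, by omega⟩
  have hred : 16 ∣ x ^ 2 - 3 * z ^ 2 - 2 * y ^ 2 + 6 * w ^ 2 - 8 * (q * z ^ 2) := by
    obtain ⟨m, hm⟩ := h
    exact ⟨m + p * y ^ 2 - (8 * p * q + q + 3 * p) * w ^ 2, by linear_combination hm⟩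
  have hodd : ∀ {n : ℤ}, ¬ 2 ∣ n → n ^ 2 % 8 = 1 := fun hn => sq_emod_eight (by grind)
  have heven : ∀ {n : ℤ}, 2 ∣ n → n ^ 2 % 4 = 0 := by
    rintro _ ⟨k, rfl⟩
    ring_nf
    omega
  have hyw := not_four_dvd_sq_add_sq_add_one y w
  by_cases hx : 2 ∣ x <;> by_cases hz : 2 ∣ z
  · obtain ⟨a, rfl⟩ := hx
    obtain ⟨b, rfl⟩ := hz
    have hab := not_four_dvd_sq_add_sq_add_one a b
    simp only [mul_pow] at hred
    by_cases hy : 2 ∣ y <;> by_cases hw : 2 ∣ w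
    · exact ⟨dvd_mul_right _ _, hy, dvd_mul_right _ _, hw⟩
    · have := heven hy
      have := hodd hw
      omega
    · have := hodd hy
      have := heven hw
      omega
    · have := hodd hy
      have := hodd hw
      have : q * (2 ^ 2 * b ^ 2) = 4 * (q * b ^ 2) := by ring
      omega
  · have := heven hx
    have := hodd hz
    omega
  · have := hodd hx
    have := heven hz
    omega
  · have := hodd hx
    have := hodd hz
    omega

theorem padicNorm_div_le_one {l : ℕ} [Fact l.Prime] (x : ℤ) {k : ℤ} (hk : ¬ (l : ℤ) ∣ k) :
    padicNorm l (x / k) ≤ 1 := by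
  rw [padicNorm.div, (padicNorm.int_eq_one_iff k).2 hk, div_one]
  exact padicNorm.of_int x

theorem padicNorm_two_mul_div_le_one {P Q : ℤ} (hP : P % 8 = 1) (hQ : Q % 8 = 3) {M x y z w : ℤ}
    (hM : M ≠ 0) (h : x ^ 2 - 2 * P * y ^ 2 - Q * z ^ 2 + 2 * P * Q * w ^ 2 = M ^ 2) :
    padicNorm 2 (2 * (x / M)) ≤ 1 := by
  induction hn : M.natAbs using Nat.strong_induction_on generalizing M x y z w with
  | _ n ih =>
  by_cases h4 : 4 ∣ M
  · obtain ⟨k, rfl⟩ := h4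
    obtain ⟨⟨a, rfl⟩, ⟨b, rfl⟩, ⟨c, rfl⟩, ⟨d, rfl⟩⟩ :=
      two_dvd_of_sixteen_dvd_form hP hQ (x := x) (y := y) (z := z) (w := w)
        (by rw [h]; exact ⟨k ^ 2, by ring⟩)
    have hk0 : (k : ℚ) ≠ 0 := by exact_mod_cast right_ne_zero_of_mul hM
    convert ih (2 * k).natAbs (by omega) (by omega)
      (by linarith : a ^ 2 - 2 * P * b ^ 2 - Q * c ^ 2 + 2 * P * Q * d ^ 2 = (2 * k) ^ 2)
      rfl using 2
    push_cast
    field_simp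
    ring
  by_cases h2 : 2 ∣ M
  · obtain ⟨k, rfl⟩ := h2
    have hdiv : (2 * (x / (2 * k : ℤ)) : ℚ) = x / k := by
      push_cast
      ring
    rw [hdiv]
    exact padicNorm_div_le_one x fun ⟨j, hj⟩ => h4 ⟨j, by rw [hj]; push_cast; ring⟩
  · rw [← mul_div_assoc]
    exact_mod_cast padicNorm_div_le_one (l := 2) (2 * x) h2

theorem padicNorm_two_le_one_of_mem_S {P Q : ℤ} (hP : P % 8 = 1) (hQ : Q % 8 = 3) {t : ℚ}
    (ht : t ∈ S (2 * P : ℤ) Q) : padicNorm 2 t ≤ 1 := by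
  obtain ⟨x, y, z, w, h, rfl⟩ := ht
  obtain ⟨M, hM⟩ := IsLocalization.exist_integer_multiples_of_finset (nonZeroDivisors ℤ)
    ({x, y, z, w} : Finset ℚ)
  have hM0 : (M : ℤ) ≠ 0 := nonZeroDivisors.coe_ne_zero M
  have hMQ : ((M : ℤ) : ℚ) ≠ 0 := Int.cast_ne_zero.2 hM0
  have hint : ∀ r ∈ ({x, y, z, w} : Finset ℚ), ∃ n : ℤ, r = n / (M : ℤ) := fun r hr => by
    obtain ⟨n, hn⟩ := hM r hr
    refine ⟨n, (eq_div_iff hMQ).2 ?_⟩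
    rw [mul_comm]
    simpa [Submonoid.smul_def] using hn.symm
  obtain ⟨x', rfl⟩ := hint x (by simp)
  obtain ⟨y', rfl⟩ := hint y (by simp)
  obtain ⟨z', rfl⟩ := hint z (by simp)
  obtain ⟨w', rfl⟩ := hint w (by simp)
  refine padicNorm_two_mul_div_le_one hP hQ (y := y') (z := z') (w := w') hM0 ?_
  field_simp at h
  exact_mod_cast h

theorem T_mul_neg_subset_adicBall {l : ℕ} [Fact l.Prime] {u : ℤ} (hu : jacobiSym u l = -1) {q : ℚ}
    (hq : q ≠ 0) (hv : Odd (padicValRat l q)) : T (u * q) (-q) ⊆ adicBall {l} 0 := by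
  refine T_subset_adicBall (forall_prime_singleton Fact.out) fun t ht k hk => ?_
  rw [← neg_neg (u * q : ℚ), ← mul_neg, S_neg_mul _ (neg_ne_zero.2 hq)] at ht
  rw [Finset.mem_singleton.1 hk]
  exact padicNorm_le_one_of_mem_S hu (neg_ne_zero.2 hq) (by rwa [padicValRat.neg]) ht

theorem R3_subset_adicBall {l : ℕ} [Fact l.Prime] (hl8 : l % 8 = 3) {q : ℚ} (hq : q ≠ 0)
    (hv : Odd (padicValRat l q)) : R3 q ⊆ adicBall {l} 0 := by
  have hlo : Odd l := Nat.odd_iff.2 (by omega)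
  have h1 : jacobiSym (-1) l = -1 := by
    rw [jacobiSym.at_neg_one hlo, ZMod.χ₄_nat_three_mod_four (by omega)]
  have h2 : jacobiSym 2 l = -1 := by
    rw [jacobiSym.at_two hlo, ZMod.χ₈_nat_mod_eight, hl8]
    decide
  have hT1 := T_mul_neg_subset_adicBall h1 hq hv
  have hT2 := T_mul_neg_subset_adicBall h2 hq hv
  simp only [Int.cast_neg, Int.cast_one, neg_one_mul, Int.cast_ofNat] at hT1 hT2
  rintro _ ⟨s, hs, s', hs', rfl⟩
  exact (semilocalRing {l} (forall_prime_singleton Fact.out)).add_mem (hT1 hs) (hT2 hs')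

theorem jacobiSym_eq_one_of_eq_sq_mul {l : ℕ} [Fact l.Prime] {n : ℤ} (hn : ¬ (l : ℤ) ∣ n)
    {r j : ℚ} (hj : padicNorm l j < 1) (h : (n : ℚ) = r ^ 2 * (1 + j)) : jacobiSym n l = 1 := by
  refine (jacobiSym_eq_one_or Fact.out hn).resolve_right fun hn1 => ?_
  have h1j : padicNorm l (1 + j) = 1 := by
    rw [padicNorm.add_eq_max_of_ne (by rw [padicNorm.one]; exact hj.ne'), padicNorm.one,
      max_eq_left hj.le]
  have hr : padicNorm l (r ^ 2) = 1 := by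
    rw [← padicNorm_eq_one_of_jacobiSym_eq_neg_one hn1, h, padicNorm.mul, h1j, mul_one]
  have hr1 : padicNorm l r ≤ 1 := by
    rw [padicNorm_sq] at hr
    exact (sq_le_one_iff₀ (padicNorm.nonneg _)).1 hr.le
  have hlt : padicNorm l (r ^ 2 - n) < 1 := by
    rw [h, show r ^ 2 - r ^ 2 * (1 + j) = -(r ^ 2 * j) by ring, padicNorm.neg, padicNorm.mul, hr,
      one_mul]
    exact hj
  exact hlt.ne (padicNorm_sq_sub_eq_one hn1 hr1)

/-! ### Square classes in `Φ k` -/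

theorem mod_eight_of_prime_factors {k : ℕ} (hk : k = 1 ∨ k = 3) {n : ℕ} (hn : n ≠ 0)
    (h : ∀ l : ℕ, l.Prime → l ∣ n → l % 8 = 1 ∨ l % 8 = k) : n % 8 = 1 ∨ n % 8 = k := by
  induction n using induction_on_primes with
  | zero => exact absurd rfl hn
  | one => exact Or.inl rfl
  | prime_mul p n hp ih =>
    have hp8 := h p hp (dvd_mul_right p n)
    have hn8 := ih (right_ne_zero_of_mul hn) fun l hl hd => h l hl (hd.mul_left p)
    rw [Nat.mul_mod]
    rcases hk with rfl | rfl <;> rcases hp8 with hp8 | hp8 <;> rcases hn8 with hn8 | hn8 <;>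
      simp [hp8, hn8]

theorem exists_eq_squarefree_mul_sq {p : ℚ} (hp : p ≠ 0) :
    ∃ (m : ℤ) (w : ℚ), p = m * w ^ 2 ∧ Squarefree m ∧ w ≠ 0 := by
  have hden : (p.den : ℚ) ≠ 0 := Nat.cast_ne_zero.2 p.den_nz
  obtain ⟨m, j, hmj, hm, -, hj⟩ := exists_sq_mul_squarefree_int (n := p.num * p.den)
    (mul_ne_zero (Rat.num_ne_zero.2 hp) (Int.natCast_ne_zero.2 p.den_nz))
  refine ⟨m, j / p.den, ?_, hm, div_ne_zero (Int.cast_ne_zero.2 hj) hden⟩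
  have hmjQ : (p.num : ℚ) * p.den = m * j ^ 2 := by exact_mod_cast hmj
  field_simp
  rw [← hmjQ, ← Rat.mul_den_eq_num p]
  ring

theorem padicNorm_two_le_iff {n : ℤ} : padicNorm 2 n ≤ 2 ^ (-3 : ℤ) ↔ 8 ∣ n := by
  exact_mod_cast (padicNorm.dvd_iff_norm_le (p := 2) (n := 3) (z := n)).symm

theorem padicNorm_two_eq_one_of_odd {n : ℤ} (hn : Odd n) : padicNorm 2 n = 1 :=
  (padicNorm.int_eq_one_iff n).2 (by grind)

theorem padicNorm_two_one_sub_sq_le {w : ℚ} (hw : padicNorm 2 w = 1) :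
    padicNorm 2 (1 - w ^ 2) ≤ 2 ^ (-3 : ℤ) := by
  have hden2 : ¬ 2 ∣ w.den := padicNorm_le_one_iff.1 hw.le
  have hden : padicNorm 2 w.den = 1 := (padicNorm.nat_eq_one_iff _).2 hden2
  have hnum : ¬ ((2 : ℕ) : ℤ) ∣ w.num := by
    rw [← padicNorm.int_eq_one_iff, ← Rat.mul_den_eq_num, padicNorm.mul, hw, hden, one_mul]
  have hsub : (8 : ℤ) ∣ w.den ^ 2 - w.num ^ 2 := by
    have hd8 := sq_emod_eight (x := w.den) (by grind)
    have hn8 := sq_emod_eight (x := w.num) (by grind)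
    omega
  have hd0 : (w.den : ℚ) ≠ 0 := Nat.cast_ne_zero.2 w.den_nz
  have hw2 : 1 - w ^ 2 = (w.den ^ 2 - w.num ^ 2 : ℤ) / (w.den : ℚ) ^ 2 := by
    push_cast
    rw [← Rat.mul_den_eq_num w]
    field_simp
  rw [hw2, padicNorm.div, padicNorm_sq, hden, one_pow, div_one]
  exact padicNorm_two_le_iff.2 hsub

/-- If `m w ^ 2 = k + 8 z`, then `w` is a `2`-adic unit and `m - k = m (1 - w ^ 2) + 8 z`. -/
theorem eight_dvd_sub_of_congTwo {m : ℤ} {k : ℕ} (hm : Odd m) (hk : Odd k) {w : ℚ}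
    (h : CongTwo (m * w ^ 2) k) : 8 ∣ m - k := by
  obtain ⟨z, hz, hmw⟩ := h
  have hm1 := padicNorm_two_eq_one_of_odd hm
  have hk1 : padicNorm 2 k = 1 := by
    exact_mod_cast padicNorm_two_eq_one_of_odd (n := k) (by exact_mod_cast hk)
  have hz8 : padicNorm 2 (8 * z) ≤ 2 ^ (-3 : ℤ) := by
    rw [padicNorm.mul]
    exact (mul_le_of_le_one_right (padicNorm.nonneg _) (padicNorm_le_one_iff.2 hz)).trans
      (by exact_mod_cast padicNorm_two_le_iff.2 (dvd_refl 8))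
  have hw : padicNorm 2 w = 1 := by
    have hlt : padicNorm 2 (8 * z) < 1 := hz8.trans_lt (by norm_num)
    have hnorm := congrArg (padicNorm 2) hmw
    rw [padicNorm.mul, hm1, one_mul, padicNorm_sq,
      padicNorm.add_eq_max_of_ne (by rw [hk1]; exact hlt.ne'), hk1, max_eq_left hlt.le] at hnorm
    exact (pow_eq_one_iff_of_nonneg (padicNorm.nonneg w) two_ne_zero).1 hnorm
  rw [← padicNorm_two_le_iff,
    show ((m - k : ℤ) : ℚ) = m * (1 - w ^ 2) + 8 * z by push_cast; linear_combination hmw]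
  exact padicNorm_add_le (padicNorm_int_mul_le m (padicNorm_two_one_sub_sq_le hw)) hz8

theorem odd_padicValRat_squarefree_mul_sq {l : ℕ} [Fact l.Prime] {m : ℤ} (hm : Squarefree m)
    (h : (l : ℤ) ∣ m) {w : ℚ} (hw : w ≠ 0) : Odd (padicValRat l (m * w ^ 2)) := by
  rw [padicValRat.mul (Int.cast_ne_zero.2 hm.ne_zero) (pow_ne_zero 2 hw), padicValRat.pow,
    padicValRat.of_int, padicValInt_eq_one_of_squarefree Fact.out hm h]
  exact ⟨padicValRat l w, by push_cast; ring⟩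

theorem exists_squarefree_of_mem_Φ {k : ℕ} (hk : k = 1 ∨ k = 3) {p : ℚ} (hp : p ∈ Φ k) :
    ∃ (P : ℕ) (w : ℚ), w ≠ 0 ∧ p = (P : ℤ) * w ^ 2 ∧ Squarefree P ∧ P % 8 = k ∧
      ∀ l : ℕ, l.Prime → l ∣ P → l % 8 = 1 ∨ l % 8 = k := by
  obtain ⟨hp0, hcong, hodd⟩ := hp
  obtain ⟨m, w, rfl, hm, hw⟩ := exists_eq_squarefree_mul_sq hp0
  have hprimes : ∀ l : ℕ, l.Prime → l ∣ m.natAbs → l % 8 = 1 ∨ l % 8 = k := fun l hl hlm => by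
    have := Fact.mk hl
    simpa only [Nat.ModEq, Nat.mod_eq_of_lt (by omega : k < 8)] using
      hodd l ⟨hl, odd_padicValRat_squarefree_mul_sq hm (Int.natCast_dvd.2 hlm) hw⟩
  have hm8 := mod_eight_of_prime_factors hk (Int.natAbs_ne_zero.2 hm.ne_zero) hprimes
  have hmk := eight_dvd_sub_of_congTwo (Int.odd_iff.2 (by omega)) (Nat.odd_iff.2 (by omega)) hcong
  have hpos : (m.natAbs : ℤ) = m := by omega
  exact ⟨m.natAbs, w, hw, by rw [hpos], Int.squarefree_natAbs.2 hm, by omega, hprimes⟩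

/-! ### The rings `T (±2pq) q` and `R1 p q` -/

section

variable {P Q : ℕ} {c : ℤ}

theorem odd_padicValInt_two (hP : Odd P) (hc : c.natAbs = 2 * P) : Odd (padicValInt 2 c) := by
  have hP0 : P ≠ 0 := hP.pos.ne'
  rw [padicValInt, hc, padicValNat.mul two_ne_zero hP0, padicValNat_self,
    padicValNat.eq_zero_of_not_dvd hP.not_two_dvd_nat]
  exact odd_one

theorem oddPrimeFactors_mul_of_natAbs_eq (hP : Odd P) (hQ : Odd Q) (hc : c.natAbs = 2 * P) :
    oddPrimeFactors (Q * c) = (Q * P).primeFactors := by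
  have hodd : 2 ∉ (Q * P).primeFactors := fun h =>
    (hQ.mul hP).not_two_dvd_nat (Nat.dvd_of_mem_primeFactors h)
  rw [oddPrimeFactors, Int.natAbs_mul, Int.natAbs_natCast, hc, mul_left_comm,
    Nat.primeFactors_mul two_ne_zero (hQ.mul hP).pos.ne', Nat.prime_two.primeFactors,
    ← Finset.insert_eq, Finset.erase_insert hodd]

theorem prod_hilbertSymbol_two_mul (hP8 : P % 8 = 1) (hQ8 : Q % 8 = 3) :
    ∏ l ∈ (Q * P).primeFactors, hilbertSymbol l Q (2 * P) = -1 := by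
  have hQodd : Odd Q := Nat.odd_iff.2 (by omega)
  have hPodd : Odd P := Nat.odd_iff.2 (by omega)
  have hprime : ∀ l ∈ (Q * P).primeFactors, l.Prime ∧ l ≠ 2 := fun l hl =>
    ⟨Nat.prime_of_mem_primeFactors hl, by
      rintro rfl
      exact (hQodd.mul hPodd).not_two_dvd_nat (Nat.dvd_of_mem_primeFactors hl)⟩
  have hfac := Nat.primeFactors_mul hQodd.pos.ne' hPodd.pos.ne'
  have hQfac : Q.primeFactors ⊆ (Q * P).primeFactors := hfac ▸ Finset.subset_union_left
  have hPfac : P.primeFactors ⊆ (Q * P).primeFactors := hfac ▸ Finset.subset_union_right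
  have hsplit : ∀ l ∈ (Q * P).primeFactors,
      hilbertSymbol l Q (2 * P) = hilbertSymbol l Q 2 * hilbertSymbol l P Q := fun l hl => by
    rw [hilbertSymbol_mul_right (hprime l hl).1 _ two_ne_zero
      (Int.natCast_ne_zero.2 hPodd.pos.ne'), hilbertSymbol_comm l P]
  have hPQ : ∏ l ∈ (Q * P).primeFactors, hilbertSymbol l P Q = 1 := by
    rw [prod_hilbertSymbol hprime (by omega) hPfac (Int.natCast_ne_zero.2 hQodd.pos.ne')
      ((Finset.erase_subset _ _).trans hQfac), ZMod.χ₈_nat_mod_eight, hP8]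
    exact one_pow _
  have hQ2 : ∏ l ∈ (Q * P).primeFactors, hilbertSymbol l Q 2 = -1 := by
    rw [prod_hilbertSymbol_two hprime hQodd hQfac, ZMod.χ₈_nat_mod_eight, hQ8]
    decide
  rw [Finset.prod_congr rfl hsplit, Finset.prod_mul_distrib, hPQ, hQ2, mul_one]

theorem prod_hilbertSymbol_neg_two_mul (hP8 : P % 8 = 1) (hQ8 : Q % 8 = 3) :
    ∏ l ∈ (Q * P).primeFactors, hilbertSymbol l Q (-(2 * P)) = 1 := by
  have hP0 : (2 * P : ℤ) ≠ 0 := by omega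
  have hsplit : ∀ l ∈ (Q * P).primeFactors, hilbertSymbol l Q (-(2 * P)) =
      hilbertSymbol l Q (-1) * hilbertSymbol l Q (2 * P) := fun l hl => by
    rw [← hilbertSymbol_mul_right (Nat.prime_of_mem_primeFactors hl) _ (by norm_num) hP0,
      neg_one_mul]
  rw [Finset.prod_congr rfl hsplit, Finset.prod_mul_distrib, prod_hilbertSymbol_two_mul hP8 hQ8,
    prod_hilbertSymbol_neg_one (fun l => Nat.prime_of_mem_primeFactors) (Nat.odd_iff.2 (by omega))
      (Nat.primeFactors_mono (dvd_mul_right _ _) (mul_ne_zero (by omega) (by omega))),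
    ZMod.χ₄_nat_three_mod_four (by omega)]
  norm_num

theorem padicNorm_le_one_of_mem_S_of_mem_oddRamified {c q : ℤ} (hc : Squarefree c)
    (hq : Squarefree q) {t : ℚ} (ht : t ∈ S c q) {l : ℕ} (hl : l ∈ oddRamified q c) :
    padicNorm l t ≤ 1 :=
  have := Fact.mk (prime_of_mem_oddRamified hl).1
  padicNorm_le_one_of_mem_S_of_hilbertSymbol hc hq (Finset.mem_filter.1 hl).2 ht

theorem T_neg_two_mul (hP8 : P % 8 = 1) (hQ8 : Q % 8 = 3) (hP : Squarefree (-(2 * P) : ℤ))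
    (hQ : Squarefree (Q : ℤ)) :
    T (-(2 * P) : ℤ) (Q : ℤ) = adicBall (oddRamified Q (-(2 * P))) 0 := by
  have hPodd : Odd P := Nat.odd_iff.2 (by omega)
  have habs : (-(2 * P) : ℤ).natAbs = 2 * P := by omega
  refine (T_subset_adicBall (fun l hl => (prime_of_mem_oddRamified hl).1) fun t ht l =>
    padicNorm_le_one_of_mem_S_of_mem_oddRamified hP hQ ht).antisymm fun t ht => ?_
  refine mem_T_of_prod_eq_one (by omega) (odd_padicValInt_two hPodd habs) (by omega) ?_
    fun l hl => ?_
  · rw [oddPrimeFactors_mul_of_natAbs_eq hPodd (Nat.odd_iff.2 (by omega)) habs,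
      prod_hilbertSymbol_neg_two_mul hP8 hQ8]
  · have := Fact.mk (prime_of_mem_oddRamified hl).1
    exact padicNorm_le_one_iff.1 (mem_adicBall_zero.1 ht l hl)

theorem prime_of_mem_insert_oddRamified {q c : ℤ} : ∀ l ∈ insert 2 (oddRamified q c), l.Prime :=
  Finset.forall_mem_insert _ _ _ |>.2 ⟨Nat.prime_two, fun _ hl => (prime_of_mem_oddRamified hl).1⟩

theorem T_two_mul (hP8 : P % 8 = 1) (hQ8 : Q % 8 = 3) (hP : Squarefree (2 * P : ℤ))
    (hQ : Squarefree (Q : ℤ)) :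
    T (2 * P : ℤ) (Q : ℤ) = adicBall (insert 2 (oddRamified Q (2 * P))) 0 := by
  have hPodd : Odd P := Nat.odd_iff.2 (by omega)
  have habs : (2 * P : ℤ).natAbs = 2 * P := by omega
  refine (T_subset_adicBall prime_of_mem_insert_oddRamified fun t ht =>
    (Finset.forall_mem_insert _ _ _).2 ⟨padicNorm_two_le_one_of_mem_S (by omega) (by omega) ht,
      fun l => padicNorm_le_one_of_mem_S_of_mem_oddRamified hP hQ ht⟩).antisymm fun t ht => ?_
  have hden : ∀ l ∈ insert 2 (oddRamified Q (2 * P)), ¬ l ∣ t.den := fun l hl =>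
    have := Fact.mk (prime_of_mem_insert_oddRamified l hl)
    padicNorm_le_one_iff.1 (mem_adicBall_zero.1 ht l hl)
  rw [Finset.forall_mem_insert] at hden
  refine mem_T_of_prod_eq_neg_one (by omega) (odd_padicValInt_two hPodd habs) (by omega) ?_ hden.1
    hden.2
  rw [oddPrimeFactors_mul_of_natAbs_eq hPodd (Nat.odd_iff.2 (by omega)) habs,
    prod_hilbertSymbol_two_mul hP8 hQ8]

end

theorem T_neg_mul_sq (c : ℚ) {b w v : ℚ} (hb : b ≠ 0) (hw : w ≠ 0) (hv : v ≠ 0) :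
    T (-(c * w ^ 2 * (b * v ^ 2))) (b * v ^ 2) = T c b := by
  rw [T, T, S_neg_mul _ (mul_ne_zero hb (pow_ne_zero 2 hv)), S_mul_sq_left _ _ hw,
    S_mul_sq_right _ _ hv]

theorem J_neg_mul_sq_eq_adicBall {Δ : Finset ℕ} (hΔ : ∀ l ∈ Δ, l.Prime) {c q : ℤ}
    (hc : Squarefree c) (hq : Squarefree q) {w v : ℚ} (hw : w ≠ 0) (hv : v ≠ 0)
    (hT : T c q = adicBall Δ 0) (hdvd : ∀ l ∈ Δ, (l : ℤ) ∣ q * c) :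
    J (-(c * w ^ 2 * (q * v ^ 2))) (q * v ^ 2) = adicBall Δ 1 := by
  have hc0 : c * w ^ 2 ≠ 0 := mul_ne_zero (Int.cast_ne_zero.2 hc.ne_zero) (pow_ne_zero 2 hw)
  have hq0 : q * v ^ 2 ≠ 0 := mul_ne_zero (Int.cast_ne_zero.2 hq.ne_zero) (pow_ne_zero 2 hv)
  refine J_eq_adicBall hΔ ?_ (neg_ne_zero.2 (mul_ne_zero hc0 hq0)) hq0 fun l hl =>
    or_iff_not_imp_right.2 fun heven => ?_
  · rw [T_neg_mul_sq _ (Int.cast_ne_zero.2 hq.ne_zero) hw hv, hT]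
  have := Fact.mk (hΔ l hl)
  have hlc : (l : ℤ) ∣ c :=
    ((Nat.prime_iff_prime_int.1 (hΔ l hl)).dvd_or_dvd (hdvd l hl)).resolve_left
      fun hlq => heven (odd_padicValRat_squarefree_mul_sq hq hlq hv)
  rw [padicValRat.neg, padicValRat.mul hc0 hq0]
  exact (odd_padicValRat_squarefree_mul_sq hc hlc hw).add_even (Int.not_odd_iff_even.1 heven)

/-- The symbols `(Q, 2P)` have product `-1` over the odd primes, so the algebra `(Q, 2P)` is
ramified at some odd prime `l`. If `l ≡ 1 mod 8`, then `-1` is a square modulo `l`, so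
`(Q, -2P)` is ramified at `l` too. -/
theorem oddRamified_inter_nonempty {P Q : ℕ} (hP8 : P % 8 = 1) (hQ8 : Q % 8 = 3)
    (hPl : ∀ l : ℕ, l.Prime → l ∣ P → l % 8 = 1)
    (hQl : ∀ l : ℕ, l.Prime → l ∣ Q → l % 8 = 1 ∨ l % 8 = 3)
    (hsq : ∀ l : ℕ, l.Prime → l ∣ Q → l % 8 = 3 → ¬ (l : ℤ) ∣ 2 * P → jacobiSym (2 * P) l = 1) :
    (oddRamified Q (-(2 * P)) ∩ insert 2 (oddRamified Q (2 * P))).Nonempty := by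
  have hPodd : Odd P := Nat.odd_iff.2 (by omega)
  have hQodd : Odd Q := Nat.odd_iff.2 (by omega)
  have hP0 : (2 * P : ℤ) ≠ 0 := by omega
  obtain ⟨l, hl, hne⟩ : ∃ l ∈ (Q * P).primeFactors, hilbertSymbol l Q (2 * P) ≠ 1 :=
    Finset.exists_ne_one_of_prod_ne_one
      (by rw [prod_hilbertSymbol_two_mul hP8 hQ8]; norm_num)
  have hlp := Nat.prime_of_mem_primeFactors hl
  have hneg := (hilbertSymbol_eq_one_or hlp (by omega) hP0).resolve_left hne
  have hlodd : Odd l := (hQodd.mul hPodd).of_dvd_nat (Nat.dvd_of_mem_primeFactors hl)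
  have hl8 : l % 8 = 1 := by
    by_cases hlP : (l : ℤ) ∣ 2 * P
    · refine hPl l hlp ((hlp.dvd_mul.1 (by exact_mod_cast hlP)).resolve_left fun h2 => ?_)
      exact hlodd.not_two_dvd_nat ((Nat.prime_dvd_prime_iff_eq hlp Nat.prime_two).1 h2 ▸ dvd_rfl)
    · have hlQ : l ∣ Q := (hlp.dvd_mul.1 (Nat.dvd_of_mem_primeFactors hl)).resolve_right
        fun h => hlP (Dvd.dvd.mul_left (Int.natCast_dvd_natCast.2 h) 2)
      refine (hQl l hlp hlQ).resolve_right fun hl3 => hne ?_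
      rw [hilbertSymbol_of_not_dvd_right _ hlP, hsq l hlp hlQ hl3 hlP, one_pow]
  have hm1 : hilbertSymbol l Q (-1) = 1 := by
    rw [hilbertSymbol_of_not_dvd_right _ (by rw [dvd_neg]; exact_mod_cast hlp.not_dvd_one),
      jacobiSym.at_neg_one hlodd, ZMod.χ₄_nat_one_mod_four (by omega), one_pow]
  refine ⟨l, Finset.mem_inter.2 ⟨Finset.mem_filter.2 ⟨?_, ?_⟩,
    Finset.mem_insert_of_mem (Finset.mem_filter.2 ⟨?_, hneg⟩)⟩⟩
  · rwa [oddPrimeFactors_mul_of_natAbs_eq hPodd hQodd (by omega)]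
  · rw [← neg_one_mul, hilbertSymbol_mul_right hlp _ (by norm_num) hP0, hm1, one_mul, hneg]
  · rwa [oddPrimeFactors_mul_of_natAbs_eq hPodd hQodd (by omega)]

theorem jacobiSym_two_mul_eq_one_of_mem_jacobsonRadical {l : ℕ} [Fact l.Prime] (hl8 : l % 8 = 3)
    {n : ℤ} (hn : ¬ (l : ℤ) ∣ 2 * n) {q w u j : ℚ} (hq : q ≠ 0) (hv : Odd (padicValRat l q))
    (hw : w ≠ 0) (hj : j ∈ jacobsonRadical (R3 q)) (h : n * w ^ 2 = 2 * u ^ 2 * (1 + j)) :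
    jacobiSym (2 * n) l = 1 := by
  have hlj := jacobsonRadical_subset_adicBall_one (forall_prime_singleton Fact.out)
    (R3_subset_adicBall hl8 hq hv) hj l (Finset.mem_singleton_self l)
  refine jacobiSym_eq_one_of_eq_sq_mul hn (padicNorm_le_zpow_neg_one_iff.1 hlj)
    (r := 2 * u / w) ?_
  push_cast
  field_simp
  linear_combination h

theorem exists_adicBall_of_mem_Ψ {p q : ℚ} (h : (p, q) ∈ Ψ) :
    ∃ Δ : Finset ℕ, (∀ l ∈ Δ, l.Prime) ∧ Δ.Nonempty ∧ R1 p q = adicBall Δ 0 ∧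
      J (2 * p * q) q + J (-2 * p * q) q = adicBall Δ 1 := by
  obtain ⟨hpΦ, hqΦ, u, -, j, hj, hpj⟩ := h
  obtain ⟨P, w, hw, rfl, hPs, hP8, hPl⟩ := exists_squarefree_of_mem_Φ (.inl rfl) hpΦ
  obtain ⟨Q, v, hv, rfl, hQs, hQ8, hQl⟩ := exists_squarefree_of_mem_Φ (.inr rfl) hqΦ
  have hQs' : Squarefree (Q : ℤ) := Int.squarefree_natCast.2 hQs
  have hPs' : Squarefree (2 * P : ℤ) := by
    exact_mod_cast Int.squarefree_natCast.2 ((Nat.squarefree_mul_iff).2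
      ⟨Nat.coprime_two_left.2 (Nat.odd_iff.2 (by omega)), Nat.squarefree_two, hPs⟩)
  have hPneg : Squarefree (-(2 * P) : ℤ) := (Associated.neg_left (.refl _)).squarefree_iff.2 hPs'
  have hΔ₁ : ∀ l ∈ oddRamified Q (-(2 * P)), l.Prime := fun l hl =>
    (prime_of_mem_oddRamified hl).1
  have hΔ₂ := prime_of_mem_insert_oddRamified (q := Q) (c := 2 * P)
  have hpq : 2 * ((P : ℤ) * w ^ 2 : ℚ) * ((Q : ℤ) * v ^ 2) =
    -(((-(2 * P) : ℤ) : ℚ) * w ^ 2 * ((Q : ℤ) * v ^ 2)) := by push_cast; ring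
  have hpq' : -2 * ((P : ℤ) * w ^ 2 : ℚ) * ((Q : ℤ) * v ^ 2) =
    -(((2 * P : ℤ) : ℚ) * w ^ 2 * ((Q : ℤ) * v ^ 2)) := by push_cast; ring
  have hQ0 : ((Q : ℤ) : ℚ) ≠ 0 := Int.cast_ne_zero.2 hQs'.ne_zero
  have hdvd : ∀ {c : ℤ}, ∀ l ∈ oddRamified Q c, (l : ℤ) ∣ Q * c := fun l hl =>
    (mem_oddPrimeFactors.1 (Finset.mem_filter.1 hl).1).2.2.1
  refine ⟨oddRamified Q (-(2 * P)) ∩ insert 2 (oddRamified Q (2 * P)),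
    fun l hl => hΔ₁ l (Finset.mem_inter.1 hl).1, ?_, ?_, ?_⟩
  · refine oddRamified_inter_nonempty hP8 hQ8 (by simpa using hPl) hQl fun l hl hlQ hl8 hlP => ?_
    have := Fact.mk hl
    exact jacobiSym_two_mul_eq_one_of_mem_jacobsonRadical hl8 hlP hqΦ.1
      (odd_padicValRat_squarefree_mul_sq hQs' (Int.natCast_dvd_natCast.2 hlQ) hv) hw hj hpj
  · rw [R1, hpq, hpq', T_neg_mul_sq _ hQ0 hw hv, T_neg_mul_sq _ hQ0 hw hv,
      T_neg_two_mul hP8 hQ8 hPneg hQs', T_two_mul hP8 hQ8 hPs' hQs', adicBall_add hΔ₁ hΔ₂]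
  · rw [hpq, hpq', J_neg_mul_sq_eq_adicBall hΔ₁ hPneg hQs' hw hv
      (T_neg_two_mul hP8 hQ8 hPneg hQs') hdvd, J_neg_mul_sq_eq_adicBall hΔ₂ hPs' hQs' hw hv
      (T_two_mul hP8 hQ8 hPs' hQs') ((Finset.forall_mem_insert _ _ _).2
        ⟨Dvd.dvd.mul_left (dvd_mul_right _ _) _, hdvd⟩), adicBall_add hΔ₁ hΔ₂]

theorem jacobsonRadical_R1_eq {p q : ℚ} (h : (p, q) ∈ Ψ) :
    jacobsonRadical (R1 p q) = J (2 * p * q) q + J (-2 * p * q) q := by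
  obtain ⟨Δ, hΔ, hne, hR, hJ⟩ := exists_adicBall_of_mem_Ψ h
  rw [hR, hJ, jacobsonRadical_adicBall hΔ hne]

/-! ### Diophantine predicates -/

open MvPolynomial

/-- A predicate on rational points that is diophantine in `ℚ`. Coordinates and witnesses are
indexed by arbitrary types, finite for the witnesses, so that existential quantifiers can be
absorbed without renumbering variables. -/
def DiophPred {α : Type*} (p : (α → ℚ) → Prop) : Prop :=
  ∃ (β : Type) (_ : Finite β) (f : MvPolynomial (α ⊕ β) ℤ),
    ∀ t : α → ℚ, p t ↔ ∃ x : β → ℚ, aeval (Sum.elim t x) f = 0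

namespace DiophPred

variable {α : Type*}

theorem congr {p p' : (α → ℚ) → Prop} (hp : DiophPred p) (h : ∀ t, p t ↔ p' t) : DiophPred p' :=
  funext (fun t => propext (h t)) ▸ hp

theorem eq (f g : MvPolynomial α ℤ) : DiophPred fun t : α → ℚ => aeval t f = aeval t g :=
  ⟨Empty, inferInstance, rename Sum.inl (f - g), fun t => by
    simp [aeval_rename, Sum.elim_comp_inl, sub_eq_zero]⟩

theorem and {p p' : (α → ℚ) → Prop} (hp : DiophPred p) (hp' : DiophPred p') :
    DiophPred fun t => p t ∧ p' t := by
  obtain ⟨β, _, f, hf⟩ := hp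
  obtain ⟨β', _, g, hg⟩ := hp'
  refine ⟨β ⊕ β', inferInstance, rename (Sum.map id Sum.inl) f ^ 2 +
    rename (Sum.map id Sum.inr) g ^ 2, fun t => ?_⟩
  have hzero : ∀ x : β ⊕ β' → ℚ, aeval (Sum.elim t x) (rename (Sum.map id Sum.inl) f ^ 2 +
      rename (Sum.map id Sum.inr) g ^ 2) = 0 ↔
      aeval (Sum.elim t (x ∘ Sum.inl)) f = 0 ∧ aeval (Sum.elim t (x ∘ Sum.inr)) g = 0 := fun x => by
    rw [map_add, map_pow, map_pow, aeval_rename, aeval_rename, Sum.elim_comp_map,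
      Sum.elim_comp_map, Function.comp_id, add_eq_zero_iff_of_nonneg (sq_nonneg _) (sq_nonneg _),
      sq_eq_zero_iff, sq_eq_zero_iff]
  simp only [hzero, hf, hg]
  constructor
  · rintro ⟨⟨x, hx⟩, y, hy⟩
    exact ⟨Sum.elim x y, by simpa using ⟨hx, hy⟩⟩
  · rintro ⟨x, hx, hy⟩
    exact ⟨⟨_, hx⟩, _, hy⟩

theorem ex {γ : Type} [Finite γ] {p : (α ⊕ γ → ℚ) → Prop} (hp : DiophPred p) :
    DiophPred fun t => ∃ x : γ → ℚ, p (Sum.elim t x) := by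
  obtain ⟨β, _, f, hf⟩ := hp
  refine ⟨γ ⊕ β, inferInstance, rename (Equiv.sumAssoc α γ β) f, fun t => ?_⟩
  have hassoc : ∀ (x : γ → ℚ) (y : β → ℚ), Sum.elim t (Sum.elim x y) ∘ Equiv.sumAssoc α γ β =
      Sum.elim (Sum.elim t x) y := fun x y => by ext ((_ | _) | _) <;> rfl
  simp only [hf, aeval_rename]
  constructor
  · rintro ⟨x, y, h⟩
    exact ⟨Sum.elim x y, by rwa [hassoc]⟩
  · rintro ⟨x, h⟩
    refine ⟨x ∘ Sum.inl, x ∘ Sum.inr, ?_⟩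
    rwa [← hassoc, Sum.elim_comp_inl_inr]

theorem isDiophantine {k : ℕ} {p : (Fin k → ℚ) → Prop} (hp : DiophPred p) :
    IsDiophantine {t | p t} := by
  obtain ⟨β, _, f, hf⟩ := hp
  obtain ⟨n, ⟨e⟩⟩ := Finite.exists_equiv_fin β
  refine ⟨n, rename (Sum.map id e) f, fun t => ?_⟩
  simp only [Set.mem_ofPred_eq, hf, aeval_rename, Sum.elim_comp_map, Function.comp_id]
  exact (e.arrowCongr (.refl ℚ)).symm.surjective.exists

theorem mem_S (a b t : MvPolynomial α ℤ) :
    DiophPred fun v : α → ℚ => aeval v t ∈ S (aeval v a) (aeval v b) := by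
  have h := ((eq (α := α ⊕ Fin 4)
    (X (Sum.inr 0) ^ 2 - rename Sum.inl a * X (Sum.inr 1) ^ 2 -
      rename Sum.inl b * X (Sum.inr 2) ^ 2 +
      rename Sum.inl a * rename Sum.inl b * X (Sum.inr 3) ^ 2) 1).and
    (eq (rename Sum.inl t) (2 * X (Sum.inr 0)))).ex
  refine h.congr fun v => ?_
  simp only [map_sub, map_add, map_mul, map_pow, aeval_X, aeval_rename, Sum.elim_comp_inl,
    Sum.elim_inr, map_one, map_ofNat]
  constructor
  · rintro ⟨x, h₁, h₂⟩
    exact ⟨_, _, _, _, h₁, h₂⟩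
  · rintro ⟨x₁, x₂, x₃, x₄, h₁, h₂⟩
    exact ⟨![x₁, x₂, x₃, x₄], h₁, h₂⟩

theorem mem_add {A B : (α → ℚ) → Set ℚ}
    (hA : DiophPred fun v : α ⊕ Fin 2 → ℚ => v (Sum.inr 0) ∈ A (v ∘ Sum.inl))
    (hB : DiophPred fun v : α ⊕ Fin 2 → ℚ => v (Sum.inr 1) ∈ B (v ∘ Sum.inl))
    (t : MvPolynomial α ℤ) : DiophPred fun v : α → ℚ => aeval v t ∈ A v + B v := by
  refine ((hA.and hB).and (eq (X (Sum.inr 0) + X (Sum.inr 1)) (rename Sum.inl t))).ex.congr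
    fun v => ?_
  simp only [map_add, aeval_X, aeval_rename, Sum.elim_comp_inl, Sum.elim_inr, Set.mem_add]
  constructor
  · rintro ⟨x, ⟨h₁, h₂⟩, h₃⟩
    exact ⟨_, h₁, _, h₂, h₃⟩
  · rintro ⟨x, h₁, y, h₂, h₃⟩
    exact ⟨![x, y], ⟨h₁, h₂⟩, h₃⟩

theorem mem_T (a b t : MvPolynomial α ℤ) :
    DiophPred fun v : α → ℚ => aeval v t ∈ T (aeval v a) (aeval v b) := by
  have h := fun i : Fin 2 => mem_S (rename Sum.inl a) (rename Sum.inl b)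
    (X (Sum.inr i) : MvPolynomial (α ⊕ Fin 2) ℤ)
  simp only [aeval_X, aeval_rename] at h
  exact mem_add (h 0) (h 1) t

theorem mem_TUnits (a b t : MvPolynomial α ℤ) :
    DiophPred fun v : α → ℚ => aeval v t ∈ TUnits (aeval v a) (aeval v b) := by
  have h := (mem_T a b t).and (((mem_T (α := α ⊕ Fin 1) (rename Sum.inl a) (rename Sum.inl b)
    (X (Sum.inr 0))).and (eq (rename Sum.inl t * X (Sum.inr 0)) 1)).ex)
  refine h.congr fun v => ?_
  simp only [map_mul, aeval_X, aeval_rename, Sum.elim_comp_inl, Sum.elim_inr, map_one]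
  refine and_congr_right fun _ => ⟨?_, ?_⟩
  · rintro ⟨x, h₁, h₂⟩
    exact ⟨_, h₁, h₂⟩
  · rintro ⟨x, h₁, h₂⟩
    exact ⟨![x], h₁, h₂⟩

theorem mem_sqClass (a b c t : MvPolynomial α ℤ) :
    DiophPred fun v : α → ℚ => aeval v t ∈ sqClass (aeval v a) (aeval v b) (aeval v c) := by
  have h := ((mem_TUnits (α := α ⊕ Fin 2) (rename Sum.inl a) (rename Sum.inl b)
    (X (Sum.inr 1))).and (eq (rename Sum.inl t)
      (rename Sum.inl c * X (Sum.inr 0) ^ 2 * X (Sum.inr 1)))).ex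
  refine h.congr fun v => ?_
  simp only [map_mul, map_pow, aeval_X, aeval_rename, Sum.elim_comp_inl, Sum.elim_inr]
  constructor
  · rintro ⟨x, h₁, h₂⟩
    exact ⟨_, _, h₁, h₂⟩
  · rintro ⟨w, u, h₁, h₂⟩
    exact ⟨![w, u], h₁, h₂⟩

theorem mem_K (a b c t : MvPolynomial α ℤ) :
    DiophPred fun v : α → ℚ => aeval v t ∈ K (aeval v a) (aeval v b) (aeval v c) := by
  have h := (mem_sqClass a b c t).and (((mem_sqClass (α := α ⊕ Fin 1) (rename Sum.inl a)
    (rename Sum.inl b) 1 (X (Sum.inr 0))).and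
      (eq (rename Sum.inl t) (1 - X (Sum.inr 0)))).ex)
  refine h.congr fun v => ?_
  simp only [map_sub, aeval_X, aeval_rename, Sum.elim_comp_inl, Sum.elim_inr, map_one]
  refine and_congr_right fun _ => ⟨?_, ?_⟩
  · rintro ⟨x, h₁, h₂⟩
    exact ⟨_, h₁, h₂⟩
  · rintro ⟨x, h₁, h₂⟩
    exact ⟨![x], h₁, h₂⟩

theorem mem_J (a b t : MvPolynomial α ℤ) :
    DiophPred fun v : α → ℚ => aeval v t ∈ J (aeval v a) (aeval v b) := by
  have hK := fun c y : MvPolynomial (α ⊕ Fin 2) ℤ =>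
    mem_K (rename Sum.inl a) (rename Sum.inl b) c y
  have h := (((hK (rename Sum.inl a) (X (Sum.inr 0))).and
    (hK (rename Sum.inl a) (rename Sum.inl t - X (Sum.inr 0)))).and
    ((hK (rename Sum.inl b) (X (Sum.inr 1))).and
    (hK (rename Sum.inl b) (rename Sum.inl t - X (Sum.inr 1))))).ex
  refine h.congr fun v => ?_
  simp only [map_sub, aeval_X, aeval_rename, Sum.elim_comp_inl, Sum.elim_inr]
  constructor
  · rintro ⟨x, h⟩
    exact ⟨_, _, h⟩
  · rintro ⟨x, y, h⟩
    exact ⟨![x, y], h⟩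

theorem mem_J_add_J (a b c d t : MvPolynomial α ℤ) :
    DiophPred fun v : α → ℚ => aeval v t ∈ J (aeval v a) (aeval v b) +
      J (aeval v c) (aeval v d) := by
  have h := fun (a b : MvPolynomial α ℤ) (i : Fin 2) => mem_J (rename Sum.inl a) (rename Sum.inl b)
    (X (Sum.inr i) : MvPolynomial (α ⊕ Fin 2) ℤ)
  simp only [aeval_X, aeval_rename] at h
  exact mem_add (h a b 0) (h c d 1) t

/-- A rational parameter `r` is pinned down by the equation `y * r.den = r.num`, which has integer
coefficients. -/
theorem specialize {p : (α ⊕ Fin 1 → ℚ) → Prop} (hp : DiophPred p) (r : ℚ) :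
    DiophPred fun t => p (Sum.elim t ![r]) := by
  refine (hp.and (eq (X (Sum.inr 0) * C (r.den : ℤ)) (C r.num))).ex.congr fun t => ?_
  have hden : (r.den : ℚ) ≠ 0 := Nat.cast_ne_zero.2 r.den_nz
  simp only [map_mul, aeval_X, Sum.elim_inr, eq_intCast, map_intCast, map_natCast]
  constructor
  · rintro ⟨x, h, hx⟩
    rw [← Rat.mul_den_eq_num r, mul_left_inj' hden] at hx
    rwa [show x = ![r] from funext (Fin.forall_fin_one.2 hx)] at h
  · exact fun h => ⟨![r], h, Rat.mul_den_eq_num r⟩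

end DiophPred

theorem isDiophantine_J_add_J :
    IsDiophantine {v : Fin 3 → ℚ | v 0 ∈ J (2 * v 1 * v 2) (v 2) + J (-2 * v 1 * v 2) (v 2)} := by
  have h := DiophPred.mem_J_add_J (2 * X 1 * X 2) (X 2) (-2 * X 1 * X 2) (X 2)
    (X 0 : MvPolynomial (Fin 3) ℤ)
  simp only [map_mul, map_neg, map_ofNat, aeval_X] at h
  exact h.isDiophantine

theorem isDiophantine_mem_J_add_J (a b c d : ℚ) :
    IsDiophantine {v : Fin 1 → ℚ | v 0 ∈ J a b + J c d} := by
  have h := DiophPred.mem_J_add_J (X (.inl (.inl (.inl (.inr 0))))) (X (.inl (.inl (.inr 0))))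
    (X (.inl (.inr 0))) (X (.inr 0))
    (X (.inl (.inl (.inl (.inl 0)))) : MvPolynomial ((((Fin 1 ⊕ Fin 1) ⊕ Fin 1) ⊕ Fin 1) ⊕ Fin 1) ℤ)
  simp only [aeval_X] at h
  exact ((((h.specialize d).specialize c).specialize b).specialize a).isDiophantine

end RatDioph

theorem mainTheorem9 :
    (∀ p q : ℚ, (p, q) ∈ RatDioph.Ψ →
      (∃ A : Subring ℚ, (A : Set ℚ) = RatDioph.R1 p q) ∧
      RatDioph.R1 p q ≠ Set.univ ∧
      RatDioph.jacobsonRadical (RatDioph.R1 p q) =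
        RatDioph.J (2 * p * q) q + RatDioph.J (-2 * p * q) q ∧
      RatDioph.IsDiophantine
        {t : Fin 1 → ℚ | t 0 ∈ RatDioph.jacobsonRadical (RatDioph.R1 p q)}) ∧
    (∃ D : Set (Fin 3 → ℚ), RatDioph.IsDiophantine D ∧
      ∀ p q : ℚ, (p, q) ∈ RatDioph.Ψ → ∀ t : ℚ,
        t ∈ RatDioph.jacobsonRadical (RatDioph.R1 p q) ↔ ![t, p, q] ∈ D) := by
  refine ⟨fun p q h => ?_, _, RatDioph.isDiophantine_J_add_J, fun p q h t => ?_⟩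
  · obtain ⟨Δ, hΔ, hne, hR, -⟩ := RatDioph.exists_adicBall_of_mem_Ψ h
    refine ⟨⟨RatDioph.semilocalRing Δ hΔ, hR.symm⟩, hR ▸ RatDioph.adicBall_zero_ne_univ hΔ hne,
      RatDioph.jacobsonRadical_R1_eq h, ?_⟩
    rw [RatDioph.jacobsonRadical_R1_eq h]
    exact RatDioph.isDiophantine_mem_J_add_J _ _ _ _
  · rw [RatDioph.jacobsonRadical_R1_eq h]
    rfl
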